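/- Let $(W,S)$ be a Coxeter system with Coxeter matrix $(m_{st})$, and order $W$ by the Bruhat order; write $u \lhd v$ if $v$ covers $u$. A \emph{distinguished matching} of a poset $P$ is an involution $\phi : P \to P$ such that for every $u \in P$ either $u \lhd \phi(u)$ or $\phi(u) \lhd u$, and such that, whenever $u \lhd \phi(u)$, $$\{x : x \lhd \phi(u)\} = \{u\} \cup \{\phi(v) : v \lhd u,\ v \lhd \phi(v)\}.$$ A \emph{partial matching} of $P$ is a pair $(Q,\phi)$ where $Q \subseteq P$ is downward closed and $\phi : Q \to Q$ is a distinguished matching of the subposet $Q$; $Q$ is its domain. A \emph{maximal matching} is a partial matching that is maximal for the extension order: $(Q_1,\phi_1) \le (Q_2,\phi_2)$ if and only if $Q_1 \subseteq Q_2$ and $\phi_2$ extends $\phi_1$. For $a \in S$ let $\mathcal{M}_a(W)$ be the set of maximal matchings $\phi$ of $W$ (defined at $e$) with $\phi(e) = a$. Let $a \in S$. The left multiplication $w \mapsto aw$ and the right multiplication $w \mapsto wa$ are elements of $\mathcal{M}_a(W)$ defined on all of $W$. They are the only elements of $\mathcal{M}_a(W)$ defined on all of $W$, except in the degenerate case where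 there is $b \in S\setminus\{a\}$ such that $$S = \{a,b\} \amalg C, \qquad \forall c \in C,\ m_{ac} = m_{bc} = 2.$$ In this degenerate case: 1. $\langle C\rangle$ and $\langle a,b\rangle$ are Coxeter groups with generating sets $C$ and $\{a,b\}$ and with the restricted Coxeter matrices, and multiplication $(x,y) \mapsto xy$ is a group isomorphism $\langle C\rangle \times \langle a,b\rangle \to W$. 2. Every $\phi \in \mathcal{M}_a(W)$, with domain $Q$, is $\langle C\rangle$-regular, i.e. for all $c \in \langle C\rangle$ and $x \in Q$ one has $cx \in Q$ and $\phi(cx) = c\,\phi(x)$; and it is defined on all of $W$. 3. Restriction to $\langle a,b\rangle$ is a bijection from $\mathcal{M}_a(W)$ onto $\mathcal{M}_a(\langle a,b\rangle)$, where $\langle a,b\rangle$ is regarded as a Coxeter group with generators $a,b$. -/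

import Mathlib

/-- An application `φ : P → P` on a poset is a distinguished (special) matching if it is an
involution, moves every element along an edge of the Hasse diagram, and, whenever `u ⋖ φ u`, the
coatoms of `φ u` are exactly `u` and the `φ v` with `v ⋖ u` and `v ⋖ φ v`. -/
structure IsDistinguishedMatching {P : Type*} [PartialOrder P] (φ : P → P) : Prop where
  involutive : Function.Involutive φ
  covBy_or_covBy : ∀ u, u ⋖ φ u ∨ φ u ⋖ u
  coatoms_eq : ∀ u, u ⋖ φ u → {x | x ⋖ φ u} = {u} ∪ φ '' {v | v ⋖ u ∧ v ⋖ φ v}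

/-- A partial (distinguished) matching of `P`: a distinguished matching of the subposet given by a
downward closed subset `dom` of `P`. -/
structure PartialMatching (P : Type*) [PartialOrder P] where
  dom : Set P
  isLowerSet_dom : IsLowerSet dom
  toFun : dom → dom
  isDistinguished : IsDistinguishedMatching toFun

namespace PartialMatching

/-- `φ.Maps x y` : the partial matching `φ` is defined at `x`, and `φ(x) = y`. -/
def Maps {P : Type*} [PartialOrder P] (φ : PartialMatching P) (x y : P) : Prop :=
  ∃ h : x ∈ φ.dom, (φ.toFun ⟨x, h⟩ : P) = y

/-- `φ ≤ ψ` : the partial matching `ψ` extends `φ`. -/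
instance instLE {P : Type*} [PartialOrder P] : LE (PartialMatching P) where
  le φ ψ := φ.dom ⊆ ψ.dom ∧ ∀ x y, φ.Maps x y → ψ.Maps x y

end PartialMatching

/-- The Coxeter matrix of a subset `J` of the set of generators. -/
def CoxeterMatrix.restrict {B : Type*} (M : CoxeterMatrix B) (J : Set B) : CoxeterMatrix J where
  M := Matrix.of fun i j => M i j
  isSymm := by
    ext i j
    exact M.symmetric j i
  diagonal i := M.diagonal i
  off_diagonal i j h := M.off_diagonal i j (fun h' => h (Subtype.ext h'))

namespace CoxeterSystem

/-- The group `W` of a Coxeter system, regarded as a poset with the Bruhat order. -/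
def Bruhat {B : Type*} {M : CoxeterMatrix B} {W : Type*} [Group W] (_cs : CoxeterSystem M W) :
    Type _ := W

/-- An arrow of the Bruhat graph: `v = u t` for a reflection `t`, and `ℓ(u) < ℓ(v)`. -/
def BruhatStep {B : Type*} {M : CoxeterMatrix B} {W : Type*} [Group W] (cs : CoxeterSystem M W)
    (u v : W) : Prop :=
  ∃ t : W, cs.IsReflection t ∧ v = u * t ∧ cs.length u < cs.length v

theorem eq_or_length_lt_of_reflTransGen {B : Type*} {M : CoxeterMatrix B} {W : Type*} [Group W]
    (cs : CoxeterSystem M W) {u v : W} (h : Relation.ReflTransGen cs.BruhatStep u v) :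
    u = v ∨ cs.length u < cs.length v := by
  induction h with
  | refl => exact Or.inl rfl
  | tail _ hs ih =>
    obtain ⟨t, _, _, hlt⟩ := hs
    rcases ih with rfl | ih
    · exact Or.inr hlt
    · exact Or.inr (ih.trans hlt)

/-- The Bruhat order: the reflexive transitive closure of the Bruhat graph. -/
instance instPartialOrderBruhat {B : Type*} {M : CoxeterMatrix B} {W : Type*} [Group W]
    (cs : CoxeterSystem M W) : PartialOrder cs.Bruhat where
  le := Relation.ReflTransGen cs.BruhatStep
  le_refl _ := Relation.ReflTransGen.refl
  le_trans _ _ _ h₁ h₂ := Relation.ReflTransGen.trans h₁ h₂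
  le_antisymm x y h₁ h₂ := by
    rcases cs.eq_or_length_lt_of_reflTransGen h₁ with h | h
    · exact h
    · rcases cs.eq_or_length_lt_of_reflTransGen h₂ with h' | h'
      · exact h'.symm
      · exact absurd h (lt_asymm h')

/-- The maximal matchings `φ` of `W`, for the extension order on partial matchings, which satisfy
`φ(e) = a`. -/
def maximalMatchings {B : Type*} {M : CoxeterMatrix B} {W : Type*} [Group W]
    (cs : CoxeterSystem M W) (a : B) : Set (PartialMatching cs.Bruhat) :=
  {φ | IsMax φ ∧ φ.Maps (1 : W) (cs.simple a)}

/-- The standard parabolic subgroup generated by `J`. -/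
def parabolic {B : Type*} {M : CoxeterMatrix B} {W : Type*} [Group W] (cs : CoxeterSystem M W)
    (J : Set B) : Subgroup W :=
  Subgroup.closure (cs.simple '' J)

end CoxeterSystem

/-! The coatom condition makes a distinguished matching rigid: the coatoms of `φ(u)`, when `φ` moves
`u` up, are read off from the values of `φ` at the coatoms of `u`. Distinct elements with the same
coatoms lie in a common dihedral parabolic subgroup (`exists_mem_parabolic_pair_of_coatoms_eq`). If
`φ(e) = a`, then `φ` preserves every parabolic subgroup containing `a`, and `a ≤ φ(u)` whenever `u`
is matched upward. So agreement with a global matching on the dihedral subgroups `⟨a, t⟩` implies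
agreement everywhere (`IsMatchingOn.eqOn_of_eqOn_parabolic`).

Outside the degenerate case, let `φ` be defined everywhere. Each `φ(s)` is `as` or `sa`, and two
generators not commuting with `a` cannot make different choices (`IsMatchingOn.false_of_mixed`); up
to inversion, `φ(s) = as` for all `s`. A shortest `x` with `φ(x) ≠ ax` lies in some `⟨a, s⟩`, starts
with `s`, and `φ(x)` starts with `s` only. Nondegeneracy gives `c` outside `{a, s}` not commuting
with both `a` and `s`. Inserting `c` in `x` yields elements outside all dihedral subgroups through
`a`, whose images would have to cover incompatible elements. The incompatibility is seen by looking
at one left descent of such an image and applying the lifting property to each of its coatoms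
(`IsFirstDefect.false_of_not_commute`, `IsFirstDefect.false_of_commute`).

In the degenerate case `W` is the product of `⟨C⟩` and `⟨a, b⟩`, and a Bruhat cover changes one
component only. A dihedral subgroup through `a` lies in `⟨a, b⟩` or is some `⟨a, c⟩` of order four,
where `φ` can only be left multiplication by `a`. Hence `φ` is the restriction of the identity of
`⟨C⟩` times a matching of `⟨a, b⟩`. A partial matching of a dihedral group extends to the whole
group, because Bruhat order there just compares lengths; so maximality makes `φ` total. -/

namespace CoxeterSystem

/-! ### The geometric representation: generators are distinct, and commuting ones have entry 2. -/

section Geometric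

open Module

variable {B : Type*} (M : CoxeterMatrix B)

/-- The coroot functionals of the geometric representation. -/
noncomputable def geomCoroot (i : B) : Dual ℝ (B →₀ ℝ) :=
  Finsupp.linearCombination ℝ fun j => -2 * Real.cos (Real.pi / M i j)

theorem geomCoroot_single (i j : B) :
    geomCoroot M i (Finsupp.single j 1) = -2 * Real.cos (Real.pi / M i j) := by
  simp [geomCoroot]

theorem geomCoroot_self (i : B) : geomCoroot M i (Finsupp.single i 1) = 2 := by
  simp [geomCoroot_single]

/-- The simple reflections of the geometric representation. -/
noncomputable def geomReflection (i : B) : (B →₀ ℝ) ≃ₗ[ℝ] (B →₀ ℝ) :=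
  reflection (geomCoroot_self M i)

/-- For finite `m = M i j`, put `θ = π / m`. The powers of a product of two reflections have
coefficients that are Chebyshev polynomials at `2 cos 2θ`, and those surviving at exponent `m`
vanish. -/
theorem geomReflection_isLiftable : M.IsLiftable (geomReflection M) := by
  intro i j
  by_cases hij : i = j
  · subst hij
    rw [M.diagonal, pow_one]
    ext1 v
    exact involutive_reflection (geomCoroot_self M i) v
  have h1 : M i j ≠ 1 := M.off_diagonal i j hij
  -- The entry 0 encodes infinite order and imposes no relation.
  rcases Nat.eq_zero_or_pos (M i j) with h0 | h0
  · rw [h0, pow_zero]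
  set θ : ℝ := Real.pi / M i j with hθ
  have hm : (M i j : ℝ) ≠ 0 := by positivity
  have e1 : geomCoroot M i (Finsupp.single j 1) = -2 * Real.cos θ := geomCoroot_single M i j
  have e2 : geomCoroot M j (Finsupp.single i 1) = -2 * Real.cos θ := by
    rw [geomCoroot_single, M.symmetric j i]
  -- This case is separate because `sin 2θ = 0` here, while the Chebyshev argument divides by `sin
  -- 2θ`.
  by_cases h2 : M i j = 2
  · have hc : Real.cos θ = 0 := by rw [hθ, h2]; simp
    rw [hc] at e1 e2
    rw [h2, pow_two]
    ext1 v
    simp only [LinearEquiv.mul_apply, geomReflection, reflection_apply, map_sub, map_smul, e1, e2,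
      geomCoroot_self, LinearEquiv.coe_one, id]
    module
  have h3 : 3 ≤ M i j := by omega
  have hmθ : M i j * θ = Real.pi := by rw [hθ]; field_simp
  have hs : Real.sin (2 * θ) ≠ 0 := by
    apply ne_of_gt
    apply Real.sin_pos_of_pos_of_lt_pi
    · have := Real.pi_pos
      positivity
    · have h3' : (3 : ℝ) ≤ M i j := by exact_mod_cast h3
      have hθ0 : 0 < θ := by have := Real.pi_pos; positivity
      nlinarith
  have ht : 2 * Real.cos (2 * θ)
      = geomCoroot M i (Finsupp.single j 1) * geomCoroot M j (Finsupp.single i 1) - 2 := by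
    rw [e1, e2, Real.cos_two_mul]; ring
  have S := fun n : ℤ => Polynomial.Chebyshev.S_two_mul_real_cos (2 * θ) n
  ext1 v
  unfold geomReflection
  rw [reflection_mul_reflection_pow_apply (geomCoroot_self M i) (geomCoroot_self M j) (M i j) v
    (2 * Real.cos (2 * θ)) ht]
  -- After multiplication by `sin 2θ` the relevant coefficient is `sin π` for even `m`, and `sin (π
  -- + θ) + sin (π - θ)` for odd `m`.
  rcases Nat.even_or_odd' (M i j) with ⟨n, hn | hn⟩
  · have i1 : ((M i j : ℤ) - 2) / 2 = n - 1 := by omega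
    have i2 : ((M i j : ℤ) - 1) / 2 = n - 1 := by omega
    have z : (Polynomial.Chebyshev.S ℝ ((n : ℤ) - 1)).eval (2 * Real.cos (2 * θ)) = 0 := by
      apply (mul_eq_zero.1 ((S _).trans _)).resolve_right hs
      rw [← Real.sin_pi, ← hmθ, hn]
      push_cast; ring_nf
    rw [i1, i2, z]
    simp
  · have i1 : ((M i j : ℤ) - 2) / 2 = n - 1 := by omega
    have i2 : ((M i j : ℤ) - 1) / 2 = n := by omega
    have i3 : ((M i j : ℤ) - 3) / 2 = n - 1 := by omega
    have i4 : ((M i j : ℤ)) / 2 = n := by omega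
    have z : (Polynomial.Chebyshev.S ℝ (n : ℤ)).eval (2 * Real.cos (2 * θ)) +
        (Polynomial.Chebyshev.S ℝ ((n : ℤ) - 1)).eval (2 * Real.cos (2 * θ)) = 0 := by
      refine (mul_eq_zero.1 ((add_mul _ _ (Real.sin (2 * θ))).trans ?_)).resolve_right hs
      rw [S, S]
      have h : (2 * n + 1) * θ = Real.pi := by rw [← hmθ, hn]; push_cast; ring
      have : ((((n : ℤ) : ℝ) + 1) * (2 * θ)) = Real.pi + θ := by push_cast; rw [← h]; ring
      rw [this]
      have : (((((n : ℤ) - 1 : ℤ) : ℝ) + 1) * (2 * θ)) = Real.pi - θ := by push_cast; rw [← h]; ring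
      rw [this, Real.sin_pi_sub, Real.sin_add]
      simp
    rw [i1, i2, i3, i4, z]
    simp

end Geometric

variable {B : Type*} {M : CoxeterMatrix B} {W : Type*} [Group W] (cs : CoxeterSystem M W)

theorem exists_geometric_rep :
    ∃ ρ : W →* ((B →₀ ℝ) ≃ₗ[ℝ] (B →₀ ℝ)), ∀ i, ρ (cs.simple i) = geomReflection M i :=
  ⟨cs.lift ⟨_, geomReflection_isLiftable M⟩, fun i => cs.lift_apply_simple _ i⟩

/-- On the basis vector at `i`, the `i`-coordinate becomes `-1` under the reflection of `i` and
stays `1` under any other. -/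
theorem simple_inj {i j : B} (h : cs.simple i = cs.simple j) : i = j := by
  obtain ⟨ρ, hρ⟩ := cs.exists_geometric_rep
  by_contra hij
  have h1 : geomReflection M i (Finsupp.single i 1) = geomReflection M j (Finsupp.single i 1) := by
    rw [← hρ, ← hρ, h]
  have h2 := DFunLike.congr_fun h1 i
  simp only [geomReflection, Module.reflection_apply, geomCoroot_self, Finsupp.sub_apply,
    Finsupp.smul_apply, Finsupp.single_eq_same] at h2
  rw [Finsupp.single_eq_of_ne (by tauto)] at h2
  norm_num at h2

/-- Comparing `i`-coordinates of the two products on the basis vector at `j` forces `cos (π / M i j)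
= 0`. The entry 0 gives cosine 1, and entries at least 3 give a positive cosine. -/
theorem eq_two_of_simple_commute {i j : B} (hij : i ≠ j)
    (h : cs.simple i * cs.simple j = cs.simple j * cs.simple i) : M i j = 2 := by
  obtain ⟨ρ, hρ⟩ := cs.exists_geometric_rep
  have h1 : geomReflection M i (geomReflection M j (Finsupp.single j 1))
      = geomReflection M j (geomReflection M i (Finsupp.single j 1)) := by
    have := congrArg (fun w => ρ w (Finsupp.single j 1)) h
    simpa only [map_mul, hρ, LinearEquiv.mul_apply] using this
  have h2 := DFunLike.congr_fun h1 i
  have hc : Real.cos (Real.pi / M i j) = 0 := by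
    have e : (Finsupp.single j (1 : ℝ)) i = 0 := Finsupp.single_eq_of_ne hij
    simp only [geomReflection, Module.reflection_apply, map_sub, map_smul, geomCoroot_single,
      M.diagonal, Finsupp.sub_apply,
      Finsupp.smul_apply, Finsupp.single_eq_same, e, smul_eq_mul] at h2
    norm_num at h2
    linarith
  by_contra hne
  have h1 : M i j ≠ 1 := M.off_diagonal i j hij
  rcases Nat.eq_zero_or_pos (M i j) with h0 | h0
  · rw [h0] at hc; simp at hc
  · have h3 : 3 ≤ M i j := by omega
    have h3' : (3 : ℝ) ≤ M i j := by exact_mod_cast h3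
    refine absurd hc (ne_of_gt (Real.cos_pos_of_mem_Ioo ⟨?_, ?_⟩))
    · have := Real.pi_pos
      have : 0 < Real.pi / M i j := by positivity
      linarith
    · have := Real.pi_pos
      apply div_lt_div_of_pos_left <;> linarith

theorem simple_commute_of_eq_two {i j : B} (h : M i j = 2) :
    cs.simple i * cs.simple j = cs.simple j * cs.simple i := by
  have := cs.simple_mul_simple_pow i j
  rw [h, pow_two] at this
  have h2 := eq_inv_of_mul_eq_one_left this
  rwa [mul_inv_rev, cs.inv_simple, cs.inv_simple] at h2

end CoxeterSystem

/-! ### The reflection cocycle and the strong exchange property. -/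

namespace CoxeterSystem

variable {B : Type*} {M : CoxeterMatrix B} {W : Type*} [Group W] (cs : CoxeterSystem M W)

section Cocycle

open scoped Classical in
/-- The action of a simple reflection on pairs of a group element and a parity. -/
noncomputable def signedConj (i : B) : Equiv.Perm (W × ZMod 2) :=
  Function.Involutive.toPerm
    (fun p => (cs.simple i * p.1 * cs.simple i, p.2 + if p.1 = cs.simple i then 1 else 0)) <| by
    rintro ⟨t, ε⟩
    have h : cs.simple i * t * cs.simple i = cs.simple i ↔ t = cs.simple i := by
      constructor
      · intro h
        have := congrArg (fun x => cs.simple i * x * cs.simple i) h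
        simpa [mul_assoc] using this
      · rintro rfl; simp
    ext
    · simp [mul_assoc]
    · simp only [h]
      split_ifs <;> simp [add_assoc, CharTwo.add_self_eq_zero]

open scoped Classical in
theorem signedConj_apply (i : B) (t : W) (ε : ZMod 2) :
    cs.signedConj i (t, ε) =
      (cs.simple i * t * cs.simple i, ε + if t = cs.simple i then 1 else 0) := rfl

open scoped Classical in
theorem signedConj_mul_pow_apply (i j : B) (k : ℕ) (t : W) (ε : ZMod 2) :
    ((cs.signedConj i * cs.signedConj j) ^ k) (t, ε) =
      ((cs.simple i * cs.simple j) ^ k * t * ((cs.simple i * cs.simple j) ^ k)⁻¹,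
        ε + ∑ l ∈ Finset.range (2 * k),
          if (cs.simple i * cs.simple j) ^ l * t = cs.simple j then 1 else 0) := by
  set x := cs.simple i * cs.simple j with hx
  have hjx : cs.simple j * x⁻¹ = x * cs.simple j := by simp [hx, mul_assoc]
  have hpow : ∀ k : ℕ, cs.simple j * (x ^ k)⁻¹ = x ^ k * cs.simple j := by
    intro k
    induction k with
    | zero => simp
    | succ k ih => rw [pow_succ', mul_inv_rev, ← mul_assoc, ih, mul_assoc, hjx, ← mul_assoc,
        ← pow_succ, pow_succ']
  have hpow' : ∀ k : ℕ, cs.simple j * x ^ k = (x ^ k)⁻¹ * cs.simple j := by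
    intro k
    rw [eq_inv_mul_iff_mul_eq, ← mul_assoc, ← hpow, inv_mul_cancel_right]
  have hconj : ∀ k : ℕ, (x ^ k * t * (x ^ k)⁻¹ = cs.simple j ↔ x ^ (2 * k) * t = cs.simple j) := by
    intro k
    rw [mul_inv_eq_iff_eq_mul, hpow', eq_inv_mul_iff_mul_eq, ← mul_assoc, ← pow_add, two_mul]
  have hconj' : ∀ k : ℕ, (cs.simple j * (x ^ k * t * (x ^ k)⁻¹) * cs.simple j = cs.simple i ↔
      x ^ (2 * k + 1) * t = cs.simple j) := by
    intro k
    have e : cs.simple j * (x ^ k * t * (x ^ k)⁻¹) * cs.simple j = cs.simple i ↔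
        x ^ k * t * (x ^ k)⁻¹ = x⁻¹ * cs.simple j := by
      rw [← eq_mul_inv_iff_mul_eq, ← eq_inv_mul_iff_mul_eq]
      simp [hx, mul_assoc]
    rw [e, mul_inv_eq_iff_eq_mul, mul_assoc, hpow', eq_inv_mul_iff_mul_eq, eq_inv_mul_iff_mul_eq,
      ← mul_assoc, ← mul_assoc, ← pow_succ, ← pow_add]
    ring_nf
  induction k with
  | zero => simp
  | succ k ih =>
    rw [pow_succ', Equiv.Perm.mul_apply, ih, Equiv.Perm.mul_apply, signedConj_apply,
      signedConj_apply, show 2 * (k + 1) = 2 * k + 1 + 1 by ring, Finset.sum_range_succ,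
      Finset.sum_range_succ]
    ext
    · simp [pow_succ', hx, mul_assoc]
    · simp only [hconj, hconj', add_assoc]

/-- As `(σ i σ j) ^ m = 1`, the `2m` flip conditions repeat with period `m`, so the flips cancel
modulo 2. -/
theorem signedConj_isLiftable : M.IsLiftable cs.signedConj := by
  classical
  intro i j
  ext1 ⟨t, ε⟩
  rw [signedConj_mul_pow_apply, cs.simple_mul_simple_pow, two_mul, Finset.sum_range_add]
  simp [pow_add, CharTwo.add_self_eq_zero]

/-- The reflection cocycle. -/
noncomputable def cocycle (w t : W) : ZMod 2 :=
  (cs.lift ⟨cs.signedConj, cs.signedConj_isLiftable⟩ w (t, 0)).2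

theorem lift_signedConj_apply (w t : W) (ε : ZMod 2) :
    cs.lift ⟨cs.signedConj, cs.signedConj_isLiftable⟩ w (t, ε)
      = (w * t * w⁻¹, ε + cs.cocycle w t) := by
  classical
  induction w using cs.simple_induction_left generalizing t ε with
  | one => simp [cocycle]
  | mul_simple_left w i ih =>
    have h0 := ih t 0
    simp only [cocycle, map_mul, Equiv.Perm.mul_apply, cs.lift_apply_simple] at ih ⊢
    rw [ih, ih t 0, signedConj_apply, signedConj_apply]
    simp [mul_assoc, add_assoc]

theorem cocycle_mul (u v t : W) :
    cs.cocycle (u * v) t = cs.cocycle v t + cs.cocycle u (v * t * v⁻¹) := by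
  have h := cs.lift_signedConj_apply (u * v) t 0
  rw [map_mul, Equiv.Perm.mul_apply, lift_signedConj_apply, lift_signedConj_apply] at h
  simpa using (congrArg Prod.snd h).symm

theorem cocycle_one (t : W) : cs.cocycle 1 t = 0 := by simp [cocycle]

open scoped Classical in
theorem cocycle_simple (i : B) (t : W) :
    cs.cocycle (cs.simple i) t = if t = cs.simple i then 1 else 0 := by
  simp [cocycle, cs.lift_apply_simple, signedConj_apply]

/-- For `t = w s w⁻¹`, the cocycle identity for `w w⁻¹ = 1` cancels the contributions of `w` and
`w⁻¹`; the middle letter contributes 1. -/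
theorem cocycle_self {t : W} (ht : cs.IsReflection t) : cs.cocycle t t = 1 := by
  obtain ⟨w, i, rfl⟩ := ht
  have h := cs.cocycle_mul w w⁻¹ (w * cs.simple i * w⁻¹)
  rw [mul_inv_cancel, cocycle_one] at h
  rw [cocycle_mul, cocycle_mul, cocycle_simple]
  simp only [mul_assoc, inv_mul_cancel_left, inv_mul_cancel, inv_inv, mul_one, one_mul, if_true,
    simple_mul_simple_self, inv_simple] at h ⊢
  rw [add_left_comm, ← h, add_zero]

theorem mem_rightInvSeq_of_cocycle_ne_zero {ω : List B} {t : W}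
    (h : cs.cocycle (cs.wordProd ω) t ≠ 0) : t ∈ cs.rightInvSeq ω := by
  induction ω with
  | nil => simp [cocycle_one] at h
  | cons i ω ih =>
    rw [wordProd_cons, cocycle_mul, cocycle_simple] at h
    rw [rightInvSeq, List.mem_cons]
    split_ifs at h with h1
    · left
      rw [← h1]; simp [mul_assoc]
    · right
      exact ih (by simpa using h)

/-- A nonzero value puts `t` in the inversion sequence of a reduced word of `w`, so `w t` is
shorter. If the value at `w` is zero, it is 1 at `w t`, and the same argument shows that `w t` is
longer. -/
theorem cocycle_eq_one_iff {t : W} (ht : cs.IsReflection t) (w : W) :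
    cs.cocycle w t = 1 ↔ cs.length (w * t) < cs.length w := by
  have key : ∀ w, cs.cocycle w t ≠ 0 → cs.length (w * t) < cs.length w := by
    intro w h
    obtain ⟨ω, hω, rfl⟩ := cs.exists_isReduced w
    exact (cs.isRightInversion_of_mem_rightInvSeq hω
      (cs.mem_rightInvSeq_of_cocycle_ne_zero h)).2
  refine ⟨fun h => key w (by rw [h]; decide), fun h => ?_⟩
  by_contra h1
  have h0 : cs.cocycle w t = 0 := by
    generalize cs.cocycle w t = z at h1
    revert z; decide
  have h2 := key (w * t) (by rw [cocycle_mul, cs.cocycle_self ht]; simp [ht.inv, ht.mul_self, h0])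
  rw [mul_assoc, ht.mul_self, mul_one] at h2
  exact lt_asymm h h2

/-- The strong exchange property. -/
theorem mem_rightInvSeq_of_length_lt {ω : List B} {t : W} (ht : cs.IsReflection t)
    (h : cs.length (cs.wordProd ω * t) < cs.length (cs.wordProd ω)) : t ∈ cs.rightInvSeq ω :=
  cs.mem_rightInvSeq_of_cocycle_ne_zero (by rw [(cs.cocycle_eq_one_iff ht _).2 h]; decide)

theorem exists_eraseIdx_of_length_lt {ω : List B} {t : W} (ht : cs.IsReflection t)
    (h : cs.length (cs.wordProd ω * t) < cs.length (cs.wordProd ω)) :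
    ∃ k < ω.length, cs.wordProd ω * t = cs.wordProd (ω.eraseIdx k) := by
  obtain ⟨k, hk, rfl⟩ := List.getElem_of_mem (cs.mem_rightInvSeq_of_length_lt ht h)
  rw [length_rightInvSeq] at hk
  refine ⟨k, hk, ?_⟩
  rw [← cs.wordProd_mul_getD_rightInvSeq, List.getD_eq_getElem]

/-- For `t ≠ s`, the cocycle of `us` at `sts` equals that of `u` at `t`. This is why right
multiplication by `s` preserves a Bruhat step unless the step is multiplication by `s`. -/
theorem length_lt_mul_simple {u t : W} (ht : cs.IsReflection t) {i : B} (hti : t ≠ cs.simple i)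
    (h : cs.length u < cs.length (u * t)) :
    cs.length (u * cs.simple i) < cs.length (u * t * cs.simple i) := by
  have h1 : cs.IsReflection (cs.simple i * t * cs.simple i) := by
    simpa using ht.conj (cs.simple i)
  have h2 : u * t * cs.simple i = u * cs.simple i * (cs.simple i * t * cs.simple i) := by
    simp [mul_assoc]
  rw [h2]
  refine lt_of_le_of_ne (not_lt.1 fun h3 => ?_) (h1.length_mul_left_ne _).symm
  rw [← cs.cocycle_eq_one_iff h1, cocycle_mul, cocycle_simple, if_neg] at h3
  · simp only [mul_assoc, inv_simple, simple_mul_simple_self, mul_one,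
      simple_mul_simple_cancel_left, zero_add] at h3
    exact lt_asymm h ((cs.cocycle_eq_one_iff ht u).1 h3)
  · intro h4
    apply hti
    have := congrArg (fun x => cs.simple i * x * cs.simple i) h4
    simpa [mul_assoc] using this

end Cocycle

end CoxeterSystem

/-! ### Bruhat order on `W`: lifting property, covers, gradedness. -/

namespace CoxeterSystem

variable {B : Type*} {M : CoxeterMatrix B} {W : Type*} [Group W] (cs : CoxeterSystem M W)

/-- The Bruhat order, as a relation on `W`. -/
def BLE (u v : W) : Prop := Relation.ReflTransGen cs.BruhatStep u v

/-- The covering relation of the Bruhat order (see `covBy_iff`). -/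
def Cov (u v : W) : Prop := cs.BLE u v ∧ cs.length v = cs.length u + 1

variable {cs}

namespace BLE

theorem refl (u : W) : cs.BLE u u := Relation.ReflTransGen.refl

theorem trans {u v w : W} (h : cs.BLE u v) (h' : cs.BLE v w) : cs.BLE u w :=
  Relation.ReflTransGen.trans h h'

theorem eq_or_length_lt {u v : W} (h : cs.BLE u v) : u = v ∨ cs.length u < cs.length v :=
  cs.eq_or_length_lt_of_reflTransGen h

theorem length_le {u v : W} (h : cs.BLE u v) : cs.length u ≤ cs.length v := by
  rcases h.eq_or_length_lt with rfl | h
  · rfl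
  · exact h.le

theorem eq_of_length_le {u v : W} (h : cs.BLE u v) (h' : cs.length v ≤ cs.length u) : u = v :=
  h.eq_or_length_lt.resolve_right (not_lt.2 h')

theorem inv {u v : W} (h : cs.BLE u v) : cs.BLE u⁻¹ v⁻¹ := by
  induction h with
  | refl => exact .refl _
  | @tail v w _ hs ih =>
    obtain ⟨t, ht, rfl, hlt⟩ := hs
    refine ih.trans (Relation.ReflTransGen.single ⟨v * t * v⁻¹, ht.conj v, ?_, ?_⟩)
    · simp [mul_assoc, ht.inv]
    · rwa [cs.length_inv, cs.length_inv]

end BLE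

theorem ble_inv_iff {u v : W} : cs.BLE u⁻¹ v⁻¹ ↔ cs.BLE u v :=
  ⟨fun h => by simpa using h.inv, BLE.inv⟩

theorem BruhatStep.mul_simple {u v : W} (h : cs.BruhatStep u v) (i : B) :
    v = u * cs.simple i ∨ cs.BruhatStep (u * cs.simple i) (v * cs.simple i) := by
  obtain ⟨t, ht, rfl, hlt⟩ := h
  by_cases hti : t = cs.simple i
  · left; rw [hti]
  · right
    refine ⟨cs.simple i * t * cs.simple i, ?_, ?_, cs.length_lt_mul_simple ht hti hlt⟩
    · simpa using ht.conj (cs.simple i)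
    · simp [mul_assoc]

theorem ble_mul_simple {u : W} {i : B} (h : ¬ cs.IsRightDescent u i) :
    cs.BLE u (u * cs.simple i) := by
  refine Relation.ReflTransGen.single ⟨_, cs.isReflection_simple i, rfl, ?_⟩
  rw [cs.not_isRightDescent_iff.1 h]; omega

namespace BLE

/-- Half of the lifting property: multiply a Bruhat chain by `s` step by step. Each step survives or
is itself multiplication by `s`, and the latter gives the second alternative. -/
theorem mul_simple_or {u v : W} (h : cs.BLE u v) (i : B) :
    cs.BLE (u * cs.simple i) (v * cs.simple i) ∨ cs.BLE u (v * cs.simple i) := by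
  induction h with
  | refl => exact Or.inl (.refl _)
  | tail h hs ih =>
    rcases hs.mul_simple i with rfl | hs
    · right; rw [simple_mul_simple_cancel_right]; exact h
    · exact ih.imp (fun h => h.tail hs) (fun h => h.tail hs)

theorem mul_simple_or' {u v : W} (h : cs.BLE u v) (i : B) :
    cs.BLE (u * cs.simple i) (v * cs.simple i) ∨ cs.BLE (u * cs.simple i) v := by
  induction h using Relation.ReflTransGen.head_induction_on with
  | refl => exact Or.inl (.refl _)
  | head hs h ih =>
    rcases hs.mul_simple i with rfl | hs
    · exact Or.inr h
    · exact ih.imp (fun h => .head hs h) (fun h => .head hs h)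

theorem simple_mul_or {u v : W} (h : cs.BLE u v) (i : B) :
    cs.BLE (cs.simple i * u) (cs.simple i * v) ∨ cs.BLE u (cs.simple i * v) := by
  simpa [← ble_inv_iff (cs := cs) (u := cs.simple i * u), ← ble_inv_iff (cs := cs) (u := u)]
    using h.inv.mul_simple_or i

theorem simple_mul_or' {u v : W} (h : cs.BLE u v) (i : B) :
    cs.BLE (cs.simple i * u) (cs.simple i * v) ∨ cs.BLE (cs.simple i * u) v := by
  simpa [← ble_inv_iff (cs := cs) (u := cs.simple i * u)]
    using h.inv.mul_simple_or' i

end BLE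

theorem ble_simple_mul {u : W} {i : B} (h : ¬ cs.IsLeftDescent u i) :
    cs.BLE u (cs.simple i * u) := by
  rw [← cs.isRightDescent_inv_iff] at h
  simpa [← ble_inv_iff (cs := cs) (u := u)] using ble_mul_simple h

theorem not_isLeftDescent_simple_mul {u : W} {i : B} :
    ¬ cs.IsLeftDescent (cs.simple i * u) i ↔ cs.IsLeftDescent u i :=
  cs.isLeftDescent_iff_not_isLeftDescent_mul.symm

theorem isLeftDescent_simple_mul {u : W} {i : B} :
    cs.IsLeftDescent (cs.simple i * u) i ↔ ¬ cs.IsLeftDescent u i := by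
  rw [← not_isLeftDescent_simple_mul, simple_mul_simple_cancel_left]

theorem simple_mul_ble {u : W} {i : B} (h : cs.IsLeftDescent u i) :
    cs.BLE (cs.simple i * u) u := by
  simpa using ble_simple_mul (not_isLeftDescent_simple_mul.2 h)

namespace BLE

/-- If `g ≤ s h` and `g < s g` then `g ≤ h`. -/
theorem of_simple_mul {g h : W} {i : B} (hg : ¬ cs.IsLeftDescent g i)
    (hgh : cs.BLE g (cs.simple i * h)) : cs.BLE g h := by
  rcases hgh.simple_mul_or i with h1 | h1 <;> rw [simple_mul_simple_cancel_left] at h1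
  · exact (ble_simple_mul hg).trans h1
  · exact h1

theorem simple_mul_right {g h : W} {i : B} (hg : ¬ cs.IsLeftDescent g i)
    (hgh : cs.BLE g h) : cs.BLE g (cs.simple i * h) :=
  of_simple_mul hg (by simpa using hgh)

/-- If `s g ≤ s h` and `g < s g` then `g ≤ h`. -/
theorem of_simple_mul_simple_mul {g h : W} {i : B} (hg : ¬ cs.IsLeftDescent g i)
    (hgh : cs.BLE (cs.simple i * g) (cs.simple i * h)) : cs.BLE g h := by
  rcases hgh.simple_mul_or i with h1 | h1
  · simpa using h1
  · rw [simple_mul_simple_cancel_left] at h1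
    exact (ble_simple_mul hg).trans h1

theorem simple_mul_simple_mul {g h : W} {i : B} (hg : cs.IsLeftDescent g i)
    (hgh : cs.BLE g h) : cs.BLE (cs.simple i * g) (cs.simple i * h) :=
  of_simple_mul_simple_mul (not_isLeftDescent_simple_mul.2 hg) (by simpa using hgh)

theorem simple_mul_left {g h : W} {i : B} (hh : cs.IsLeftDescent h i)
    (hgh : cs.BLE g h) : cs.BLE (cs.simple i * g) h :=
  (hgh.simple_mul_or' i).elim (fun h1 => h1.trans (simple_mul_ble hh)) id

theorem simple_mul_mono {g h : W} {i : B} (hh : ¬ cs.IsLeftDescent h i)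
    (hgh : cs.BLE g h) : cs.BLE (cs.simple i * g) (cs.simple i * h) :=
  (hgh.simple_mul_or' i).elim id (fun h1 => h1.trans (ble_simple_mul hh))

end BLE

theorem one_ble (g : W) : cs.BLE 1 g := by
  induction hn : cs.length g generalizing g with
  | zero => rw [cs.length_eq_zero_iff.1 hn]; exact .refl _
  | succ n ih =>
    have hg : g ≠ 1 := by rintro rfl; simp at hn
    obtain ⟨i, hi⟩ := cs.exists_leftDescent_of_ne_one hg
    exact (ih (cs.simple i * g) (by have := cs.isLeftDescent_iff.1 hi; omega)).trans
      (simple_mul_ble hi)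

namespace Cov

theorem inv {u v : W} (h : cs.Cov u v) : cs.Cov u⁻¹ v⁻¹ := ⟨h.1.inv, by simp [h.2]⟩

theorem ne {u v : W} (h : cs.Cov u v) : u ≠ v := by
  rintro rfl; have := h.2; omega

/-- If `g` lacks the descent `i`, lifting gives `g ≤ s h` with equal lengths. All the later descent
arguments rest on this dichotomy for coatoms. -/
theorem eq_simple_mul_or {g h : W} (hgh : cs.Cov g h) {i : B} (hh : cs.IsLeftDescent h i) :
    g = cs.simple i * h ∨ cs.IsLeftDescent g i := by
  by_cases hg : cs.IsLeftDescent g i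
  · exact Or.inr hg
  · refine Or.inl ((hgh.1.simple_mul_right hg).eq_of_length_le ?_)
    have := cs.isLeftDescent_iff.1 hh
    have := hgh.2
    omega

theorem simple_mul_simple_mul {g h : W} (hgh : cs.Cov g h) {i : B} (hg : cs.IsLeftDescent g i)
    (hh : cs.IsLeftDescent h i) : cs.Cov (cs.simple i * g) (cs.simple i * h) := by
  refine ⟨hgh.1.simple_mul_simple_mul hg, ?_⟩
  have := cs.isLeftDescent_iff.1 hh
  have := cs.isLeftDescent_iff.1 hg
  have := hgh.2
  omega

theorem simple_mul_mono {g h : W} (hgh : cs.Cov g h) {i : B} (hg : ¬ cs.IsLeftDescent g i)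
    (hh : ¬ cs.IsLeftDescent h i) : cs.Cov (cs.simple i * g) (cs.simple i * h) := by
  refine ⟨hgh.1.simple_mul_mono hh, ?_⟩
  have := cs.not_isLeftDescent_iff.1 hh
  have := cs.not_isLeftDescent_iff.1 hg
  have := hgh.2
  omega

end Cov

theorem cov_inv_iff {u v : W} : cs.Cov u⁻¹ v⁻¹ ↔ cs.Cov u v :=
  ⟨fun h => by simpa using h.inv, Cov.inv⟩

theorem simple_mul_cov {h : W} {i : B} (hh : cs.IsLeftDescent h i) : cs.Cov (cs.simple i * h) h :=
  ⟨simple_mul_ble hh, (cs.isLeftDescent_iff.1 hh).symm⟩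

theorem cov_simple_mul {h : W} {i : B} (hh : ¬ cs.IsLeftDescent h i) :
    cs.Cov h (cs.simple i * h) :=
  ⟨ble_simple_mul hh, cs.not_isLeftDescent_iff.1 hh⟩

theorem cov_simple_mul_or (i : B) (h : W) :
    cs.Cov h (cs.simple i * h) ∨ cs.Cov (cs.simple i * h) h := by
  by_cases hh : cs.IsLeftDescent h i
  · exact Or.inr (simple_mul_cov hh)
  · exact Or.inl (cov_simple_mul hh)

theorem mul_simple_cov {h : W} {i : B} (hh : cs.IsRightDescent h i) :
    cs.Cov (h * cs.simple i) h := by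
  rw [← cov_inv_iff]
  simpa using simple_mul_cov (cs.isLeftDescent_inv_iff.2 hh)

theorem cov_mul_simple {h : W} {i : B} (hh : ¬ cs.IsRightDescent h i) :
    cs.Cov h (h * cs.simple i) := by
  rw [← cov_inv_iff]
  rw [← cs.isLeftDescent_inv_iff] at hh
  simpa using cov_simple_mul hh

/-- The Bruhat order is graded by the length. -/
theorem BLE.exists_cov {u v : W} (h : cs.BLE u v) (hne : u ≠ v) :
    ∃ w, cs.BLE u w ∧ cs.Cov w v := by
  induction hn : cs.length v generalizing u v with
  | zero =>
    have := h.eq_or_length_lt.resolve_left hne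
    omega
  | succ n ih =>
    have hv : v ≠ 1 := by rintro rfl; simp at hn
    obtain ⟨i, hi⟩ := cs.exists_leftDescent_of_ne_one hv
    by_cases hu : cs.IsLeftDescent u i
    · obtain ⟨w, hw, hc⟩ := ih (h.simple_mul_simple_mul hu) (by simpa using hne)
        (by have := cs.isLeftDescent_iff.1 hi; omega)
      by_cases hwi : cs.IsLeftDescent w i
      · have h1 := hw.simple_mul_left hwi
        rw [simple_mul_simple_cancel_left] at h1
        exact ⟨_, h1.trans hc.1, simple_mul_cov hi⟩
      · have h1 := hw.simple_mul_mono hwi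
        have h2 := hc.simple_mul_mono hwi (not_isLeftDescent_simple_mul.2 hi)
        rw [simple_mul_simple_cancel_left] at h1 h2
        exact ⟨_, h1, h2⟩
    · exact ⟨_, h.simple_mul_right hu, simple_mul_cov hi⟩

/-! ### Standard parabolic subgroups. -/

section Parabolic

variable {J : Set B}

theorem simple_mem_parabolic {i : B} (hi : i ∈ J) : cs.simple i ∈ cs.parabolic J :=
  Subgroup.subset_closure ⟨i, hi, rfl⟩

theorem wordProd_mem_parabolic {ω : List B} (h : ∀ i ∈ ω, i ∈ J) :
    cs.wordProd ω ∈ cs.parabolic J := by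
  induction ω with
  | nil => simp
  | cons i ω ih =>
    rw [wordProd_cons]
    exact mul_mem (simple_mem_parabolic (h i (by simp))) (ih fun j hj => h j (by simp [hj]))

/-- Appending a letter of `J` to a reduced word in `J` keeps it reduced or, by exchange, amounts to
deleting a letter. -/
theorem exists_isReduced_of_mem_parabolic {w : W} (hw : w ∈ cs.parabolic J) :
    ∃ ω : List B, cs.IsReduced ω ∧ w = cs.wordProd ω ∧ ∀ i ∈ ω, i ∈ J := by
  have key : ∀ i ∈ J, ∀ w : W, (∃ ω : List B, cs.IsReduced ω ∧ w = cs.wordProd ω ∧ ∀ i ∈ ω, i ∈ J) →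
      ∃ ω : List B, cs.IsReduced ω ∧ w * cs.simple i = cs.wordProd ω ∧ ∀ i ∈ ω, i ∈ J := by
    rintro i hi w ⟨ω, hω, rfl, hJ⟩
    by_cases h : cs.IsRightDescent (cs.wordProd ω) i
    · obtain ⟨k, hk, hkω⟩ := cs.exists_eraseIdx_of_length_lt (cs.isReflection_simple i) h
      refine ⟨_, ?_, hkω, fun j hj => hJ j (List.mem_of_mem_eraseIdx hj)⟩
      have := cs.isRightDescent_iff.1 h
      rw [hkω, hω.eq] at this
      rw [IsReduced, List.length_eraseIdx_of_lt hk]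
      omega
    · refine ⟨ω.concat i, ?_, (cs.wordProd_concat i ω).symm, ?_⟩
      · rw [IsReduced, wordProd_concat, cs.not_isRightDescent_iff.1 h, hω.eq]; simp
      · intro j hj
        simp only [List.concat_eq_append, List.mem_append, List.mem_singleton] at hj
        rcases hj with hj | rfl
        exacts [hJ j hj, hi]
  induction hw using Subgroup.closure_induction_right with
  | one => exact ⟨[], by simp [IsReduced], by simp, by simp⟩
  | mul_right x hx y hy ih =>
    obtain ⟨i, hi, rfl⟩ := hy
    exact key i hi _ ih
  | mul_inv_cancel x hx y hy ih =>
    obtain ⟨i, hi, rfl⟩ := hy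
    rw [inv_simple]
    exact key i hi _ ih

theorem simple_mem_parabolic_iff {i : B} : cs.simple i ∈ cs.parabolic J ↔ i ∈ J := by
  refine ⟨fun h => ?_, simple_mem_parabolic⟩
  obtain ⟨ω, hω, h, hJ⟩ := exists_isReduced_of_mem_parabolic h
  have hl := hω.eq
  rw [← h, length_simple] at hl
  obtain ⟨j, rfl⟩ := List.length_eq_one_iff.1 hl.symm
  rw [wordProd_singleton] at h
  exact cs.simple_inj h ▸ hJ j (by simp)

/-- By strong exchange, a downward Bruhat step deletes a letter from a reduced word in `J`. -/
theorem BLE.mem_parabolic {u v : W} (h : cs.BLE u v) (hv : v ∈ cs.parabolic J) :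
    u ∈ cs.parabolic J := by
  induction h using Relation.ReflTransGen.head_induction_on with
  | refl => exact hv
  | @head u v hs _ ih =>
    obtain ⟨t, ht, rfl, hlt⟩ := hs
    obtain ⟨ω, hω, h, hJ⟩ := exists_isReduced_of_mem_parabolic ih
    have hu : u = cs.wordProd ω * t := by rw [← h, mul_assoc, ht.mul_self, mul_one]
    rw [h, hu] at hlt
    obtain ⟨k, _, hk⟩ := cs.exists_eraseIdx_of_length_lt ht hlt
    rw [hu, hk]
    exact wordProd_mem_parabolic fun j hj => hJ j (List.mem_of_mem_eraseIdx hj)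

theorem mem_of_isLeftDescent {v : W} (hv : v ∈ cs.parabolic J) {i : B}
    (hi : cs.IsLeftDescent v i) : i ∈ J := by
  have h := (simple_mul_ble hi).mem_parabolic hv
  rw [← simple_mem_parabolic_iff (cs := cs)]
  simpa using mul_mem h (inv_mem hv)

theorem mem_of_isRightDescent {v : W} (hv : v ∈ cs.parabolic J) {i : B}
    (hi : cs.IsRightDescent v i) : i ∈ J :=
  mem_of_isLeftDescent (inv_mem hv) (cs.isLeftDescent_inv_iff.2 hi)

theorem parabolic_mono {J K : Set B} (h : J ⊆ K) : cs.parabolic J ≤ cs.parabolic K :=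
  Subgroup.closure_mono (Set.image_mono h)

/-- If `c ∉ J`, `g ∈ W_J` and `s ∈ J` is a left descent of `c g`, then `s` and `c` commute. -/
theorem commute_of_isLeftDescent_simple_mul {c s : B} (hc : c ∉ J) {g : W}
    (hg : g ∈ cs.parabolic J) (hs : s ∈ J) (h : cs.IsLeftDescent (cs.simple c * g) s) :
    cs.simple s * cs.simple c = cs.simple c * cs.simple s := by
  have hcg : ¬ cs.IsLeftDescent g c := fun h => hc (mem_of_isLeftDescent hg h)
  have hcJ : cs.simple c ∉ cs.parabolic J := fun h => hc (simple_mem_parabolic_iff.1 h)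
  have hsJ := simple_mem_parabolic (cs := cs) hs
  -- Otherwise lifting gives `s c g ≤ g`, which puts `c` in the parabolic subgroup of `J`.
  have h1 : cs.IsLeftDescent (cs.simple s * (cs.simple c * g)) c := by
    by_contra h1
    have h2 := ((simple_mul_ble h).of_simple_mul h1).mem_parabolic hg
    apply hcJ
    rw [← mul_assoc] at h2
    simpa using mul_mem (inv_mem hsJ) (mul_mem h2 (inv_mem hg))
  have h2 := ((simple_mul_ble h).simple_mul_simple_mul h1).mem_parabolic
    (by simpa using hg)
  have h3 : cs.simple c * cs.simple s * cs.simple c ∈ cs.parabolic J := by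
    simpa [mul_assoc] using mul_mem h2 (inv_mem hg)
  have h4 : ¬ cs.IsLeftDescent (cs.simple c * cs.simple s * cs.simple c) c :=
    fun h => hc (mem_of_isLeftDescent h3 h)
  have h5 : ¬ cs.IsLeftDescent (cs.simple s) c := fun h => hc (mem_of_isLeftDescent hsJ h)
  have h6 := cs.not_isLeftDescent_iff.1 h4
  have h7 := cs.not_isLeftDescent_iff.1 h5
  rw [mul_assoc, simple_mul_simple_cancel_left] at h6
  have h8 := cs.length_mul_le (cs.simple s) (cs.simple c)
  have h9 := cs.length_mul_simple (cs.simple c * cs.simple s) c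
  rw [length_simple] at h7 h8
  rw [length_simple] at h8
  rw [← mul_assoc] at h6
  -- `csc` lies in the parabolic subgroup, so `c` is not a descent of it; hence `sc`, of length at
  -- most 2, is longer than `csc`.
  have h10 : cs.length (cs.simple c * cs.simple s * cs.simple c) = 1 := by omega
  obtain ⟨j, hj⟩ := cs.length_eq_one_iff.1 h10
  have hjJ : j ∈ J := by rwa [hj, simple_mem_parabolic_iff] at h3
  have hj' : cs.simple c * cs.simple s = cs.simple j * cs.simple c := by
    rw [← hj]; simp
  by_cases hjs : j = s
  · rw [hj', hjs]
  · exfalso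
    have h11 : cs.BLE (cs.simple s) (cs.simple j * cs.simple c) := hj' ▸ ble_simple_mul h5
    have h12 : ¬ cs.IsLeftDescent (cs.simple s) j := by
      intro h
      have := mem_of_isLeftDescent (J := {s}) (simple_mem_parabolic rfl) h
      exact hjs this
    have h13 := (h11.of_simple_mul h12).eq_of_length_le (by simp)
    exact hc (cs.simple_inj h13 ▸ hs)

end Parabolic

/-! ### Dihedral parabolic subgroups. -/

section Dihedral

theorem isLeftDescent_of_mem_pair {a b : B} {g : W} (hg : g ∈ cs.parabolic {a, b}) (h1 : g ≠ 1)
    (ha : ¬ cs.IsLeftDescent g a) : cs.IsLeftDescent g b := by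
  obtain ⟨i, hi⟩ := cs.exists_leftDescent_of_ne_one h1
  rcases mem_of_isLeftDescent hg hi with rfl | rfl
  · exact absurd hi ha
  · exact hi

theorem parabolic_pair_comm (a b : B) : cs.parabolic {a, b} = cs.parabolic {b, a} := by
  rw [Set.pair_comm]

/-- An element of a dihedral parabolic subgroup is determined by its length and a non-descent. -/
theorem eq_of_not_isLeftDescent {a b : B} {g h : W} (hg : g ∈ cs.parabolic {a, b})
    (hh : h ∈ cs.parabolic {a, b}) (hl : cs.length g = cs.length h)
    (hga : ¬ cs.IsLeftDescent g a) (hha : ¬ cs.IsLeftDescent h a) : g = h := by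
  induction hn : cs.length g generalizing a b g h with
  | zero => rw [cs.length_eq_zero_iff.1 hn, cs.length_eq_zero_iff.1 (hl.symm.trans hn)]
  | succ n ih =>
    have h1 : g ≠ 1 := by rintro rfl; simp at hn
    have h2 : h ≠ 1 := by rintro rfl; rw [hl, length_one] at hn; omega
    have h3 := isLeftDescent_of_mem_pair hg h1 hga
    have h4 := isLeftDescent_of_mem_pair hh h2 hha
    have h5 := cs.isLeftDescent_iff.1 h3
    have h6 := cs.isLeftDescent_iff.1 h4
    have hb : cs.simple b ∈ cs.parabolic {a, b} := simple_mem_parabolic (by simp)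
    have := ih (a := b) (b := a) (g := cs.simple b * g) (h := cs.simple b * h)
      (parabolic_pair_comm (cs := cs) a b ▸ mul_mem hb hg)
      (parabolic_pair_comm (cs := cs) a b ▸ mul_mem hb hh) (by omega)
      (not_isLeftDescent_simple_mul.2 h3) (not_isLeftDescent_simple_mul.2 h4) (by omega)
    simpa using this

theorem eq_of_isLeftDescent {a b : B} {g h : W} (hg : g ∈ cs.parabolic {a, b})
    (hh : h ∈ cs.parabolic {a, b}) (hl : cs.length g = cs.length h)
    (hga : cs.IsLeftDescent g a) (hha : cs.IsLeftDescent h a) : g = h := by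
  have hb : cs.simple a ∈ cs.parabolic {a, b} := simple_mem_parabolic (by simp)
  have h5 := cs.isLeftDescent_iff.1 hga
  have h6 := cs.isLeftDescent_iff.1 hha
  have := eq_of_not_isLeftDescent (mul_mem hb hg) (mul_mem hb hh) (by omega)
    (not_isLeftDescent_simple_mul.2 hga) (not_isLeftDescent_simple_mul.2 hha)
  simpa using this

/-- The set of elements below `g` contains 1 and is stable under left multiplication by `a` and by
`b`. -/
theorem ble_of_isLeftDescent_of_isLeftDescent {a b : B} {g : W} (ha : cs.IsLeftDescent g a)
    (hb : cs.IsLeftDescent g b) {h : W} (hh : h ∈ cs.parabolic {a, b}) : cs.BLE h g := by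
  induction hh using Subgroup.closure_induction_left with
  | one => exact one_ble g
  | mul_left x hx y hy ih =>
    obtain ⟨i, rfl | rfl, rfl⟩ := hx
    exacts [ih.simple_mul_left ha, ih.simple_mul_left hb]
  | inv_mul_cancel x hx y hy ih =>
    obtain ⟨i, rfl | rfl, rfl⟩ := hx <;> rw [inv_simple]
    exacts [ih.simple_mul_left ha, ih.simple_mul_left hb]

end Dihedral

end CoxeterSystem

namespace CoxeterSystem

variable {B : Type*} {M : CoxeterMatrix B} {W : Type*} [Group W] {cs : CoxeterSystem M W}

/-! ### Elements with the same coatoms. -/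

section Coatoms

theorem IsLeftDescent.of_mul_simple {x : W} {r i : B} (hr : cs.IsRightDescent x r)
    (hi : cs.IsLeftDescent (x * cs.simple r) i) : cs.IsLeftDescent x i := by
  have h1 := cs.isRightDescent_iff.1 hr
  have h2 := cs.isLeftDescent_iff.1 hi
  have h3 := cs.length_mul_simple (cs.simple i * (x * cs.simple r)) r
  rw [mul_assoc, simple_mul_simple_cancel_right] at h3
  rw [IsLeftDescent]
  omega

/-- Left descents of `s x = y r'` are descents of `y`, and those of `t y = x r` are descents of `x`.
So `(s x, t y)` satisfies the same hypotheses with `s` and `t` exchanged: both elements are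
alternating words. -/
theorem mem_parabolic_pair_of_simple_mul_eq {x y : W} {s t r r' : B}
    (hl : cs.length x = cs.length y)
    (hx : ∀ i, cs.IsLeftDescent x i → i = s) (hy : ∀ i, cs.IsLeftDescent y i → i = t)
    (h1 : cs.simple t * y = x * cs.simple r) (h2 : cs.simple s * x = y * cs.simple r') :
    x ∈ cs.parabolic {s, t} ∧ y ∈ cs.parabolic {s, t} := by
  induction hn : cs.length x generalizing x y s t r r' with
  | zero =>
    rw [cs.length_eq_zero_iff.1 hn, cs.length_eq_zero_iff.1 (hl.symm.trans hn)]
    exact ⟨one_mem _, one_mem _⟩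
  | succ n ih =>
    have hx1 : x ≠ 1 := by rintro rfl; simp at hn
    have hy1 : y ≠ 1 := by rintro rfl; rw [hl] at hn; simp at hn
    have hs : cs.IsLeftDescent x s := by
      obtain ⟨i, hi⟩ := cs.exists_leftDescent_of_ne_one hx1
      rwa [← hx i hi]
    have ht : cs.IsLeftDescent y t := by
      obtain ⟨i, hi⟩ := cs.exists_leftDescent_of_ne_one hy1
      rwa [← hy i hi]
    have hs' := cs.isLeftDescent_iff.1 hs
    have ht' := cs.isLeftDescent_iff.1 ht
    have hr : cs.IsRightDescent x r := by rw [IsRightDescent, ← h1]; omega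
    have hr' : cs.IsRightDescent y r' := by rw [IsRightDescent, ← h2]; omega
    obtain ⟨h3, h4⟩ := ih (x := cs.simple s * x) (y := cs.simple t * y) (s := t) (t := s)
      (r := r) (r' := r') (by omega)
      (fun i hi => hy i (IsLeftDescent.of_mul_simple hr' (h2 ▸ hi)))
      (fun i hi => hx i (IsLeftDescent.of_mul_simple hr (h1 ▸ hi)))
      (by rw [h1, mul_assoc]) (by rw [h2, ← mul_assoc, h1]) (by omega)
    rw [parabolic_pair_comm] at h3 h4
    constructor
    · simpa using mul_mem (simple_mem_parabolic (cs := cs) (J := {s, t}) (i := s) (by simp)) h3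
    · simpa using mul_mem (simple_mem_parabolic (cs := cs) (J := {s, t}) (i := t) (by simp)) h4

/-- Distinct elements with the same coatoms lie in a common dihedral parabolic subgroup. -/
theorem exists_mem_parabolic_pair_of_coatoms_eq {x y : W} (hx1 : x ≠ 1) (hne : x ≠ y)
    (h : ∀ z, cs.Cov z x ↔ cs.Cov z y) :
    ∃ s t, x ∈ cs.parabolic {s, t} ∧ y ∈ cs.parabolic {s, t} := by
  -- A common left descent `i` makes `i x` a coatom of `y`; then `i x = i y`, or `i` is a descent of
  -- `i x`, and neither is possible.
  have disj : ∀ {x y : W}, x ≠ y → (∀ z, cs.Cov z x ↔ cs.Cov z y) →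
      ∀ i, cs.IsLeftDescent x i → ¬ cs.IsLeftDescent y i := by
    intro x y hne h i hi hi'
    rcases ((h _).1 (simple_mul_cov hi)).eq_simple_mul_or hi' with h1 | h1
    · exact hne (by simpa using h1)
    · exact not_isLeftDescent_simple_mul.2 hi h1
  -- `x r` is a coatom of `y`. It cannot have the descent `t`, which `x` would inherit, so it equals
  -- `t y`.
  have key : ∀ {x y : W}, x ≠ y → (∀ z, cs.Cov z x ↔ cs.Cov z y) → ∀ r t,
      cs.IsRightDescent x r → cs.IsLeftDescent y t → cs.simple t * y = x * cs.simple r := by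
    intro x y hne h r t hr ht
    rcases ((h _).1 (mul_simple_cov hr)).eq_simple_mul_or ht with h1 | h1
    · exact h1.symm
    · exact absurd ht (disj hne h _ (IsLeftDescent.of_mul_simple hr h1))
  obtain ⟨s, hs⟩ := cs.exists_leftDescent_of_ne_one hx1
  have hl : cs.length x = cs.length y := by
    have h1 := (simple_mul_cov hs).2
    have h2 := ((h _).1 (simple_mul_cov hs)).2
    omega
  have hy1 : y ≠ 1 := by
    rintro rfl
    rw [length_one, length_eq_zero_iff] at hl
    exact hx1 hl
  obtain ⟨t, ht⟩ := cs.exists_leftDescent_of_ne_one hy1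
  obtain ⟨r, hr⟩ := cs.exists_rightDescent_of_ne_one hx1
  obtain ⟨r', hr'⟩ := cs.exists_rightDescent_of_ne_one hy1
  have h1 := fun t ht => key hne h r t hr ht
  have h2 := fun s hs => key hne.symm (fun z => (h z).symm) r' s hr' hs
  refine ⟨s, t, mem_parabolic_pair_of_simple_mul_eq hl (fun i hi => ?_) (fun i hi => ?_)
    (h1 t ht) (h2 s hs)⟩
  · exact cs.simple_inj (mul_right_cancel ((h2 i hi).trans (h2 s hs).symm))
  · exact cs.simple_inj (mul_right_cancel ((h1 i hi).trans (h1 t ht).symm))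

end Coatoms

/-! ### Matchings as functions on `W`, and their rigidity. -/

variable (cs) in
/-- A partial matching with domain `Q`, as a function on `W` with irrelevant values outside `Q`. -/
structure IsMatchingOn (Q : Set W) (f : W → W) : Prop where
  lower : ∀ {u v}, cs.BLE u v → v ∈ Q → u ∈ Q
  maps : ∀ {u}, u ∈ Q → f u ∈ Q
  invol : ∀ {u}, u ∈ Q → f (f u) = u
  cov : ∀ {u}, u ∈ Q → cs.Cov u (f u) ∨ cs.Cov (f u) u
  coat : ∀ {u}, u ∈ Q → cs.Cov u (f u) → ∀ x,
    cs.Cov x (f u) ↔ x = u ∨ ∃ v, cs.Cov v u ∧ cs.Cov v (f v) ∧ f v = x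

theorem Cov.asymm {u v : W} (h : cs.Cov u v) (h' : cs.Cov v u) : False := by
  have := h.2; have := h'.2; omega

namespace IsMatchingOn

variable {Q : Set W} {f g : W → W} {a : B}

/-- If `w` were matched downward, the coatom condition at `f w` would apply to `u ⋖ w`: either `u =
f w`, so `f u = w`, or `u = f v` with `v` matched upward, so `u` is matched downward. -/
theorem up_of_cov (hf : cs.IsMatchingOn Q f) {u w : W} (hw : w ∈ Q) (h : cs.Cov u w)
    (hu : cs.Cov u (f u)) (hne : f u ≠ w) : cs.Cov w (f w) ∧ cs.Cov (f u) (f w) := by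
  have hwu : cs.Cov w (f w) := by
    refine (hf.cov hw).resolve_right fun h1 => ?_
    have h2 : cs.Cov (f w) (f (f w)) := by rwa [hf.invol hw]
    have h3 : cs.Cov u (f (f w)) := by rwa [hf.invol hw]
    rcases (hf.coat (hf.maps hw) h2 u).1 h3 with rfl | ⟨v, h4, h5, rfl⟩
    · exact hne (hf.invol hw)
    · rw [hf.invol (hf.lower (h4.1.trans h1.1) hw)] at hu
      exact h5.asymm hu
  exact ⟨hwu, (hf.coat hw hwu _).2 (Or.inr ⟨u, h, hu, rfl⟩)⟩

/-- By induction all coatoms of `z = f u` lie in the parabolic subgroup when `u ≠ 1` is matched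
upward. A coatom `z r` has a left descent `j ∈ J`; this is a descent of `z` too, so `j z` is again a
coatom, and `z` is recovered from `j` and `j z`. -/
theorem mem_parabolic (hf : cs.IsMatchingOn Q f) (h1 : f 1 = cs.simple a) {J : Set B} (ha : a ∈ J)
    {u : W} (hu : u ∈ Q) (huJ : u ∈ cs.parabolic J) : f u ∈ cs.parabolic J := by
  induction hn : cs.length u using Nat.strong_induction_on generalizing u with
  | _ n ih =>
  rcases hf.cov hu with h | h
  · rcases eq_or_ne u 1 with rfl | hu1
    · rw [h1]; exact simple_mem_parabolic ha
    · have hcoat : ∀ x, cs.Cov x (f u) → x ∈ cs.parabolic J := by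
        intro x hx
        rcases (hf.coat hu h x).1 hx with rfl | ⟨v, h2, h3, rfl⟩
        · exact huJ
        · exact ih _ (by have := h2.2; omega) (hf.lower h2.1 hu) (h2.1.mem_parabolic huJ) rfl
      have hz1 : f u ≠ 1 := by
        intro h2; have := h.2; rw [h2, length_one] at this; omega
      obtain ⟨r, hr⟩ := cs.exists_rightDescent_of_ne_one hz1
      have h2 := mul_simple_cov hr
      have h3 : f u * cs.simple r ≠ 1 := by
        intro h3
        have h4 := h2.2
        rw [h3, length_one] at h4
        exact hu1 (cs.length_eq_zero_iff.1 (by have := h.2; omega))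
      obtain ⟨j, hj⟩ := cs.exists_leftDescent_of_ne_one h3
      have hjJ := mem_of_isLeftDescent (hcoat _ h2) hj
      have h5 := hcoat _ (simple_mul_cov (IsLeftDescent.of_mul_simple hr hj))
      simpa using mul_mem (simple_mem_parabolic (cs := cs) hjJ) h5
  · exact h.1.mem_parabolic huJ

/-- Descend along coatoms `v` of `u`: either `f v ⋖ f u` with `v` matched upward, or `v` itself is
the image of the shorter element `f v`. This ensures that a dihedral subgroup containing `f u`
passes through `a`. -/
theorem simple_ble (hf : cs.IsMatchingOn Q f) (h1 : f 1 = cs.simple a) {u : W} (hu : u ∈ Q)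
    (h : cs.Cov u (f u)) : cs.BLE (cs.simple a) (f u) := by
  induction hn : cs.length u using Nat.strong_induction_on generalizing u with
  | _ n ih =>
  rcases eq_or_ne u 1 with rfl | hu1
  · rw [h1]; exact .refl _
  · obtain ⟨i, hi⟩ := cs.exists_leftDescent_of_ne_one hu1
    have hv := simple_mul_cov hi
    set v := cs.simple i * u
    have hvQ := hf.lower hv.1 hu
    have hvl := hv.2
    rcases hf.cov hvQ with h2 | h2
    · have h3 : f v ≠ u := by
        intro h3
        rw [← h3, hf.invol hvQ] at h
        exact h2.asymm h
      exact (ih _ (by omega) hvQ h2 rfl).trans (hf.up_of_cov hu hv h2 h3).2.1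
    · have h3 := ih _ (by have := h2.2; omega) (hf.maps hvQ) (by rwa [hf.invol hvQ]) rfl
      rw [hf.invol hvQ] at h3
      exact h3.trans (hv.1.trans h.1)

/-- The value of a matching at an element outside the dihedral parabolic subgroups containing `a`
is determined by its values at the coatoms. -/
theorem eq_of_forall_cov (hf : cs.IsMatchingOn Q f) (hg : cs.IsMatchingOn Set.univ g)
    (h1 : f 1 = cs.simple a) {u : W} (hu : u ∈ Q)
    (hdih : ∀ t, u ∉ cs.parabolic {a, t}) (h : ∀ v, cs.Cov v u → f v = g v) : f u = g u := by
  rcases hf.cov hu with h2 | h2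
  · rcases hg.cov (Set.mem_univ u) with h3 | h3
    · by_contra hne
      have hu1 : f u ≠ 1 := by
        intro h4; have := h2.2; rw [h4, length_one] at this; omega
      obtain ⟨s, t, hs, -⟩ := exists_mem_parabolic_pair_of_coatoms_eq hu1 hne <| by
        intro z
        rw [hf.coat hu h2, hg.coat (Set.mem_univ u) h3]
        refine or_congr Iff.rfl (exists_congr fun v => and_congr_right fun hv => ?_)
        rw [h v hv]
      have ha := (hf.simple_ble h1 hu h2).mem_parabolic hs
      rw [simple_mem_parabolic_iff] at ha
      rcases ha with rfl | rfl
      · exact hdih _ (h2.1.mem_parabolic hs)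
      · exact hdih _ (h2.1.mem_parabolic (parabolic_pair_comm (cs := cs) _ _ ▸ hs))
    · have h4 := h _ h3
      rw [hg.invol (Set.mem_univ u)] at h4
      have h5 := congrArg f h4
      rw [hf.invol (hf.lower h3.1 hu)] at h5
      exact h5.symm
  · have h4 := h _ h2
    rw [hf.invol hu] at h4
    have h5 := congrArg g h4
    rw [hg.invol (Set.mem_univ _)] at h5
    exact h5.symm

/-- A matching is determined by its restrictions to the dihedral parabolic subgroups
containing `a`. -/
theorem eqOn_of_eqOn_parabolic (hf : cs.IsMatchingOn Q f) (hg : cs.IsMatchingOn Set.univ g)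
    (h1 : f 1 = cs.simple a) (h : ∀ t, ∀ u ∈ Q, u ∈ cs.parabolic {a, t} → f u = g u) {u : W}
    (hu : u ∈ Q) : f u = g u := by
  induction hn : cs.length u using Nat.strong_induction_on generalizing u with
  | _ n ih =>
  by_cases hd : ∃ t, u ∈ cs.parabolic {a, t}
  · obtain ⟨t, ht⟩ := hd
    exact h t u hu ht
  · push Not at hd
    exact hf.eq_of_forall_cov hg h1 hu hd
      (fun v hv => ih _ (by have := hv.2; omega) (hf.lower hv.1 hu) rfl)

/-- The coatom condition is the lifting property: a coatom of `a u` other than `u` has the left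
descent `a`. -/
theorem left_mul (a : B) : cs.IsMatchingOn Set.univ (fun w => cs.simple a * w) where
  lower _ _ := trivial
  maps _ := trivial
  invol _ := by simp
  cov _ := cov_simple_mul_or _ _
  coat := by
    intro u _ h x
    have hu : ¬ cs.IsLeftDescent u a := by rw [cs.not_isLeftDescent_iff]; exact h.2
    have hu' : cs.IsLeftDescent (cs.simple a * u) a := isLeftDescent_simple_mul.2 hu
    constructor
    · intro hx
      rcases hx.eq_simple_mul_or hu' with h1 | h1
      · left; simpa using h1
      · right
        have h2 := hx.simple_mul_simple_mul h1 hu'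
        rw [simple_mul_simple_cancel_left] at h2
        refine ⟨_, h2, ?_, ?_⟩
        · simpa using simple_mul_cov h1
        · simp
    · rintro (rfl | ⟨v, h1, h2, rfl⟩)
      · exact h
      · refine h1.simple_mul_mono ?_ hu
        rw [cs.not_isLeftDescent_iff]
        exact h2.2

/-- Inversion is an automorphism of the Bruhat order; it exchanges left and right multiplication. -/
theorem inv_conj (hf : cs.IsMatchingOn Set.univ f) :
    cs.IsMatchingOn Set.univ (fun w => (f w⁻¹)⁻¹) where
  lower _ _ := trivial
  maps _ := trivial
  invol _ := by simp [hf.invol]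
  cov {u} _ := by
    have := hf.cov (Set.mem_univ u⁻¹)
    rwa [← cov_inv_iff, inv_inv, ← cov_inv_iff (u := f u⁻¹), inv_inv] at this
  coat := by
    intro u _ h x
    rw [← cov_inv_iff, inv_inv] at h
    rw [← cov_inv_iff, inv_inv, hf.coat (Set.mem_univ _) h, inv_inj]
    refine or_congr Iff.rfl ⟨?_, ?_⟩
    · rintro ⟨v, h1, h2, h3⟩
      refine ⟨v⁻¹, ?_, ?_, ?_⟩
      · rwa [← cov_inv_iff, inv_inv]
      · rw [inv_inv]; exact h2.inv
      · rw [inv_inv, h3, inv_inv]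
    · rintro ⟨v, h1, h2, h3⟩
      refine ⟨v⁻¹, h1.inv, ?_, ?_⟩
      · rwa [← cov_inv_iff, inv_inv]
      · rw [← h3, inv_inv]

theorem right_mul (a : B) : cs.IsMatchingOn Set.univ (fun w => w * cs.simple a) := by
  simpa using (left_mul (cs := cs) a).inv_conj

end IsMatchingOn

end CoxeterSystem

namespace CoxeterSystem

variable {B : Type*} {M : CoxeterMatrix B} {W : Type*} [Group W] {cs : CoxeterSystem M W}

local notation "σ" => CoxeterSystem.simple cs

/-! ### Short words and the values at the generators. -/

section Words

theorem not_isLeftDescent_of_mem {J : Set B} {g : W} (hg : g ∈ cs.parabolic J) {i : B}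
    (hi : i ∉ J) : ¬ cs.IsLeftDescent g i := fun h => hi (mem_of_isLeftDescent hg h)

theorem cov_simple_mul_of_mem {J : Set B} {g : W} (hg : g ∈ cs.parabolic J) {i : B}
    (hi : i ∉ J) : cs.Cov g (σ i * g) := cov_simple_mul (not_isLeftDescent_of_mem hg hi)

theorem simple_mem_pair_left (a b : B) : σ a ∈ cs.parabolic {a, b} :=
  simple_mem_parabolic (by simp)

theorem simple_mem_pair_right (a b : B) : σ b ∈ cs.parabolic {a, b} :=
  simple_mem_parabolic (by simp)

theorem isLeftDescent_of_not {g : W} {i : B} (h : ¬ cs.IsLeftDescent g i) :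
    cs.IsLeftDescent (σ i * g) i := isLeftDescent_simple_mul.2 h

theorem simple_cov_left {a s : B} (h : a ≠ s) : cs.Cov (σ s) (σ a * σ s) :=
  cov_simple_mul_of_mem (J := {s}) (simple_mem_parabolic rfl) (by simpa using h)

theorem simple_cov_right {a s : B} (h : a ≠ s) : cs.Cov (σ a) (σ a * σ s) := by
  rw [← cov_inv_iff]
  simpa using simple_cov_left (cs := cs) h.symm

theorem not_isLeftDescent_simple {a s : B} (h : a ≠ s) : ¬ cs.IsLeftDescent (σ s) a :=
  not_isLeftDescent_of_mem (J := {s}) (simple_mem_parabolic rfl) (by simpa using h)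

theorem ne_of_not_commute {a s : B} (h : σ a * σ s ≠ σ s * σ a) : a ≠ s := by
  rintro rfl; exact h rfl

/-- With both letters as descents, `as` would lie above `sa`, which has the same length, and the
generators would commute. -/
theorem isLeftDescent_mul_eq {a s : B} (h : σ a * σ s ≠ σ s * σ a) {d : B}
    (hd : cs.IsLeftDescent (σ a * σ s) d) : d = a := by
  have has := ne_of_not_commute h
  have hm : σ a * σ s ∈ cs.parabolic {a, s} :=
    mul_mem (simple_mem_pair_left a s) (simple_mem_pair_right a s)
  rcases mem_of_isLeftDescent hm hd with rfl | rfl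
  · rfl
  · exfalso
    have h1 := ble_of_isLeftDescent_of_isLeftDescent
      (isLeftDescent_of_not (not_isLeftDescent_simple has)) hd
      (mul_mem (simple_mem_pair_right a d) (simple_mem_pair_left a d))
    refine h (h1.eq_of_length_le ?_).symm
    rw [(simple_cov_left (cs := cs) has).2, (simple_cov_right (cs := cs) has.symm).2]

theorem simple_not_mem {J : Set B} {c : B} (hc : c ∉ J) : σ c ∉ cs.parabolic J :=
  fun h => hc (simple_mem_parabolic_iff.1 h)

end Words

namespace IsMatchingOn

variable {f : W → W} {a : B}

theorem apply_simple_ne_one (hf : cs.IsMatchingOn Set.univ f) (h1 : f 1 = σ a) {s : B}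
    (hs : s ≠ a) : cs.Cov (σ s) (f (σ s)) := by
  refine (hf.cov (Set.mem_univ _)).resolve_right fun h => ?_
  have h2 := h.2
  rw [length_simple] at h2
  have h3 : f (σ s) = 1 := cs.length_eq_zero_iff.1 (by omega)
  have h4 := hf.invol (Set.mem_univ (σ s))
  rw [h3, h1] at h4
  exact hs (cs.simple_inj h4.symm)

/-- For `s ≠ a` the image has length 2 in `⟨a, s⟩`, where an element is determined by its length and
a left descent. -/
theorem apply_simple (hf : cs.IsMatchingOn Set.univ f) (h1 : f 1 = σ a) (s : B) :
    f (σ s) = σ a * σ s ∨ f (σ s) = σ s * σ a := by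
  by_cases hs : s = a
  · subst hs
    left
    rw [← h1, hf.invol (Set.mem_univ _), h1]
    simp
  have hup := hf.apply_simple_ne_one h1 hs
  have hm : f (σ s) ∈ cs.parabolic {a, s} :=
    hf.mem_parabolic h1 (by simp) (Set.mem_univ _) (simple_mem_pair_right a s)
  have hl := hup.2
  have hne : f (σ s) ≠ 1 := by intro h; rw [h] at hl; simp at hl
  by_cases hd : cs.IsLeftDescent (f (σ s)) a
  · left
    refine eq_of_isLeftDescent hm
      (mul_mem (simple_mem_pair_left a s) (simple_mem_pair_right a s)) ?_ hd
      (isLeftDescent_of_not (not_isLeftDescent_simple (Ne.symm hs)))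
    rw [hl, (simple_cov_left (cs := cs) (Ne.symm hs)).2]
  · right
    have hd' := isLeftDescent_of_mem_pair hm hne hd
    rw [parabolic_pair_comm] at hm
    refine eq_of_isLeftDescent hm
      (mul_mem (simple_mem_pair_left s a) (simple_mem_pair_right s a)) ?_ hd'
      (isLeftDescent_of_not (not_isLeftDescent_simple hs))
    rw [hl, (simple_cov_right (cs := cs) hs).2]

end IsMatchingOn

/-! ### Left and right behaviour cannot be mixed. -/

section Mixed

variable {a s t : B}

theorem isLeftDescent_triple_eq (hst : s ≠ t) (hs : σ a * σ s ≠ σ s * σ a)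
    (ht : σ a * σ t ≠ σ t * σ a) (hc : σ s * σ t = σ t * σ s) {d : B}
    (hd : cs.IsLeftDescent (σ s * (σ a * σ t)) d) : d = s := by
  have has := ne_of_not_commute hs
  have hat := ne_of_not_commute ht
  have hm : σ s * (σ a * σ t) ∈ cs.parabolic {s, a, t} :=
    mul_mem (simple_mem_parabolic (by simp)) (mul_mem (simple_mem_parabolic (by simp))
      (simple_mem_parabolic (by simp)))
  have hatm : σ a * σ t ∈ cs.parabolic {a, t} :=
    mul_mem (simple_mem_pair_left a t) (simple_mem_pair_right a t)
  have hs' : s ∉ ({a, t} : Set B) := by simp [has.symm, hst]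
  have hcov := cov_simple_mul_of_mem hatm hs'
  have hl2 := (simple_cov_left (cs := cs) hat).2
  rcases mem_of_isLeftDescent hm hd with rfl | rfl | rfl
  · rfl
  · exfalso
    have h1 := ble_of_isLeftDescent_of_isLeftDescent hd
      (isLeftDescent_of_not (not_isLeftDescent_of_mem hatm hs'))
      (mul_mem (simple_mem_pair_left d s) (simple_mem_pair_right d s))
    have h2 := h1.of_simple_mul (fun h => has.symm (isLeftDescent_mul_eq hs h))
    have h3 := h2.eq_of_length_le (by rw [hl2, (simple_cov_left (cs := cs) has).2]; simp)
    exact hst (cs.simple_inj (mul_left_cancel h3))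
  · exfalso
    have h1 : cs.Cov (σ a * σ d) (σ d * (σ a * σ d)) :=
      cov_simple_mul fun h => hat.symm (isLeftDescent_mul_eq ht h)
    have h2 := cov_simple_mul_of_mem (mul_mem (simple_mem_pair_right a d) hatm) hs'
    have h3 := cs.isLeftDescent_iff.1 hd
    rw [← mul_assoc, ← hc, mul_assoc] at h3
    have := h1.2; have := h2.2; have := hcov.2
    omega

variable {f : W → W}

/-- `f (st)` covers `st`, `as` and `ta`; its left descents force `f (st) = tas` and `st = ts`. Then
`f (sat)` covers `sat`, `tas`, an element of `⟨a, s⟩` and one of `⟨a, t⟩`, and no left descent is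
compatible with all four. -/
theorem IsMatchingOn.false_of_mixed (hf : cs.IsMatchingOn Set.univ f) (h1 : f 1 = σ a)
    (hs : σ a * σ s ≠ σ s * σ a) (ht : σ a * σ t ≠ σ t * σ a)
    (hfs : f (σ s) = σ a * σ s) (hft : f (σ t) = σ t * σ a) : False := by
  have has := ne_of_not_commute hs
  have hat := ne_of_not_commute ht
  have hst : s ≠ t := by
    rintro rfl
    exact hs (hfs.symm.trans hft)
  have has_st : a ∉ ({s, t} : Set B) := by simp [has, hat]
  have hs_at : s ∉ ({a, t} : Set B) := by simp [has.symm, hst]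
  have ht_as : t ∉ ({a, s} : Set B) := by simp [hat.symm, hst.symm]
  have hss : σ s ∈ cs.parabolic {s, t} := simple_mem_pair_left s t
  have htt : σ t ∈ cs.parabolic {s, t} := simple_mem_pair_right s t
  have hstm := mul_mem hss htt
  -- the value at `st`
  have e1 : σ a * σ s ≠ σ s * σ t := fun h =>
    simple_not_mem has_st ((mul_mem_cancel_right hss).1 (h ▸ hstm))
  have e2 : σ t * σ a ≠ σ s * σ t := fun h =>
    simple_not_mem has_st ((mul_mem_cancel_left htt).1 (h ▸ hstm))
  have e3 : σ a * σ s ≠ σ t * σ a := fun h =>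
    simple_not_mem hs_at ((mul_mem_cancel_left (simple_mem_pair_left a t)).1
      (h ▸ mul_mem (simple_mem_pair_right a t) (simple_mem_pair_left a t)))
  have us := hf.apply_simple_ne_one h1 has.symm
  have ut := hf.apply_simple_ne_one h1 hat.symm
  obtain ⟨c1, c2⟩ := hf.up_of_cov (Set.mem_univ _) (simple_cov_right hst) us (hfs ▸ e1)
  obtain ⟨-, c3⟩ := hf.up_of_cov (Set.mem_univ _) (simple_cov_left hst) ut (hft ▸ e2)
  rw [hfs] at c2
  rw [hft] at c3
  have hkey : σ s * σ t = σ t * σ s ∧ f (σ s * σ t) = σ t * (σ a * σ s) := by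
    have hz : f (σ s * σ t) ≠ 1 := by intro h; have := c1.2; rw [h] at this; simp at this
    obtain ⟨d, hd⟩ := cs.exists_leftDescent_of_ne_one hz
    rcases c2.eq_simple_mul_or hd with h2 | h2 <;> rcases c3.eq_simple_mul_or hd with h3 | h3
    · exact absurd (h2.trans h3.symm) e3
    · have hdt := isLeftDescent_mul_eq ht.symm h3
      subst hdt
      refine ⟨?_, by rw [h2]; simp⟩
      rcases c1.eq_simple_mul_or hd with h4 | h4
      · exact absurd (h2.trans h4.symm) e1
      · by_contra hne
        exact hst.symm (isLeftDescent_mul_eq hne h4)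
    · have hda := isLeftDescent_mul_eq hs h2
      subst hda
      rcases c1.eq_simple_mul_or hd with h4 | h4
      · exact absurd (h3.trans h4.symm) e2
      · exact absurd h4 (not_isLeftDescent_of_mem hstm has_st)
    · exact absurd ((isLeftDescent_mul_eq hs h2).symm.trans (isLeftDescent_mul_eq ht.symm h3)) hat
  obtain ⟨hc, hfst⟩ := hkey
  -- the value at `sat`
  have hatm : σ a * σ t ∈ cs.parabolic {a, t} :=
    mul_mem (simple_mem_pair_left a t) (simple_mem_pair_right a t)
  have hasm : σ s * σ a ∈ cs.parabolic {a, s} :=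
    mul_mem (simple_mem_pair_right a s) (simple_mem_pair_left a s)
  have D1 : ∀ d, cs.IsLeftDescent (σ s * (σ a * σ t)) d → d = s :=
    fun d => isLeftDescent_triple_eq hst hs ht hc
  have D2 : ∀ d, cs.IsLeftDescent (σ t * (σ a * σ s)) d → d = t :=
    fun d => isLeftDescent_triple_eq hst.symm ht hs hc.symm
  have k1 : cs.Cov (σ a * σ t) (σ s * (σ a * σ t)) := cov_simple_mul_of_mem hatm hs_at
  have k2 : cs.Cov (σ s * σ t) (σ s * (σ a * σ t)) :=
    (simple_cov_left hat).simple_mul_mono (not_isLeftDescent_simple hst)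
      (not_isLeftDescent_of_mem hatm hs_at)
  have k3 : cs.Cov (σ s * σ a) (σ s * (σ a * σ t)) := by
    rw [← mul_assoc]
    exact cov_mul_simple fun h => ht_as (mem_of_isRightDescent hasm h)
  have e4 : σ t * (σ a * σ s) ≠ σ s * (σ a * σ t) := by
    intro h
    have h5 : cs.IsLeftDescent (σ t * (σ a * σ s)) t := isLeftDescent_of_not
      (not_isLeftDescent_of_mem (mul_mem (simple_mem_pair_left a s) (simple_mem_pair_right a s))
        ht_as)
    exact hst.symm (D1 _ (h ▸ h5))
  obtain ⟨m1, m2⟩ := hf.up_of_cov (Set.mem_univ _) k2 c1 (hfst ▸ e4)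
  rw [hfst] at m2
  have hg := hf.mem_parabolic h1 (J := {a, s}) (by simp) (Set.mem_univ _) hasm
  have hh := hf.mem_parabolic h1 (J := {a, t}) (by simp) (Set.mem_univ _) hatm
  have e5 : f (σ s * σ a) ≠ σ s * (σ a * σ t) := by
    intro h
    rw [h, ← mul_assoc] at hg
    exact simple_not_mem ht_as ((mul_mem_cancel_left hasm).1 hg)
  have e6 : f (σ a * σ t) ≠ σ s * (σ a * σ t) := by
    intro h
    rw [h] at hh
    exact simple_not_mem hs_at ((mul_mem_cancel_right hatm).1 hh)
  have ug := (hf.up_of_cov (Set.mem_univ _) (simple_cov_right has.symm) us (hfs ▸ hs)).1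
  have uh := (hf.up_of_cov (Set.mem_univ _) (simple_cov_left hat) ut (hft ▸ ht.symm)).1
  have m3 := (hf.up_of_cov (Set.mem_univ _) k3 ug e5).2
  have m4 := (hf.up_of_cov (Set.mem_univ _) k1 uh e6).2
  have hz : f (σ s * (σ a * σ t)) ≠ 1 := by intro h; have := m1.2; rw [h] at this; simp at this
  obtain ⟨d, hd⟩ := cs.exists_leftDescent_of_ne_one hz
  rcases m1.eq_simple_mul_or hd with h2 | h2
  · rcases m2.eq_simple_mul_or hd with h3 | h3
    · exact e4 (h3.trans h2.symm)
    · obtain rfl := D2 _ h3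
      rcases m3.eq_simple_mul_or hd with h4 | h4
      · exact e5 (h4.trans h2.symm)
      · exact not_isLeftDescent_of_mem hg ht_as h4
  · obtain rfl := D1 _ h2
    rcases m2.eq_simple_mul_or hd with h3 | h3
    · rcases m4.eq_simple_mul_or hd with h4 | h4
      · have h5 := hh
        rw [h4, ← h3] at h5
        refine simple_not_mem (cs := cs) hs_at ?_
        have h6 := (mul_mem_cancel_left (simple_mem_pair_right a t)).1 h5
        exact (mul_mem_cancel_left (simple_mem_pair_left a t)).1 h6
      · exact not_isLeftDescent_of_mem hh hs_at h4
    · exact hst (D2 _ h3)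

end Mixed

end CoxeterSystem

/-! ### The shortest deviation from left multiplication. -/

namespace CoxeterSystem

variable {B : Type*} {M : CoxeterMatrix B} {W : Type*} [Group W] {cs : CoxeterSystem M W}

local notation "σ" => CoxeterSystem.simple cs

variable {f : W → W} {a s c : B} {x : W}

variable (cs) in
/-- `x` is an element of minimal length at which the matching `f` differs from the left
multiplication by `a`, and it lies in the dihedral parabolic subgroup of `a` and `s`. -/
structure IsFirstDefect (f : W → W) (a s : B) (x : W) : Prop where
  matching : cs.IsMatchingOn Set.univ f
  map_one : f 1 = σ a
  map_simple : f (σ s) = σ a * σ s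
  ne : s ≠ a
  mem : x ∈ cs.parabolic {a, s}
  apply_ne : f x ≠ σ a * x
  apply_of_lt : ∀ v, cs.length v < cs.length x → f v = σ a * v

namespace IsFirstDefect

/-- If `ax` were shorter than `x`, minimality would give `f (ax) = x`, and `f x = ax` by
involutivity. -/
theorem not_isLeftDescent (h : cs.IsFirstDefect f a s x) : ¬ cs.IsLeftDescent x a := by
  intro h1
  have h2 := h.apply_of_lt (σ a * x) h1
  rw [simple_mul_simple_cancel_left] at h2
  apply h.apply_ne
  rw [← h2, h.matching.invol (Set.mem_univ _), h2]

theorem ne_one (h : cs.IsFirstDefect f a s x) : x ≠ 1 := by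
  rintro rfl
  exact h.apply_ne (by rw [h.map_one, mul_one])

theorem isLeftDescent (h : cs.IsFirstDefect f a s x) : cs.IsLeftDescent x s :=
  isLeftDescent_of_mem_pair h.mem h.ne_one h.not_isLeftDescent

theorem two_le_length (h : cs.IsFirstDefect f a s x) : 2 ≤ cs.length x := by
  have h1 := mt cs.length_eq_zero_iff.1 h.ne_one
  have h2 : cs.length x ≠ 1 := by
    intro h2
    have h3 := cs.isLeftDescent_iff.1 h.isLeftDescent
    have h4 : σ s * x = 1 := cs.length_eq_zero_iff.1 (by omega)
    have h5 : x = σ s := by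
      rw [← cs.simple_mul_simple_cancel_left (w := x) s, h4, mul_one]
    exact h.apply_ne (h5 ▸ h.map_simple)
  omega

theorem cov (h : cs.IsFirstDefect f a s x) : cs.Cov x (f x) := by
  refine (h.matching.cov (Set.mem_univ _)).resolve_right fun h1 => ?_
  have h2 := h.apply_of_lt (f x) (by have := h1.2; omega)
  rw [h.matching.invol (Set.mem_univ _)] at h2
  exact h.apply_ne (by rw [h2, simple_mul_simple_cancel_left, ← h2])

theorem apply_mem (h : cs.IsFirstDefect f a s x) : f x ∈ cs.parabolic {a, s} :=
  h.matching.mem_parabolic h.map_one (by simp) (Set.mem_univ _) h.mem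

theorem simple_mul_mem (h : cs.IsFirstDefect f a s x) : σ a * x ∈ cs.parabolic {a, s} :=
  mul_mem (simple_mem_pair_left a s) h.mem

theorem length_simple_mul (h : cs.IsFirstDefect f a s x) :
    cs.length (σ a * x) = cs.length x + 1 := cs.not_isLeftDescent_iff.1 h.not_isLeftDescent

/-- The only element of `⟨a, s⟩` of length `ℓ(x) + 1` with left descent `a` is `ax`. -/
theorem eq_of_isLeftDescent_apply (h : cs.IsFirstDefect f a s x) {d : B}
    (hd : cs.IsLeftDescent (f x) d) : d = s := by
  rcases mem_of_isLeftDescent h.apply_mem hd with rfl | rfl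
  · exfalso
    exact h.apply_ne (eq_of_isLeftDescent h.apply_mem h.simple_mul_mem
      (by rw [h.length_simple_mul, h.cov.2]) hd (isLeftDescent_of_not h.not_isLeftDescent))
  · rfl

/-- No element of length `ℓ(x) + 1` has both `a` and `s` as left descents. -/
theorem false_of_descents (h : cs.IsFirstDefect f a s x) {w : W}
    (hw : cs.length w = cs.length x + 1) (h1 : cs.IsLeftDescent w a)
    (h2 : cs.IsLeftDescent w s) : False := by
  have h3 := (ble_of_isLeftDescent_of_isLeftDescent h1 h2 h.apply_mem).eq_of_length_le
    (by rw [hw, h.cov.2])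
  have h4 := (ble_of_isLeftDescent_of_isLeftDescent h1 h2 h.simple_mul_mem).eq_of_length_le
    (by rw [hw, h.length_simple_mul])
  exact h.apply_ne (h3.trans h4.symm)

theorem apply_eq_of_length_le (h : cs.IsFirstDefect f a s x) {v : W}
    (hv : cs.length v ≤ cs.length x) (hd : ∀ t, v ∉ cs.parabolic {a, t}) : f v = σ a * v :=
  h.matching.eq_of_forall_cov (IsMatchingOn.left_mul a) h.map_one (Set.mem_univ _) hd
    fun w hw => h.apply_of_lt w (by have := hw.2; omega)

/-- Take a coatom `x' = x r` of `x`. Then `f (cx)` covers `cx`, `f x` and `f (cx') = acx'`. Since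
`a` is never a left descent of `cg` for `g ∈ ⟨a, s⟩`, no left descent of `f (cx)` is compatible with
all three. -/
theorem false_of_not_commute (h : cs.IsFirstDefect f a s x) (hc : c ∉ ({a, s} : Set B))
    (hac : σ a * σ c ≠ σ c * σ a) : False := by
  have hf := h.matching
  have hcm := simple_not_mem (cs := cs) hc
  have haJ : a ∈ ({a, s} : Set B) := by simp
  have hsJ : s ∈ ({a, s} : Set B) := by simp
  have nda : ∀ g ∈ cs.parabolic {a, s}, ¬ cs.IsLeftDescent (σ c * g) a := fun g hg hd =>
    hac (commute_of_isLeftDescent_simple_mul hc hg haJ hd)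
  -- `w = c x`
  have xw := cov_simple_mul_of_mem h.mem hc
  have hcw : ∀ g ∈ cs.parabolic {a, s}, g ≠ σ c * x := fun g hg e =>
    hcm ((mul_mem_cancel_right h.mem).1 (e ▸ hg))
  obtain ⟨wz, uz⟩ := hf.up_of_cov (Set.mem_univ _) xw h.cov (hcw _ h.apply_mem)
  -- `v = c x'`
  obtain ⟨r, hr⟩ := cs.exists_rightDescent_of_ne_one h.ne_one
  have x'x := mul_simple_cov hr
  have hx' := x'x.1.mem_parabolic h.mem
  set x' := x * σ r
  have hx'l := x'x.2
  have hk := h.two_le_length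
  have hx's : cs.IsLeftDescent x' s := by
    refine isLeftDescent_of_mem_pair hx' ?_
      (fun hd => h.not_isLeftDescent (IsLeftDescent.of_mul_simple hr hd))
    intro e; rw [e, length_one] at hx'l; omega
  have hcx' := not_isLeftDescent_of_mem hx' hc
  have vw := x'x.simple_mul_mono hcx' (not_isLeftDescent_of_mem h.mem hc)
  have hvl : cs.length (σ c * x') = cs.length x := by
    rw [cs.not_isLeftDescent_iff.1 hcx']; omega
  have hva := nda x' hx'
  -- A parabolic subgroup containing `cx'` contains `c` and `s`, so `cx'` is in no dihedral subgroup
  -- through `a`, and the values at its coatoms determine its image.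
  have fv : f (σ c * x') = σ a * (σ c * x') := by
    refine h.apply_eq_of_length_le hvl.le fun t ht => ?_
    have hct := mem_of_isLeftDescent ht (isLeftDescent_of_not hcx')
    have h1 := mem_of_isLeftDescent ((ble_simple_mul hcx').mem_parabolic ht) hx's
    rcases hct with rfl | rfl
    · simp at hc
    · rcases h1 with h1 | h1
      · exact h.ne h1
      · rw [h1] at hc; simp at hc
  have hav := isLeftDescent_of_not hva
  have hwa := nda x h.mem
  have avz := (hf.up_of_cov (Set.mem_univ _) vw (by rw [fv]; exact cov_simple_mul hva)
    (by rw [fv]; intro e; exact hwa (e ▸ hav))).2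
  rw [fv] at avz
  have havl : cs.length (σ a * (σ c * x')) = cs.length x + 1 := by
    rw [cs.not_isLeftDescent_iff.1 hva, hvl]
  have hz : f (σ c * x) ≠ 1 := by intro e; have := wz.2; rw [e] at this; simp at this
  obtain ⟨d, hd⟩ := cs.exists_leftDescent_of_ne_one hz
  rcases uz.eq_simple_mul_or hd with h2 | h2
  · -- `z = d u`
    rcases wz.eq_simple_mul_or hd with h3 | h3
    · exact hcw _ h.apply_mem (h2.trans h3.symm)
    · rcases avz.eq_simple_mul_or hd with h4 | h4
      · have h5 := h.apply_mem
        rw [h2, ← h4] at h5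
        have h6 := (mul_mem_cancel_left (simple_mem_pair_left a s)).1 h5
        exact hcm ((mul_mem_cancel_right hx').1 h6)
      · have hm : σ c * x ∈ cs.parabolic {c, a, s} :=
          mul_mem (simple_mem_parabolic (by simp))
            (parabolic_mono (Set.subset_insert _ _) h.mem)
        rcases mem_of_isLeftDescent hm h3 with rfl | rfl | rfl
        · have h5 := (avz.1.simple_mul_simple_mul h4).mem_parabolic (h2 ▸ h.apply_mem)
          have h6 : σ d * (σ a * σ d) ∈ cs.parabolic {a, s} := by
            rw [← mul_assoc, ← mul_assoc] at h5
            rw [← mul_assoc]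
            exact (mul_mem_cancel_right hx').1 h5
          refine nda _ h6 ?_
          rw [simple_mul_simple_cancel_left]
          refine isLeftDescent_of_not (not_isLeftDescent_simple (ne_of_not_commute hac))
        · exact hwa h3
        · exact h.false_of_descents havl hav h4
  · obtain rfl := h.eq_of_isLeftDescent_apply h2
    rcases avz.eq_simple_mul_or hd with h3 | h3
    · have hwd : cs.IsLeftDescent (σ c * x) d := by
        refine (wz.eq_simple_mul_or hd).resolve_left fun h4 => ?_
        exact hwa ((h3.trans h4.symm) ▸ hav)
      have hcomm := commute_of_isLeftDescent_simple_mul hc h.mem hsJ hwd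
      have h5 := (wz.simple_mul_simple_mul hwd hd).1
      rw [← h3, ← mul_assoc, hcomm, mul_assoc] at h5
      have hy : σ d * x ∈ cs.parabolic {a, d} := mul_mem (simple_mem_pair_right a d) h.mem
      have h6 := h5.of_simple_mul (nda _ hy)
      have h7 := cs.isLeftDescent_iff.1 h.isLeftDescent
      have h8 := h6.eq_of_length_le (by
        rw [hvl, cs.not_isLeftDescent_iff.1 (not_isLeftDescent_of_mem hy hc)]; omega)
      rw [← mul_left_cancel h8] at hx's
      exact not_isLeftDescent_simple_mul.2 h.isLeftDescent hx's
    · exact h.false_of_descents havl hav h3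

/-- Write `x = sy` and insert `c` after `s`: the image `z` of `scy` covers `scy`, `f x` and `ascy'`,
where `y' = yr`. Only `s` can be a left descent of `z`, so `sz = ascy'`. Hence `cy ≤ ascy'`; as `a`
and `c` commute, lifting gives `cay ≤ cy'`, so `ay = yr`. For `ay ≠ 1` this would give `y` the left
descent `s`. -/
theorem length_eq_two_of_commute (h : cs.IsFirstDefect f a s x) (hc : c ∉ ({a, s} : Set B))
    (hac : σ a * σ c = σ c * σ a) (hsc : σ s * σ c ≠ σ c * σ s) :
    cs.length x = 2 ∧ cs.Cov (σ s * (σ c * (σ s * x))) (f (σ s * (σ c * (σ s * x)))) ∧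
      ∃ r, cs.IsRightDescent (σ s * x) r ∧ f (σ s * (σ c * (σ s * x))) =
        σ s * (σ a * (σ s * (σ c * (σ s * x * σ r)))) := by
  have hf := h.matching
  have hcm := simple_not_mem (cs := cs) hc
  have haJ : a ∈ ({a, s} : Set B) := by simp
  have hsJ : s ∈ ({a, s} : Set B) := by simp
  have hs := simple_mem_pair_right (cs := cs) a s
  have ha := simple_mem_pair_left (cs := cs) a s
  have nds : ∀ g ∈ cs.parabolic {a, s}, ¬ cs.IsLeftDescent (σ c * g) s := fun g hg hd =>
    hsc (commute_of_isLeftDescent_simple_mul hc hg hsJ hd)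
  have hk := h.two_le_length
  have hxs := h.isLeftDescent
  have hx : x = σ s * (σ s * x) := by simp
  have hys : ¬ cs.IsLeftDescent (σ s * x) s := not_isLeftDescent_simple_mul.2 hxs
  have hym : σ s * x ∈ cs.parabolic {a, s} := mul_mem hs h.mem
  have hyl := cs.isLeftDescent_iff.1 hxs
  have hyx := simple_mul_cov hxs
  set y := σ s * x with hy
  clear_value y
  have hy1 : y ≠ 1 := by intro e; rw [e, length_one] at hyl; omega
  have hya : cs.IsLeftDescent y a := by
    rw [parabolic_pair_comm] at hym
    exact isLeftDescent_of_mem_pair hym hy1 hys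
  -- `w = s c y`
  have ycy := cov_simple_mul_of_mem hym hc
  have xw := ycy.simple_mul_mono hys (nds _ hym)
  rw [← hx] at xw
  have hcw : ∀ g ∈ cs.parabolic {a, s}, ∀ y ∈ cs.parabolic {a, s}, g ≠ σ s * (σ c * y) :=
    fun g hg y hy e =>
      hcm ((mul_mem_cancel_right hy).1 ((mul_mem_cancel_left hs).1 (e ▸ hg)))
  obtain ⟨wz, uz⟩ := hf.up_of_cov (Set.mem_univ _) xw h.cov (hcw _ h.apply_mem _ hym)
  -- `v = s c y'`
  obtain ⟨r, hr⟩ := cs.exists_rightDescent_of_ne_one hy1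
  have y'y := mul_simple_cov hr
  have hy'm := y'y.1.mem_parabolic hym
  set y' := y * σ r with hy'
  have hy'l := y'y.2
  have hcy' := not_isLeftDescent_of_mem hy'm hc
  have vw := (y'y.simple_mul_mono hcy' (not_isLeftDescent_of_mem hym hc)).simple_mul_mono
    (nds _ hy'm) (nds _ hym)
  have hvl : cs.length (σ s * (σ c * y')) = cs.length x := by
    rw [cs.not_isLeftDescent_iff.1 (nds _ hy'm), cs.not_isLeftDescent_iff.1 hcy']; omega
  have hvs := isLeftDescent_of_not (nds _ hy'm)
  have hva : ¬ cs.IsLeftDescent (σ s * (σ c * y')) a := fun hd =>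
    hcw _ h.mem _ hy'm ((ble_of_isLeftDescent_of_isLeftDescent hd hvs h.mem).eq_of_length_le
      hvl.le)
  have fv : f (σ s * (σ c * y')) = σ a * (σ s * (σ c * y')) := by
    refine h.apply_eq_of_length_le hvl.le fun t ht => ?_
    rcases mem_of_isLeftDescent ht hvs with e | rfl
    · exact h.ne e
    · exact hcw _ ht _ hy'm rfl
  have hav := isLeftDescent_of_not hva
  have hwl : cs.length (σ s * (σ c * y)) = cs.length x + 1 := xw.2
  have hws := isLeftDescent_of_not (nds _ hym)
  have hwa : ¬ cs.IsLeftDescent (σ s * (σ c * y)) a := fun hd => h.false_of_descents hwl hd hws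
  have avz := (hf.up_of_cov (Set.mem_univ _) vw (by rw [fv]; exact cov_simple_mul hva)
    (by rw [fv]; intro e; exact hwa (e ▸ hav))).2
  rw [fv] at avz
  have havl : cs.length (σ a * (σ s * (σ c * y'))) = cs.length x + 1 := by
    rw [cs.not_isLeftDescent_iff.1 hva, hvl]
  have hz : f (σ s * (σ c * y)) ≠ 1 := by intro e; have := wz.2; rw [e] at this; simp at this
  obtain ⟨d, hd⟩ := cs.exists_leftDescent_of_ne_one hz
  rcases uz.eq_simple_mul_or hd with h2 | h2
  · exfalso
    rcases wz.eq_simple_mul_or hd with h3 | h3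
    · exact hcw _ h.apply_mem _ hym (h2.trans h3.symm)
    · have hsub := parabolic_mono (cs := cs) (Set.subset_insert c {a, s})
      have hm : σ s * (σ c * y) ∈ cs.parabolic {c, a, s} :=
        mul_mem (hsub hs) (mul_mem (simple_mem_parabolic (by simp)) (hsub hym))
      rcases mem_of_isLeftDescent hm h3 with rfl | rfl | rfl
      · rcases xw.eq_simple_mul_or h3 with h4 | h4
        · replace h4 := hx.symm.trans h4
          rw [← mul_assoc, ← mul_assoc] at h4
          have h5 := mul_right_cancel h4
          apply hsc
          conv_lhs => rw [h5]
          simp [mul_assoc]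
        · exact not_isLeftDescent_of_mem h.mem hc h4
      · exact hwa h3
      · rcases avz.eq_simple_mul_or hd with h4 | h4
        · refine hcw _ (mul_mem ha h.apply_mem) _ hy'm ?_
          rw [h2, ← h4, simple_mul_simple_cancel_left]
        · exact h.false_of_descents havl hav h4
  · obtain rfl := h.eq_of_isLeftDescent_apply h2
    have h3 := (avz.eq_simple_mul_or hd).resolve_right
      fun h3 => h.false_of_descents havl hav h3
    refine ⟨?_, wz, r, hr, by rw [h3, simple_mul_simple_cancel_left]⟩
    have h5 := (wz.simple_mul_simple_mul hws hd).1
    rw [← h3, simple_mul_simple_cancel_left] at h5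
    have hy2m := mul_mem ha hym
    have hcy : σ c * y = σ a * (σ c * (σ a * y)) := by
      rw [← mul_assoc, hac, mul_assoc, simple_mul_simple_cancel_left]
    have hyl2 := cs.isLeftDescent_iff.1 hya
    have hcya : cs.IsLeftDescent (σ c * y) a := by
      rw [IsLeftDescent, hcy, simple_mul_simple_cancel_left, ← hcy,
        cs.not_isLeftDescent_iff.1 (not_isLeftDescent_of_mem hy2m hc),
        cs.not_isLeftDescent_iff.1 (not_isLeftDescent_of_mem hym hc)]
      omega
    rw [hcy] at h5 hcya
    have h6 := h5.of_simple_mul_simple_mul (isLeftDescent_simple_mul.1 hcya)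
    have h7 := h6.of_simple_mul (nds _ hy2m)
    have h8 := mul_left_cancel (h7.eq_of_length_le (by
      rw [cs.not_isLeftDescent_iff.1 (not_isLeftDescent_of_mem hy2m hc),
        cs.not_isLeftDescent_iff.1 hcy']; omega))
    by_contra hne
    have hy2d := isLeftDescent_of_mem_pair hy2m
      (by intro e; rw [e, length_one] at hyl2; omega) (not_isLeftDescent_simple_mul.2 hya)
    rw [h8] at hy2d
    exact hys (IsLeftDescent.of_mul_simple hr hy2d)

end IsFirstDefect

end CoxeterSystem

/-! ### The remaining case: `c` commutes with `a` but not with `s`. -/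

namespace CoxeterSystem

variable {B : Type*} {M : CoxeterMatrix B} {W : Type*} [Group W] {cs : CoxeterSystem M W}

local notation "σ" => CoxeterSystem.simple cs

namespace IsFirstDefect

variable {f : W → W} {a s c : B} {x : W}

/-- Here `x = sa`, with `f (sa) = sas ≠ asa`. The values `csa ↦ csas`, `scs ↦ ascs`, `sca ↦ sasc`,
`scsa ↦ csasc` and `sacs ↦ sascs` are forced. Now `f (scasa)` must cover `scasa`, `csasc` and
`sascs`. For any left descent of it, either two of these elements coincide or `asa` lies below
`sasc` or `sacs`; all are impossible. -/
theorem false_of_commute (h : cs.IsFirstDefect f a s x) (hc : c ∉ ({a, s} : Set B))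
    (hac : σ a * σ c = σ c * σ a) (hsc : σ s * σ c ≠ σ c * σ s) : False := by
  have hf := h.matching
  have haJ : a ∈ ({a, s} : Set B) := by simp
  have hsJ : s ∈ ({a, s} : Set B) := by simp
  have ha := simple_mem_pair_left (cs := cs) a s
  have hs := simple_mem_pair_right (cs := cs) a s
  have hcm := simple_not_mem (cs := cs) hc
  have hsne := h.ne
  have hca : c ≠ a := by rintro rfl; simp at hc
  have hcs : c ≠ s := by rintro rfl; simp at hc
  have ha_sc : a ∉ ({s, c} : Set B) := by simp [hsne.symm, hca.symm]
  have ham := simple_not_mem (cs := cs) ha_sc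
  have hs_ac : s ∉ ({a, c} : Set B) := by simp [hsne, hcs.symm]
  have hs' := simple_mem_pair_left (cs := cs) s c
  have hc' := simple_mem_pair_right (cs := cs) s c
  have hscm := mul_mem hs' hc'
  have hcsm := mul_mem hc' hs'
  have nds : ∀ g ∈ cs.parabolic {a, s}, ¬ cs.IsLeftDescent (σ c * g) s := fun g hg hd =>
    hsc (commute_of_isLeftDescent_simple_mul hc hg hsJ hd)
  have triple : ∀ g ∈ cs.parabolic {a, s, c}, ∀ d, cs.IsLeftDescent g d → d = a ∨ d = s ∨ d = c :=
    fun g hg d hd => mem_of_isLeftDescent hg hd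
  have ha3 : σ a ∈ cs.parabolic {a, s, c} := simple_mem_parabolic (by simp)
  have hs3 : σ s ∈ cs.parabolic {a, s, c} := simple_mem_parabolic (by simp)
  have hc3 : σ c ∈ cs.parabolic {a, s, c} := simple_mem_parabolic (by simp)
  -- the element `x` and its image
  obtain ⟨hx2, wz, r, hr, hfw⟩ := h.length_eq_two_of_commute hc hac hsc
  have hyl := cs.isLeftDescent_iff.1 h.isLeftDescent
  have hya : σ s * x = σ a := by
    have hm := mul_mem hs h.mem
    obtain ⟨i, hi⟩ := cs.length_eq_one_iff.1 (show cs.length (σ s * x) = 1 by omega)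
    rw [hi] at hm ⊢
    rcases simple_mem_parabolic_iff.1 hm with rfl | rfl
    · rfl
    · exfalso
      apply not_isLeftDescent_simple_mul.2 h.isLeftDescent
      rw [hi, IsLeftDescent]; simp
  have hxe : x = σ s * σ a := by rw [← hya]; simp
  have hra : r = a := by
    rw [hya] at hr
    exact mem_of_isRightDescent (J := {a}) (simple_mem_parabolic rfl) hr
  rw [hya] at wz
  rw [hya, hra, simple_mul_simple_self, mul_one] at hfw
  rw [hfw] at wz
  have hcov := h.cov
  have hne := h.apply_ne
  have hfm := h.apply_mem
  have hnd := h.not_isLeftDescent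
  have has : σ a * σ s ≠ σ s * σ a := by
    intro e
    apply hnd
    rw [hxe, ← e]
    exact isLeftDescent_of_not (not_isLeftDescent_simple hsne.symm)
  have N_as : ¬ cs.IsLeftDescent (σ a * σ s) s := fun hd => hsne (isLeftDescent_mul_eq has hd)
  have N_sa : ¬ cs.IsLeftDescent (σ s * σ a) a := hxe ▸ hnd
  have l_as := (simple_cov_left (cs := cs) hsne.symm).2
  have l_sa := (simple_cov_left (cs := cs) hsne).2
  have l_cs := (simple_cov_left (cs := cs) hcs).2
  have l_sc := (simple_cov_left (cs := cs) hcs.symm).2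
  have c_sas := cov_simple_mul N_as
  have c_asa := cov_simple_mul N_sa
  have l_sas := c_sas.2
  have l_asa := c_asa.2
  rw [length_simple] at l_as l_sa l_cs l_sc
  have m_as := mul_mem ha hs
  have m_sa := mul_mem hs ha
  have m_sas := mul_mem hs m_as
  have m_asa := mul_mem ha m_sa
  have f_sa : f (σ s * σ a) = σ s * (σ a * σ s) := by
    have hl := hcov.2
    have hne1 : f x ≠ 1 := by intro e; rw [e] at hl; simp at hl
    have hd : cs.IsLeftDescent (f x) s := by
      obtain ⟨d, hd⟩ := cs.exists_leftDescent_of_ne_one hne1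
      exact h.eq_of_isLeftDescent_apply hd ▸ hd
    rw [hxe] at hd hfm hl
    rw [parabolic_pair_comm] at hfm m_sas
    exact eq_of_isLeftDescent hfm m_sas (by omega) hd (isLeftDescent_of_not N_as)
  have N_sas : ∀ d, cs.IsLeftDescent (σ s * (σ a * σ s)) d → d = s := by
    intro d hd
    rw [← f_sa, ← hxe] at hd
    exact h.eq_of_isLeftDescent_apply hd
  have hasa_ne : σ a * (σ s * σ a) ≠ σ s * (σ a * σ s) := by
    rw [← f_sa, ← hxe]; exact hne.symm
  have N_asa : ∀ d, cs.IsLeftDescent (σ a * (σ s * σ a)) d → d = a := by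
    intro d hd
    rcases mem_of_isLeftDescent m_asa hd with rfl | rfl
    · rfl
    · rw [parabolic_pair_comm] at m_asa m_sas
      exact absurd (eq_of_isLeftDescent m_asa m_sas (by omega) hd (isLeftDescent_of_not N_as))
        hasa_ne
  have N_asa_s : ¬ cs.IsLeftDescent (σ a * (σ s * σ a)) s := fun hd => hsne (N_asa _ hd)
  have N_asa_c : ¬ cs.IsLeftDescent (σ a * (σ s * σ a)) c := fun hd => hca (N_asa _ hd)
  have N_cs : ∀ d, cs.IsLeftDescent (σ c * σ s) d → d = c :=
    fun d hd => isLeftDescent_mul_eq hsc.symm hd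
  have N_cs_s : ¬ cs.IsLeftDescent (σ c * σ s) s := fun hd => hcs (N_cs _ hd).symm
  have N_cs_a : ¬ cs.IsLeftDescent (σ c * σ s) a := not_isLeftDescent_of_mem hcsm ha_sc
  have acs_eq : σ a * (σ c * σ s) = σ c * (σ a * σ s) := by
    rw [← mul_assoc, hac, mul_assoc]
  have casa_eq : σ c * (σ a * (σ s * σ a)) = σ a * (σ c * (σ s * σ a)) := by
    rw [← mul_assoc, ← hac, mul_assoc]
  have N_acs_s : ¬ cs.IsLeftDescent (σ a * (σ c * σ s)) s := acs_eq ▸ nds _ m_as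
  have not_ac : ∀ g ∈ cs.parabolic {a, s}, ∀ t, σ s * (σ c * g) ∉ cs.parabolic {a, t} := by
    intro g hg t ht
    rcases mem_of_isLeftDescent ht (isLeftDescent_of_not (nds g hg)) with e | rfl
    · exact hsne e
    · exact hcm ((mul_mem_cancel_right hg).1 ((mul_mem_cancel_left hs).1 ht))
  have f_cs : f (σ c * σ s) = σ a * (σ c * σ s) := by
    refine h.apply_eq_of_length_le (by omega) fun t ht => ?_
    have h1 := mem_of_isLeftDescent ht
      (isLeftDescent_of_not (not_isLeftDescent_simple (cs := cs) hcs))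
    rcases h1 with e | rfl
    · exact hca e
    · exact simple_not_mem hs_ac
        ((mul_mem_cancel_left (simple_mem_pair_right a c)).1 ht)
  have f_sc : f (σ s * σ c) = σ a * (σ s * σ c) := by
    refine h.apply_eq_of_length_le (by omega) fun t ht => ?_
    exact not_ac 1 (one_mem _) t (by simpa using ht)
  -- the value at `csa`
  have k_sa_csa := cov_simple_mul_of_mem m_sa hc
  have N_csa_s := nds _ m_sa
  have l_casa := (cov_simple_mul_of_mem m_asa hc).2
  have l_csa := k_sa_csa.2
  have N_csa_a : ¬ cs.IsLeftDescent (σ c * (σ s * σ a)) a := by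
    intro hd
    have := cs.isLeftDescent_iff.1 hd
    rw [← casa_eq] at this
    omega
  have k_cs_csa : cs.Cov (σ c * σ s) (σ c * (σ s * σ a)) :=
    (simple_cov_right hsne).simple_mul_mono (not_isLeftDescent_simple hcs)
      (not_isLeftDescent_of_mem m_sa hc)
  have k_cs_acs := cov_simple_mul N_cs_a
  have acs_ne_csa : σ a * (σ c * σ s) ≠ σ c * (σ s * σ a) := fun e =>
    N_csa_a (e ▸ isLeftDescent_of_not N_cs_a)
  obtain ⟨f_csa, k_csa⟩ : f (σ c * (σ s * σ a)) = σ c * (σ s * (σ a * σ s)) ∧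
      cs.Cov (σ c * (σ s * σ a)) (σ c * (σ s * (σ a * σ s))) := by
    obtain ⟨z1, z2⟩ := hf.up_of_cov (Set.mem_univ _) k_sa_csa (hxe ▸ hcov) (by
      rw [f_sa]; intro e
      exact hcm ((mul_mem_cancel_right m_sa).1 (e ▸ m_sas)))
    have z3 := (hf.up_of_cov (Set.mem_univ _) k_cs_csa (f_cs ▸ k_cs_acs)
      (f_cs ▸ acs_ne_csa)).2
    rw [f_sa] at z2
    rw [f_cs] at z3
    have hz : f (σ c * (σ s * σ a)) ≠ 1 := by intro e; have := z1.2; rw [e] at this; simp at this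
    obtain ⟨d, hd⟩ := cs.exists_leftDescent_of_ne_one hz
    have key : f (σ c * (σ s * σ a)) = σ c * (σ s * (σ a * σ s)) := by
      rcases z1.eq_simple_mul_or hd with e | hd1
      · rcases z2.eq_simple_mul_or hd with e2 | hd2
        · exact absurd (e2.trans e.symm) fun e =>
            hcm ((mul_mem_cancel_right m_sa).1 (e ▸ m_sas))
        · obtain rfl := N_sas _ hd2
          rcases z3.eq_simple_mul_or hd with e3 | hd3
          · exact absurd (e3.trans e.symm) acs_ne_csa
          · exact absurd hd3 N_acs_s
      · rcases triple _ (mul_mem hc3 (mul_mem hs3 ha3)) d hd1 with rfl | rfl | rfl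
        · exact absurd hd1 N_csa_a
        · exact absurd hd1 N_csa_s
        · rcases z2.eq_simple_mul_or hd with e2 | hd2
          · rw [e2]; simp
          · exact absurd (N_sas _ hd2) hcs
    exact ⟨key, key ▸ z1⟩
  -- the value at `scs`
  have k_cs_scs := cov_simple_mul N_cs_s
  have l_scs := k_cs_scs.2
  have m_scs := mul_mem hs' hcsm
  have N_scs_a : ¬ cs.IsLeftDescent (σ s * (σ c * σ s)) a := not_isLeftDescent_of_mem m_scs ha_sc
  have k_scs := cov_simple_mul N_scs_a
  have f_scs : f (σ s * (σ c * σ s)) = σ a * (σ s * (σ c * σ s)) := by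
    refine hf.eq_of_forall_cov (IsMatchingOn.left_mul a) h.map_one (Set.mem_univ _)
      (not_ac _ hs) fun v hv => ?_
    rcases hv.eq_simple_mul_or (isLeftDescent_of_not N_cs_s) with e | hd
    · rw [simple_mul_simple_cancel_left] at e
      rw [e, f_cs]
    · have hl := hv.2
      have e := eq_of_isLeftDescent (hv.1.mem_parabolic m_scs) hscm (by omega) hd
        (isLeftDescent_of_not (not_isLeftDescent_simple hcs.symm))
      rw [e, f_sc]
  have sas_not : ¬ cs.BLE (σ s * (σ a * σ s)) (σ a * (σ s * (σ c * σ s))) := by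
    intro hb
    have h1 := (hb.of_simple_mul fun hd => hsne.symm (N_sas _ hd)).mem_parabolic m_scs
    exact ham ((mul_mem_cancel_right hs').1 ((mul_mem_cancel_left hs').1 h1))
  have N_ascs_s : ¬ cs.IsLeftDescent (σ a * (σ s * (σ c * σ s))) s := fun hd =>
    sas_not (ble_of_isLeftDescent_of_isLeftDescent (isLeftDescent_of_not N_scs_a) hd m_sas)
  -- the value at `sca`
  have l_asc := (cov_simple_mul (not_isLeftDescent_of_mem hscm ha_sc)).2
  have asa_not_asc : ¬ cs.BLE (σ a * (σ s * σ a)) (σ a * (σ s * σ c)) := by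
    intro hb
    have e := hb.eq_of_length_le (by omega)
    exact hca (cs.simple_inj (mul_left_cancel (mul_left_cancel e))).symm
  have asa_not_sasc : ¬ cs.BLE (σ a * (σ s * σ a)) (σ s * (σ a * (σ s * σ c))) := fun hb =>
    asa_not_asc (hb.of_simple_mul N_asa_s)
  have N_asc_s : ¬ cs.IsLeftDescent (σ a * (σ s * σ c)) s := by
    intro hd
    have hb := ble_of_isLeftDescent_of_isLeftDescent
      (isLeftDescent_of_not (not_isLeftDescent_of_mem hscm ha_sc)) hd m_asa
    exact asa_not_asc hb
  have D_sasc : ∀ d, cs.IsLeftDescent (σ s * (σ a * (σ s * σ c))) d → d = s := by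
    intro d hd
    have hds := isLeftDescent_of_not N_asc_s
    rcases triple _ (mul_mem hs3 (mul_mem ha3 (mul_mem hs3 hc3))) d hd with rfl | rfl | rfl
    · exact absurd (ble_of_isLeftDescent_of_isLeftDescent hd hds m_asa) asa_not_sasc
    · rfl
    · exfalso
      have hb := ble_of_isLeftDescent_of_isLeftDescent hds hd m_scs
      have hb2 := (hb.of_simple_mul_simple_mul N_cs_s).of_simple_mul N_cs_a
      exact hsc (hb2.eq_of_length_le (by omega)).symm
  -- the value at `scsa`
  have k_csa_scsa := cov_simple_mul N_csa_s
  have k_scs_scsa : cs.Cov (σ s * (σ c * σ s)) (σ s * (σ c * (σ s * σ a))) :=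
    k_cs_csa.simple_mul_mono N_cs_s N_csa_s
  have k_ca_csa : cs.Cov (σ c * σ a) (σ c * (σ s * σ a)) :=
    (simple_cov_left hsne).simple_mul_mono (not_isLeftDescent_simple hca)
      (not_isLeftDescent_of_mem m_sa hc)
  have k_sca_scsa : cs.Cov (σ s * (σ c * σ a)) (σ s * (σ c * (σ s * σ a))) :=
    k_ca_csa.simple_mul_mono (nds _ ha) N_csa_s
  have N_scsa_a : ¬ cs.IsLeftDescent (σ s * (σ c * (σ s * σ a))) a := by
    intro hd
    have hb := ble_of_isLeftDescent_of_isLeftDescent hd (isLeftDescent_of_not N_csa_s) m_asa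
    have e := ((hb.of_simple_mul N_asa_s).of_simple_mul N_asa_c).length_le
    omega
  have csas_ne_ascs : σ c * (σ s * (σ a * σ s)) ≠ σ a * (σ s * (σ c * σ s)) := fun e =>
    sas_not (e ▸ (cov_simple_mul_of_mem m_sas hc).1)
  have sasc_ne_scsa : σ s * (σ a * (σ s * σ c)) ≠ σ s * (σ c * (σ s * σ a)) := fun e =>
    N_csa_a (mul_left_cancel e ▸ isLeftDescent_of_not (not_isLeftDescent_of_mem hscm ha_sc))
  have csas_ne_scsa : σ c * (σ s * (σ a * σ s)) ≠ σ s * (σ c * (σ s * σ a)) := fun e =>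
    nds _ m_sas (e ▸ isLeftDescent_of_not N_csa_s)
  have ascs_ne_scsa : σ a * (σ s * (σ c * σ s)) ≠ σ s * (σ c * (σ s * σ a)) := fun e =>
    N_ascs_s (e ▸ isLeftDescent_of_not N_csa_s)
  obtain ⟨f_scsa, k_scsa, D_p⟩ : f (σ s * (σ c * (σ s * σ a))) =
        σ c * (σ s * (σ a * (σ s * σ c))) ∧
      cs.Cov (σ s * (σ c * (σ s * σ a))) (f (σ s * (σ c * (σ s * σ a)))) ∧
      ∀ d, cs.IsLeftDescent (f (σ s * (σ c * (σ s * σ a)))) d → d = c := by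
    obtain ⟨z1, z2⟩ := hf.up_of_cov (Set.mem_univ _) k_csa_scsa (f_csa ▸ k_csa)
      (f_csa ▸ csas_ne_scsa)
    have z3 := (hf.up_of_cov (Set.mem_univ _) k_scs_scsa (f_scs ▸ k_scs)
      (f_scs ▸ ascs_ne_scsa)).2
    have z4 := (hf.up_of_cov (Set.mem_univ _) k_sca_scsa (hfw ▸ wz)
      (hfw ▸ sasc_ne_scsa)).2
    rw [f_csa] at z2
    rw [f_scs] at z3
    rw [hfw] at z4
    have hz : f (σ s * (σ c * (σ s * σ a))) ≠ 1 := by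
      intro e; have := z1.2; rw [e] at this; simp at this
    have D : ∀ d, cs.IsLeftDescent (f (σ s * (σ c * (σ s * σ a)))) d → d = c := by
      intro d hd
      rcases z4.eq_simple_mul_or hd with e4 | hd4
      · rcases z1.eq_simple_mul_or hd with e1 | hd1
        · exact absurd (e4.trans e1.symm) sasc_ne_scsa
        · rcases triple _ (mul_mem hs3 (mul_mem hc3 (mul_mem hs3 ha3))) d hd1 with rfl | rfl | rfl
          · exact absurd hd1 N_scsa_a
          · rcases z2.eq_simple_mul_or hd with e2 | hd2
            · rcases z3.eq_simple_mul_or hd with e3 | hd3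
              · exact absurd (e2.trans e3.symm) csas_ne_ascs
              · exact absurd hd3 N_ascs_s
            · exact absurd hd2 (nds _ m_sas)
          · rfl
      · obtain rfl := D_sasc _ hd4
        exfalso
        rcases z2.eq_simple_mul_or hd with e2 | hd2
        · rcases z3.eq_simple_mul_or hd with e3 | hd3
          · exact csas_ne_ascs (e2.trans e3.symm)
          · exact N_ascs_s hd3
        · exact nds _ m_sas hd2
    obtain ⟨d, hd⟩ := cs.exists_leftDescent_of_ne_one hz
    obtain rfl := D d hd
    refine ⟨?_, z1, D⟩
    rcases z4.eq_simple_mul_or hd with e4 | hd4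
    · rw [e4]; simp
    · exact absurd (D_sasc _ hd4) hcs
  -- the value at `sacs`
  have N_ca_s := nds _ ha
  have k_sca_sacs : cs.Cov (σ s * (σ c * σ a)) (σ s * (σ a * (σ c * σ s))) := by
    rw [← hac] at N_ca_s ⊢
    exact ((simple_cov_right hcs).simple_mul_mono (not_isLeftDescent_simple hca.symm)
      N_cs_a).simple_mul_mono N_ca_s N_acs_s
  have k_scs_sacs : cs.Cov (σ s * (σ c * σ s)) (σ s * (σ a * (σ c * σ s))) :=
    k_cs_acs.simple_mul_mono N_cs_s N_acs_s
  have k_sas_sacs : cs.Cov (σ s * (σ a * σ s)) (σ s * (σ a * (σ c * σ s))) := by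
    have := cov_simple_mul_of_mem m_as hc
    rw [← acs_eq] at this
    exact this.simple_mul_mono N_as N_acs_s
  have l_acs := k_cs_acs.2
  have asa_not_acs : ¬ cs.BLE (σ a * (σ s * σ a)) (σ a * (σ c * σ s)) := fun hb => by
    have e := hb.eq_of_length_le (by omega)
    have h1 := (mul_mem_cancel_left ha).1 (e ▸ m_asa)
    exact hcm ((mul_mem_cancel_right hs).1 h1)
  have asa_not_sacs : ¬ cs.BLE (σ a * (σ s * σ a)) (σ s * (σ a * (σ c * σ s))) := fun hb =>
    asa_not_acs (hb.of_simple_mul N_asa_s)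
  have d_sacs := isLeftDescent_of_not N_acs_s
  have D_sacs : ∀ d, cs.IsLeftDescent (σ s * (σ a * (σ c * σ s))) d → d = s := by
    intro d hd
    rcases triple _ (mul_mem hs3 (mul_mem ha3 (mul_mem hc3 hs3))) d hd with rfl | rfl | rfl
    · exact absurd (ble_of_isLeftDescent_of_isLeftDescent hd d_sacs m_asa) asa_not_sacs
    · rfl
    · rcases k_sas_sacs.eq_simple_mul_or hd with e | hd1
      · rw [acs_eq] at e
        have e' : (σ s) * (σ a * σ s) = (σ d * σ s * σ d) * (σ a * σ s) := by
          rw [e]; simp only [mul_assoc]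
        have e2 := mul_right_cancel e'
        refine absurd ?_ hsc
        conv_lhs => rw [e2]
        simp [mul_assoc]
      · exact absurd (N_sas _ hd1) hcs
  obtain ⟨f_sacs, k_sacs, D_q⟩ : f (σ s * (σ a * (σ c * σ s))) =
        σ s * (σ a * (σ s * (σ c * σ s))) ∧
      cs.Cov (σ s * (σ a * (σ c * σ s))) (f (σ s * (σ a * (σ c * σ s)))) ∧
      ∀ d, cs.IsLeftDescent (f (σ s * (σ a * (σ c * σ s)))) d → d = s := by
    have sasc_ne_sacs : σ s * (σ a * (σ s * σ c)) ≠ σ s * (σ a * (σ c * σ s)) := fun e =>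
      hsc (mul_left_cancel (mul_left_cancel e))
    obtain ⟨z1, z2⟩ := hf.up_of_cov (Set.mem_univ _) k_sca_sacs (hfw ▸ wz)
      (hfw ▸ sasc_ne_sacs)
    have z3 := (hf.up_of_cov (Set.mem_univ _) k_scs_sacs (f_scs ▸ k_scs)
      (f_scs ▸ fun e => N_ascs_s (e ▸ d_sacs))).2
    rw [hfw] at z2
    rw [f_scs] at z3
    have hz : f (σ s * (σ a * (σ c * σ s))) ≠ 1 := by
      intro e; have := z1.2; rw [e] at this; simp at this
    have D : ∀ d, cs.IsLeftDescent (f (σ s * (σ a * (σ c * σ s)))) d → d = s := by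
      intro d hd
      rcases z1.eq_simple_mul_or hd with e1 | hd1
      · rcases z2.eq_simple_mul_or hd with e2 | hd2
        · exact absurd (e2.trans e1.symm) sasc_ne_sacs
        · exact D_sasc _ hd2
      · exact D_sacs _ hd1
    obtain ⟨d, hd⟩ := cs.exists_leftDescent_of_ne_one hz
    obtain rfl := D d hd
    refine ⟨?_, z1, D⟩
    rcases z3.eq_simple_mul_or hd with e3 | hd3
    · rw [e3]; simp
    · exact absurd hd3 N_ascs_s
  -- the value at `scasa`
  have N_casa_s := nds _ m_asa
  have k_csa_casa := cov_simple_mul N_csa_a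
  rw [← casa_eq] at k_csa_casa
  have k_scsa_w := k_csa_casa.simple_mul_mono N_csa_s N_casa_s
  have k_sacs_w : cs.Cov (σ s * (σ a * (σ c * σ s))) (σ s * (σ c * (σ a * (σ s * σ a)))) := by
    refine Cov.simple_mul_mono ?_ N_acs_s N_casa_s
    rw [casa_eq]
    exact k_cs_csa.simple_mul_mono N_cs_a N_csa_a
  have d_w := isLeftDescent_of_not N_casa_s
  obtain ⟨z1, z2⟩ := hf.up_of_cov (Set.mem_univ _) k_scsa_w k_scsa
    fun e => hcs (D_p _ (e ▸ d_w)).symm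
  have hqw : f (σ s * (σ a * (σ c * σ s))) ≠ σ s * (σ c * (σ a * (σ s * σ a))) := by
    rw [f_sacs, casa_eq]
    intro e
    have h1 : σ c * (σ s * σ a) ∈ cs.parabolic {s, c} :=
      mul_left_cancel (mul_left_cancel e) ▸ m_scs
    exact ham ((mul_mem_cancel_left hs').1 ((mul_mem_cancel_left hc').1 h1))
  have z3 := (hf.up_of_cov (Set.mem_univ _) k_sacs_w k_sacs hqw).2
  have hz : f (σ s * (σ c * (σ a * (σ s * σ a)))) ≠ 1 := by
    intro e; have := z1.2; rw [e] at this; simp at this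
  obtain ⟨d, hd⟩ := cs.exists_leftDescent_of_ne_one hz
  rcases z2.eq_simple_mul_or hd with e2 | hd2
  · rcases z3.eq_simple_mul_or hd with e3 | hd3
    · have e := congrArg f (e2.trans e3.symm)
      rw [hf.invol (Set.mem_univ _), hf.invol (Set.mem_univ _)] at e
      exact acs_ne_csa (mul_left_cancel e).symm
    · obtain rfl := D_q _ hd3
      have h1 := z1.simple_mul_simple_mul d_w hd
      rw [← e2, f_scsa, simple_mul_simple_cancel_left] at h1
      exact asa_not_sasc (h1.1.of_simple_mul_simple_mul N_asa_c)
  · obtain rfl := D_p _ hd2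
    have e3 := (z3.eq_simple_mul_or hd).resolve_right fun hd3 => hcs (D_q _ hd3)
    rcases z1.eq_simple_mul_or hd with e1 | hd1
    · exact hqw (e3.trans e1.symm)
    · have hb : cs.BLE (σ a * (σ s * σ a)) (σ s * (σ d * (σ a * (σ s * σ a)))) :=
        (ble_simple_mul N_asa_c).trans (ble_simple_mul N_casa_s)
      have hb2 := hb.simple_mul_right N_asa_c
      rw [← (k_sacs_w.eq_simple_mul_or hd1).resolve_right fun hd => hcs (D_sacs _ hd)] at hb2
      exact asa_not_sacs hb2

end IsFirstDefect

/-! ### Matchings defined everywhere, outside the degenerate case. -/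

variable {f : W → W} {a : B}

namespace IsMatchingOn

theorem eq_left_mul (hf : cs.IsMatchingOn Set.univ f) (h1 : f 1 = σ a)
    (hfs : ∀ s, f (σ s) = σ a * σ s)
    (hdeg : ¬ ∃ b, b ≠ a ∧ ∀ c, c ≠ a → c ≠ b → M a c = 2 ∧ M b c = 2) (w : W) :
    f w = σ a * w := by
  induction hn : cs.length w using Nat.strong_induction_on generalizing w with
  | _ n ih =>
  have ih' : ∀ v, cs.length v < cs.length w → f v = σ a * v := fun v hv => ih _ (hn ▸ hv) v rfl
  by_cases hdih : ∃ t, w ∈ cs.parabolic {a, t}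
  · obtain ⟨t, ht⟩ := hdih
    by_contra hne
    have hta : t ≠ a := by
      rintro rfl
      obtain ⟨d, hd⟩ := cs.exists_leftDescent_of_ne_one
        (show w ≠ 1 by rintro rfl; exact hne (by rw [h1, mul_one]))
      have hdt : d = t := by simpa using mem_of_isLeftDescent ht hd
      subst hdt
      have h2 := ih' (σ d * w) hd
      rw [simple_mul_simple_cancel_left] at h2
      exact hne (by rw [← h2, hf.invol (Set.mem_univ _), h2])
    have h : cs.IsFirstDefect f a t w := ⟨hf, h1, hfs t, hta, ht, hne, ih'⟩
    push Not at hdeg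
    obtain ⟨c, hca, hct, hM⟩ := hdeg t hta
    have hc : c ∉ ({a, t} : Set B) := by simp [hca, hct]
    by_cases hac : σ a * σ c = σ c * σ a
    · refine h.false_of_commute hc hac fun hsc => ?_
      exact hM (cs.eq_two_of_simple_commute hca.symm hac)
        (cs.eq_two_of_simple_commute hct.symm hsc)
    · exact h.false_of_not_commute hc hac
  · push Not at hdih
    exact hf.eq_of_forall_cov (left_mul a) h1 (Set.mem_univ _) hdih
      fun v hv => ih' v (by have := hv.2; omega)

theorem eq_left_mul_or_eq_right_mul (hf : cs.IsMatchingOn Set.univ f) (h1 : f 1 = σ a)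
    (hdeg : ¬ ∃ b, b ≠ a ∧ ∀ c, c ≠ a → c ≠ b → M a c = 2 ∧ M b c = 2) :
    (∀ w, f w = σ a * w) ∨ (∀ w, f w = w * σ a) := by
  by_cases hl : ∀ s, f (σ s) = σ a * σ s
  · exact Or.inl (hf.eq_left_mul h1 hl hdeg)
  · right
    push Not at hl
    obtain ⟨t, ht⟩ := hl
    have ht' := (hf.apply_simple h1 t).resolve_left ht
    -- Generators commuting with `a` satisfy both formulas; for the others, `false_of_mixed`
    -- compares with `t`.
    have hr : ∀ s, f (σ s) = σ s * σ a := by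
      intro s
      rcases hf.apply_simple h1 s with hs | hs
      · by_cases hc : σ a * σ s = σ s * σ a
        · rw [hs, hc]
        · exact (hf.false_of_mixed h1 hc (fun e => ht (ht'.trans e.symm)) hs ht').elim
      · exact hs
    intro w
    have := hf.inv_conj.eq_left_mul (a := a) (by simp [h1]) (fun s => by simp [hr]) hdeg w⁻¹
    simpa using congrArg (·⁻¹) this

end IsMatchingOn

end CoxeterSystem

/-! ### Translation between partial matchings and functions on `W`. -/

theorem covBy_coe_iff_of_isLowerSet {P : Type*} [PartialOrder P] {s : Set P} (hs : IsLowerSet s)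
    {u v : s} : u ⋖ v ↔ (u : P) ⋖ v := by
  constructor
  · intro h
    refine ⟨h.1, fun w hw hwv => ?_⟩
    exact h.2 (c := ⟨w, hs hwv.le v.2⟩) hw hwv
  · intro h
    exact ⟨h.1, fun w hw hwv => h.2 hw hwv⟩

namespace PartialMatching

variable {P : Type*} [PartialOrder P]

theorem Maps.mem_dom {φ : PartialMatching P} {x y : P} (h : φ.Maps x y) : x ∈ φ.dom := h.1

theorem Maps.unique {φ : PartialMatching P} {x y y' : P} (h : φ.Maps x y) (h' : φ.Maps x y') :
    y = y' := by
  obtain ⟨_, rfl⟩ := h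
  obtain ⟨_, rfl⟩ := h'
  rfl

theorem eq_of_maps_iff {φ ψ : PartialMatching P} (h : ∀ x y, φ.Maps x y ↔ ψ.Maps x y) :
    φ = ψ := by
  have hdom : φ.dom = ψ.dom := by
    ext x
    exact ⟨fun hx => ((h x _).1 ⟨hx, rfl⟩).1, fun hx => ((h x _).2 ⟨hx, rfl⟩).1⟩
  obtain ⟨Q, hQ, f, hf⟩ := φ
  obtain ⟨Q', hQ', f', hf'⟩ := ψ
  dsimp only at hdom
  subst hdom
  have : f = f' := by
    funext x
    obtain ⟨_, h2⟩ := (h x (f x)).1 ⟨x.2, rfl⟩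
    exact Subtype.ext h2.symm
  subst this
  rfl

theorem isMax_of_dom_eq_univ {φ : PartialMatching P} (h : φ.dom = Set.univ) : IsMax φ := by
  intro ψ hψ
  refine ⟨by rw [h]; exact Set.subset_univ _, fun x y hxy => ?_⟩
  have hx : x ∈ φ.dom := by rw [h]; trivial
  have h1 : φ.Maps x (φ.toFun ⟨x, hx⟩) := ⟨hx, rfl⟩
  rwa [hxy.unique (hψ.2 _ _ h1)]

end PartialMatching

namespace CoxeterSystem

variable {B : Type*} {M : CoxeterMatrix B} {W : Type*} [Group W] {cs : CoxeterSystem M W}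

/-- Gradedness (`BLE.exists_cov`) inserts an element just below `v`, so a cover must raise the
length by exactly one. -/
theorem covBy_iff {u v : cs.Bruhat} : u ⋖ v ↔ cs.Cov u v := by
  constructor
  · intro h
    have hne : u ≠ v := h.1.ne
    obtain ⟨w, hw, hwv⟩ := BLE.exists_cov (cs := cs) h.1.le hne
    by_cases huw : u = w
    · rwa [huw]
    · exact absurd (lt_of_le_of_ne (α := cs.Bruhat) hwv.1 hwv.ne)
        (h.2 (lt_of_le_of_ne (α := cs.Bruhat) hw huw))
  · intro h
    refine ⟨lt_of_le_of_ne (α := cs.Bruhat) h.1 h.ne, fun w huw hwv => ?_⟩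
    have h1 := (BLE.eq_or_length_lt (cs := cs) huw.le).resolve_left huw.ne
    have h2 := (BLE.eq_or_length_lt (cs := cs) hwv.le).resolve_left hwv.ne
    have h3 := h.2
    omega

open scoped Classical in
/-- The function on `W` underlying a partial matching, extended by the identity. -/
noncomputable def _root_.PartialMatching.toMap (φ : PartialMatching cs.Bruhat) (w : W) : W :=
  if h : w ∈ φ.dom then (φ.toFun ⟨w, h⟩).1 else w

theorem _root_.PartialMatching.toMap_of_mem (φ : PartialMatching cs.Bruhat) {w : W}
    (h : w ∈ φ.dom) : φ.toMap w = (φ.toFun ⟨w, h⟩).1 := dif_pos h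

theorem _root_.PartialMatching.maps_iff (φ : PartialMatching cs.Bruhat) {x y : W} :
    φ.Maps x y ↔ x ∈ φ.dom ∧ φ.toMap x = y := by
  constructor
  · rintro ⟨h, rfl⟩
    exact ⟨h, φ.toMap_of_mem h⟩
  · rintro ⟨h, rfl⟩
    exact ⟨h, (φ.toMap_of_mem h).symm⟩

theorem _root_.PartialMatching.isMatchingOn (φ : PartialMatching cs.Bruhat) :
    cs.IsMatchingOn φ.dom φ.toMap := by
  have cov : ∀ {u v : φ.dom}, u ⋖ v ↔ cs.Cov u.1 v.1 := fun {u v} =>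
    (covBy_coe_iff_of_isLowerSet φ.isLowerSet_dom).trans covBy_iff
  have hφ := φ.isDistinguished
  refine ⟨fun {u v} h hv => φ.isLowerSet_dom (a := v) h hv, fun {u} hu => ?_, fun {u} hu => ?_,
    fun {u} hu => ?_, fun {u} hu h x => ?_⟩
  · rw [φ.toMap_of_mem hu]; exact Subtype.prop _
  · rw [φ.toMap_of_mem hu]
    exact (φ.toMap_of_mem (Subtype.prop _)).trans (congrArg Subtype.val (hφ.involutive _))
  · rw [φ.toMap_of_mem hu]
    exact (hφ.covBy_or_covBy ⟨u, hu⟩).imp cov.1 cov.1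
  · rw [φ.toMap_of_mem hu] at h ⊢
    have hc := hφ.coatoms_eq ⟨u, hu⟩ (cov.2 h)
    constructor
    · intro hx
      have hxQ : x ∈ φ.dom := φ.isLowerSet_dom (a := (φ.toFun ⟨u, hu⟩).1) hx.1 (Subtype.prop _)
      have hmem : (⟨x, hxQ⟩ : φ.dom) ∈ {x | x ⋖ φ.toFun ⟨u, hu⟩} := cov.2 hx
      rw [hc] at hmem
      rcases hmem with h1 | ⟨v, ⟨h1, h2⟩, h3⟩
      · left; exact congrArg Subtype.val h1
      · right
        refine ⟨v.1, cov.1 h1, ?_, ?_⟩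
        · rw [φ.toMap_of_mem v.2]; exact cov.1 h2
        · rw [φ.toMap_of_mem v.2]; exact congrArg Subtype.val h3
    · rintro (rfl | ⟨v, h1, h2, rfl⟩)
      · exact h
      · have hv : v ∈ φ.dom := φ.isLowerSet_dom (a := u) h1.1 hu
        rw [φ.toMap_of_mem hv] at h2 ⊢
        have hmem : φ.toFun ⟨v, hv⟩ ∈ {x | x ⋖ φ.toFun ⟨u, hu⟩} := by
          rw [hc]
          exact Or.inr ⟨⟨v, hv⟩, ⟨cov.2 h1, cov.2 h2⟩, rfl⟩
        exact cov.1 hmem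

/-- The partial matching of the Bruhat order given by a function on `W`. -/
def IsMatchingOn.toPartialMatching {Q : Set W} {f : W → W} (hf : cs.IsMatchingOn Q f) :
    PartialMatching cs.Bruhat where
  dom := Q
  isLowerSet_dom _ _ h hv := hf.lower h hv
  toFun x := ⟨f x.1, hf.maps x.2⟩
  isDistinguished := by
    have hQ : IsLowerSet (α := cs.Bruhat) Q := fun _ _ h hv => hf.lower h hv
    have cov : ∀ {u v : (show Set cs.Bruhat from Q)}, u ⋖ v ↔ cs.Cov u.1 v.1 := fun {u v} =>
      (covBy_coe_iff_of_isLowerSet hQ).trans covBy_iff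
    refine ⟨fun x => Subtype.ext (hf.invol x.2),
      fun u => (hf.cov u.2).imp cov.2 cov.2, fun u hu => ?_⟩
    ext x
    refine cov.trans ((hf.coat u.2 (cov.1 hu) x.1).trans (or_congr ?_ ⟨?_, ?_⟩))
    · exact Subtype.ext_iff.symm
    · rintro ⟨v, h1, h2, h3⟩
      have hv := hf.lower h1.1 u.2
      exact ⟨⟨v, hv⟩, ⟨cov.2 h1, cov.2 h2⟩, Subtype.ext h3⟩
    · rintro ⟨v, ⟨h1, h2⟩, h3⟩
      exact ⟨v.1, cov.1 h1, cov.1 h2, congrArg Subtype.val h3⟩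

theorem IsMatchingOn.toPartialMatching_maps {Q : Set W} {f : W → W} (hf : cs.IsMatchingOn Q f)
    {x y : W} : hf.toPartialMatching.Maps x y ↔ x ∈ Q ∧ f x = y :=
  ⟨fun ⟨h, h'⟩ => ⟨h, h'⟩, fun ⟨h, h'⟩ => ⟨h, h'⟩⟩

theorem IsMatchingOn.toPartialMatching_mem_maximalMatchings {a : B} {f : W → W}
    (hf : cs.IsMatchingOn Set.univ f) (h1 : f 1 = cs.simple a) :
    hf.toPartialMatching ∈ cs.maximalMatchings a :=
  ⟨PartialMatching.isMax_of_dom_eq_univ rfl, hf.toPartialMatching_maps.2 ⟨trivial, h1⟩⟩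

theorem exists_left_right_maximalMatchings (cs : CoxeterSystem M W) (a : B) :
    ∃ L ∈ cs.maximalMatchings a, ∃ R ∈ cs.maximalMatchings a,
      (∀ w : W, L.Maps w (cs.simple a * w)) ∧
      (∀ w : W, R.Maps w (w * cs.simple a)) ∧
      ((¬ ∃ b, b ≠ a ∧ ∀ c, c ≠ a → c ≠ b → M a c = 2 ∧ M b c = 2) →
        {φ ∈ cs.maximalMatchings a | φ.dom = Set.univ} = {L, R}) := by
  have hL := IsMatchingOn.left_mul (cs := cs) a
  have hR := IsMatchingOn.right_mul (cs := cs) a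
  have mL := hL.toPartialMatching_mem_maximalMatchings (a := a) (mul_one _)
  have mR := hR.toPartialMatching_mem_maximalMatchings (a := a) (one_mul _)
  refine ⟨_, mL, _, mR, fun w => hL.toPartialMatching_maps.2 ⟨trivial, rfl⟩,
    fun w => hR.toPartialMatching_maps.2 ⟨trivial, rfl⟩, fun hdeg => ?_⟩
  ext φ
  simp only [Set.mem_ofPred_eq, Set.mem_insert_iff, Set.mem_singleton_iff]
  constructor
  · rintro ⟨⟨-, hφ⟩, hdom⟩
    have hf := φ.isMatchingOn
    have h1 := (φ.maps_iff.1 hφ).2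
    have key : ∀ {g : W → W} (hg : cs.IsMatchingOn Set.univ g), (∀ w, φ.toMap w = g w) →
        φ = hg.toPartialMatching := by
      intro g hg h
      refine PartialMatching.eq_of_maps_iff fun x y => ?_
      refine (φ.maps_iff (x := x) (y := y)).trans
        (Iff.trans ?_ (hg.toPartialMatching_maps (x := x) (y := y)).symm)
      rw [hdom]
      exact ⟨fun hx => ⟨trivial, (h x).symm.trans hx.2⟩, fun hx => ⟨trivial, (h x).trans hx.2⟩⟩
    have hf' : cs.IsMatchingOn Set.univ φ.toMap := by
      have := hf
      rwa [hdom] at this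
    exact (hf'.eq_left_mul_or_eq_right_mul h1 hdeg).imp (key hL) (key hR)
  · rintro (rfl | rfl)
    · exact ⟨mL, rfl⟩
    · exact ⟨mR, rfl⟩

end CoxeterSystem

namespace CoxeterSystem

variable {B : Type*} {M : CoxeterMatrix B} {W : Type*} [Group W] {cs : CoxeterSystem M W}

/-! ### Bruhat order and extension of matchings in dihedral groups. -/

section DihedralOrder

variable {a b : B}

/-- Strip a left descent `j` of `v`, from `u` as well if it has it. If `u` lacks `j`, then `u` is
shorter than `jv` or equal to it, as two elements of equal length without `j` coincide. -/
theorem ble_of_length_lt {u v : W} (hu : u ∈ cs.parabolic {a, b}) (hv : v ∈ cs.parabolic {a, b})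
    (h : cs.length u < cs.length v) : cs.BLE u v := by
  induction hn : cs.length v using Nat.strong_induction_on generalizing u v with
  | _ n ih =>
  have hv1 : v ≠ 1 := by rintro rfl; simp at h
  obtain ⟨j, hj⟩ := cs.exists_leftDescent_of_ne_one hv1
  have hjm := mem_of_isLeftDescent hv hj
  have hsj := simple_mem_parabolic (cs := cs) hjm
  have hl := cs.isLeftDescent_iff.1 hj
  by_cases huj : cs.IsLeftDescent u j
  · have hl' := cs.isLeftDescent_iff.1 huj
    have := ih _ (by omega) (mul_mem hsj hu) (mul_mem hsj hv) (by omega) rfl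
    simpa using this.simple_mul_mono (not_isLeftDescent_simple_mul.2 hj)
  · refine BLE.trans ?_ (simple_mul_ble hj)
    rcases Nat.lt_or_ge (cs.length u) (cs.length (cs.simple j * v)) with h1 | h1
    · exact ih _ (by omega) hu (mul_mem hsj hv) h1 rfl
    · have hE : ∀ {g h : W}, g ∈ cs.parabolic {a, b} → h ∈ cs.parabolic {a, b} →
          cs.length g = cs.length h → ¬ cs.IsLeftDescent g j → ¬ cs.IsLeftDescent h j → g = h := by
        intro g h hg hh
        rcases hjm with rfl | rfl
        · exact eq_of_not_isLeftDescent hg hh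
        · rw [parabolic_pair_comm] at hg hh
          exact eq_of_not_isLeftDescent hg hh
      rw [hE hu (mul_mem hsj hv) (by omega) huj (not_isLeftDescent_simple_mul.2 hj)]
      exact .refl _

theorem cov_of_length_eq {u v : W} (hu : u ∈ cs.parabolic {a, b}) (hv : v ∈ cs.parabolic {a, b})
    (h : cs.length v = cs.length u + 1) : cs.Cov u v :=
  ⟨ble_of_length_lt hu hv (by omega), h⟩

theorem eq_of_not_isLeftDescent' {g h : W} (hg : g ∈ cs.parabolic {a, b})
    (hh : h ∈ cs.parabolic {a, b}) (hl : cs.length g = cs.length h) {j : B}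
    (hj : j ∈ ({a, b} : Set B))
    (hgj : ¬ cs.IsLeftDescent g j) (hhj : ¬ cs.IsLeftDescent h j) : g = h := by
  rcases hj with rfl | rfl
  · exact eq_of_not_isLeftDescent hg hh hl hgj hhj
  · rw [parabolic_pair_comm] at hg hh
    exact eq_of_not_isLeftDescent hg hh hl hgj hhj

theorem eq_of_isLeftDescent' {g h : W} (hg : g ∈ cs.parabolic {a, b})
    (hh : h ∈ cs.parabolic {a, b}) (hl : cs.length g = cs.length h) {j : B}
    (hj : j ∈ ({a, b} : Set B))
    (hgj : cs.IsLeftDescent g j) (hhj : cs.IsLeftDescent h j) : g = h := by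
  rcases hj with rfl | rfl
  · exact eq_of_isLeftDescent hg hh hl hgj hhj
  · rw [parabolic_pair_comm] at hg hh
    exact eq_of_isLeftDescent hg hh hl hgj hhj

end DihedralOrder

namespace IsMatchingOn

variable {a b : B} {Q : Set W} {g : W → W}

/-- A matching of a lower subset of a dihedral parabolic subgroup extends to the subgroup. -/
theorem exists_extension (hg : cs.IsMatchingOn Q g) (hQ : Q ⊆ cs.parabolic {a, b})
    (h1 : (1 : W) ∈ Q) :
    ∃ g', cs.IsMatchingOn (cs.parabolic {a, b}) g' ∧ ∀ x ∈ Q, g' x = g x := by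
  classical
  set D := cs.parabolic {a, b} with hD
  by_cases hQD : (D : Set W) ⊆ Q
  · rw [Set.Subset.antisymm hQ hQD] at hg
    exact ⟨g, hg, fun _ _ => rfl⟩
  have hex : ∃ n, ∃ x ∈ D, x ∉ Q ∧ cs.length x = n := by
    rw [Set.not_subset] at hQD
    obtain ⟨x, hx, hxQ⟩ := hQD
    exact ⟨_, x, hx, hxQ, rfl⟩
  -- Since order compares lengths, `Q` contains everything shorter than `x` and nothing longer; it
  -- can only hold part of the level of `x`.
  obtain ⟨x, hxD, hxQ, hxn⟩ := Nat.find_spec hex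
  have hmin : ∀ u ∈ D, u ∉ Q → cs.length x ≤ cs.length u := fun u hu huQ =>
    hxn ▸ Nat.find_min' hex ⟨u, hu, huQ, rfl⟩
  have hmax : ∀ u ∈ Q, cs.length u ≤ cs.length x := fun u hu => by
    by_contra h
    exact hxQ (hg.lower (ble_of_length_lt hxD (hQ hu) (not_le.1 h)) hu)
  have hx1 : x ≠ 1 := by rintro rfl; exact hxQ h1
  -- some element of length `ℓ(x) - 1` is matched upwards
  obtain ⟨y, hyQ, hyl⟩ : ∃ y ∈ Q, cs.length y = cs.length x := by
    have hlt : ∀ {p}, cs.Cov p x → p ∈ Q ∧ cs.length p + 1 = cs.length x := by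
      intro p hp
      refine ⟨?_, hp.2.symm⟩
      by_contra hpQ
      have := hmin p (hp.1.mem_parabolic hxD) hpQ
      have := hp.2
      omega
    have hup : ∀ {p}, cs.Cov p x → cs.Cov p (g p) → cs.length (g p) = cs.length x := by
      intro p hp h
      rw [h.2, hp.2]
    obtain ⟨i, hi⟩ := cs.exists_leftDescent_of_ne_one hx1
    have hp := simple_mul_cov hi
    rcases hg.cov (hlt hp).1 with h2 | h2
    · exact ⟨_, hg.maps (hlt hp).1, hup hp h2⟩
    -- A second coatom of `x` comes from another left descent, or else from a right descent.
    · obtain ⟨p', hp', hne⟩ : ∃ p', cs.Cov p' x ∧ cs.simple i * x ≠ p' := by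
        by_cases hj : ∃ j, cs.IsLeftDescent x j ∧ j ≠ i
        · obtain ⟨j, hj, hji⟩ := hj
          exact ⟨_, simple_mul_cov hj, fun e => hji (cs.simple_inj (mul_right_cancel e)).symm⟩
        · push Not at hj
          obtain ⟨r, hr⟩ := cs.exists_rightDescent_of_ne_one hx1
          refine ⟨_, mul_simple_cov hr, fun e => ?_⟩
          have hx'1 : cs.simple i * x ≠ 1 := by
            intro e2
            have := h2.2
            rw [e2, length_one] at this
            omega
          obtain ⟨j, hd⟩ := cs.exists_leftDescent_of_ne_one hx'1
          obtain rfl := hj j (IsLeftDescent.of_mul_simple hr (e ▸ hd))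
          exact not_isLeftDescent_simple_mul.2 hi hd
      -- If both coatoms were matched downward, the image of `p'` would be a coatom of the first one
      -- that violates the coatom condition.
      refine ⟨_, hg.maps (hlt hp').1, hup hp' ((hg.cov (hlt hp').1).resolve_right fun h3 => ?_)⟩
      have h4 : cs.Cov (g (cs.simple i * x)) (g (g (cs.simple i * x))) := by
        rwa [hg.invol (hlt hp).1]
      have h5 : cs.Cov (g (p')) (g (g (cs.simple i * x))) := by
        rw [hg.invol (hlt hp).1]
        refine cov_of_length_eq (hQ (hg.maps (hlt hp').1)) (hQ (hlt hp).1) ?_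
        have := h3.2; have := (hlt hp).2; have := (hlt hp').2
        omega
      rcases (hg.coat (hg.maps (hlt hp).1) h4 _).1 h5 with e | ⟨v, h6, h7, h8⟩
      · have e2 := congrArg g e
        rw [hg.invol (hlt hp).1, hg.invol (hlt hp').1] at e2
        exact hne e2.symm
      · have h9 := h7.2
        have h10 := h6.2
        have e2 := congrArg g h8
        have hvQ := hg.lower h6.1 (hg.maps (hlt hp).1)
        rw [hg.invol hvQ, hg.invol (hlt hp').1] at e2
        rw [e2] at h9
        have := h3.2; have := h2.2; have := (hlt hp).2; have := (hlt hp').2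
        omega
  have hyD := hQ hyQ
  have hyx : y ≠ x := by rintro rfl; exact hxQ hyQ
  have hy1 : y ≠ 1 := by
    rintro rfl
    rw [length_one] at hyl
    exact hx1 (cs.length_eq_zero_iff.1 hyl.symm)
  -- `y` is the other element at the level of `x`. Left multiplication by its first letter `j`,
  -- which `x` lacks, preserves the complement of `Q`, so it can define the extension there.
  obtain ⟨j, hyj⟩ := cs.exists_leftDescent_of_ne_one hy1
  have hj := mem_of_isLeftDescent hyD hyj
  have hsj : cs.simple j ∈ D := simple_mem_parabolic hj
  have hxj : ¬ cs.IsLeftDescent x j := fun h => hyx (eq_of_isLeftDescent' hyD hxD hyl hj hyj h)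
  have hlevel : ∀ u ∈ D, u ∉ Q → cs.length u = cs.length x → u = x := by
    intro u hu huQ hl
    refine eq_of_not_isLeftDescent' hu hxD hl hj (fun h => huQ ?_) hxj
    rwa [eq_of_isLeftDescent' hu hyD (hl.trans hyl.symm) hj h hyj]
  have hjQ : ∀ u ∈ D, u ∉ Q → cs.simple j * u ∉ Q := by
    intro u hu huQ hjuQ
    have h2 := hmax _ hjuQ
    have h3 := hmin u hu huQ
    by_cases hd : cs.IsLeftDescent u j
    · have h4 := cs.isLeftDescent_iff.1 hd
      have h5 : cs.length u ≠ cs.length x := fun h => hxj (hlevel u hu huQ h ▸ hd)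
      have := eq_of_not_isLeftDescent' (mul_mem hsj hu) hxD (by omega) hj
        (not_isLeftDescent_simple_mul.2 hd) hxj
      exact hxQ (this ▸ hjuQ)
    · have h4 := cs.not_isLeftDescent_iff.1 hd
      omega
  have hdown : ∀ z ∈ Q, cs.length z = cs.length x → cs.Cov (g z) z := by
    intro z hz hl
    refine (hg.cov hz).resolve_left fun h => ?_
    have := hmax _ (hg.maps hz)
    have := h.2
    omega
  refine ⟨fun u => if u ∈ Q then g u else cs.simple j * u, ⟨fun {u v} h hv => h.mem_parabolic hv,
    fun {u} hu => ?_, fun {u} hu => ?_, fun {u} hu => ?_, fun {u} hu h z => ?_⟩,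
    fun u hu => if_pos hu⟩
  · split_ifs with huQ
    · exact hQ (hg.maps huQ)
    · exact mul_mem hsj hu
  · by_cases huQ : u ∈ Q
    · rw [if_pos huQ, if_pos (hg.maps huQ), hg.invol huQ]
    · rw [if_neg huQ, if_neg (hjQ u hu huQ), simple_mul_simple_cancel_left]
  · split_ifs with huQ
    · exact hg.cov huQ
    · exact cov_simple_mul_or _ _
  · by_cases huQ : u ∈ Q
    · rw [if_pos huQ] at h ⊢
      rw [hg.coat huQ h]
      refine or_congr Iff.rfl (exists_congr fun v => and_congr_right fun hv => ?_)
      rw [if_pos (hg.lower hv.1 huQ)]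
    · rw [if_neg huQ] at h ⊢
      have hju := mul_mem hsj hu
      constructor
      · intro hz
        have hzD := hz.1.mem_parabolic hju
        have hzu : cs.length z = cs.length u := by have := hz.2; have := h.2; omega
        have hun := hmin u hu huQ
        have hud : ¬ cs.IsLeftDescent u j := by
          rw [cs.not_isLeftDescent_iff]; exact h.2
        by_cases hzQ : z ∈ Q
        · right
          have h2 := hmax z hzQ
          have h3 := hdown z hzQ (by omega)
          have h4 := hg.maps hzQ
          refine ⟨g z, cov_of_length_eq (hQ h4) hu (by rw [← hzu, h3.2]), ?_, ?_⟩
          · rw [if_pos h4, hg.invol hzQ]; exact h3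
          · rw [if_pos h4, hg.invol hzQ]
        · rcases hz.eq_simple_mul_or (isLeftDescent_simple_mul.2 hud) with h2 | h2
          · left; rw [h2, simple_mul_simple_cancel_left]
          · right
            have h3 := simple_mul_cov h2
            have h4 := hjQ z hzD hzQ
            refine ⟨cs.simple j * z, cov_of_length_eq (mul_mem hsj hzD) hu
              (by rw [← hzu, h3.2]), ?_, ?_⟩
            · rw [if_neg h4, simple_mul_simple_cancel_left]; exact h3
            · rw [if_neg h4, simple_mul_simple_cancel_left]
      · rintro (rfl | ⟨v, h2, h3, h4⟩)
        · exact h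
        · have hvD := h2.1.mem_parabolic hu
          refine cov_of_length_eq ?_ hju ?_
          · rw [← h4]
            split_ifs with hvQ
            · exact hQ (hg.maps hvQ)
            · exact mul_mem hsj hvD
          · rw [h.2, ← h4, h3.2, h2.2]

end IsMatchingOn

end CoxeterSystem

/-! ### Direct factors of a Coxeter system and their retractions. -/

/-- The Coxeter graph has no edge between `J` and its complement. -/
def CoxeterMatrix.IsDirectFactor {B : Type*} (M : CoxeterMatrix B) (J : Set B) : Prop :=
  ∀ i ∈ J, ∀ j ∉ J, M i j = 2

theorem CoxeterMatrix.IsDirectFactor.compl {B : Type*} {M : CoxeterMatrix B} {J : Set B}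
    (hJ : M.IsDirectFactor J) : M.IsDirectFactor Jᶜ := fun i hi j hj => by
  rw [M.symmetric]
  exact hJ j (not_not.1 hj) i hi

namespace CoxeterSystem

variable {B : Type*} {M : CoxeterMatrix B} {W : Type*} [Group W] {cs : CoxeterSystem M W}
  {J : Set B}

section Retraction

variable (cs)

/-- The homomorphism from the Coxeter group of `J` to `W`. -/
noncomputable def ofRestrict (J : Set B) : (M.restrict J).Group →* W :=
  (M.restrict J).toCoxeterSystem.lift
    ⟨fun i => cs.simple i, fun i j => cs.simple_mul_simple_pow i j⟩

@[simp] theorem ofRestrict_simple (i : J) :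
    cs.ofRestrict J ((M.restrict J).simple i) = cs.simple i :=
  (M.restrict J).toCoxeterSystem.lift_apply_simple _ i

theorem ofRestrict_mem (x : (M.restrict J).Group) : cs.ofRestrict J x ∈ cs.parabolic J := by
  induction x using (M.restrict J).toCoxeterSystem.simple_induction_left with
  | one => rw [map_one]; exact one_mem _
  | mul_simple_left w i hw =>
    rw [map_mul, CoxeterMatrix.toCoxeterSystem_simple, ofRestrict_simple]
    exact mul_mem (simple_mem_parabolic i.2) hw

-- A mixed relation has exponent 2, and reduces to a generator squaring to 1.
open scoped Classical in
theorem isLiftable_extend (hJ : M.IsDirectFactor J) :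
    M.IsLiftable fun i => if h : i ∈ J then (M.restrict J).simple ⟨i, h⟩ else 1 := by
  intro i j
  have hsq : ∀ i, (M.restrict J).simple i ^ 2 = 1 := (M.restrict J).toCoxeterSystem.simple_sq
  by_cases hi : i ∈ J <;> by_cases hj : j ∈ J
  · simp only [hi, hj, dite_true]
    exact (M.restrict J).toCoxeterSystem.simple_mul_simple_pow ⟨i, hi⟩ ⟨j, hj⟩
  · simp only [hi, hj, dite_true, dite_false, mul_one, hJ i hi j hj, hsq]
  · simp only [hi, hj, dite_true, dite_false, one_mul, M.symmetric i j, hJ j hj i hi, hsq]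
  · simp only [hi, hj, dite_false, mul_one, one_pow]

/-- The homomorphism from `W` to the Coxeter group of a direct factor `J` which is trivial on the
other generators. -/
noncomputable def toRestrict (hJ : M.IsDirectFactor J) : W →* (M.restrict J).Group :=
  cs.lift ⟨_, isLiftable_extend hJ⟩

theorem toRestrict_simple (hJ : M.IsDirectFactor J) {i : B} (hi : i ∈ J) :
    cs.toRestrict hJ (cs.simple i) = (M.restrict J).simple ⟨i, hi⟩ :=
  (cs.lift_apply_simple _ i).trans (dif_pos hi)

theorem toRestrict_simple_of_notMem (hJ : M.IsDirectFactor J) {i : B} (hi : i ∉ J) :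
    cs.toRestrict hJ (cs.simple i) = 1 :=
  (cs.lift_apply_simple _ i).trans (dif_neg hi)

/-- The retraction of `W` onto a direct factor. -/
noncomputable def retract (hJ : M.IsDirectFactor J) : W →* cs.parabolic J :=
  ((cs.ofRestrict J).codRestrict (cs.parabolic J) cs.ofRestrict_mem).comp (cs.toRestrict hJ)

theorem coe_retract (hJ : M.IsDirectFactor J) (w : W) :
    (cs.retract hJ w : W) = cs.ofRestrict J (cs.toRestrict hJ w) := rfl

theorem coe_retract_simple (hJ : M.IsDirectFactor J) {i : B} (hi : i ∈ J) :
    (cs.retract hJ (cs.simple i) : W) = cs.simple i := by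
  rw [coe_retract, toRestrict_simple cs hJ hi, ofRestrict_simple]

theorem retract_simple_of_notMem (hJ : M.IsDirectFactor J) {i : B} (hi : i ∉ J) :
    cs.retract hJ (cs.simple i) = 1 :=
  Subtype.ext (by rw [coe_retract, toRestrict_simple_of_notMem cs hJ hi, map_one]; rfl)

theorem coe_retract_of_mem (hJ : M.IsDirectFactor J) {w : W} (hw : w ∈ cs.parabolic J) :
    (cs.retract hJ w : W) = w := by
  have : Set.EqOn ((cs.parabolic J).subtype.comp (cs.retract hJ)) (MonoidHom.id W)
      (cs.parabolic J) := by
    refine MonoidHom.eqOn_closure ?_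
    rintro _ ⟨i, hi, rfl⟩
    exact cs.coe_retract_simple hJ hi
  exact this hw

@[simp] theorem retract_coe (hJ : M.IsDirectFactor J) (w : cs.parabolic J) :
    cs.retract hJ w = w := Subtype.ext (cs.coe_retract_of_mem hJ w.2)

theorem retract_of_mem_compl (hJ : M.IsDirectFactor J) {w : W} (hw : w ∈ cs.parabolic Jᶜ) :
    cs.retract hJ w = 1 := by
  have : Set.EqOn (cs.retract hJ) (1 : W →* cs.parabolic J) (cs.parabolic Jᶜ) := by
    refine MonoidHom.eqOn_closure ?_
    rintro _ ⟨i, hi, rfl⟩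
    exact cs.retract_simple_of_notMem hJ hi
  exact this hw

@[simp] theorem retract_coe_compl (hJ : M.IsDirectFactor J) (w : cs.parabolic Jᶜ) :
    cs.retract hJ w = 1 := cs.retract_of_mem_compl hJ w.2

theorem retract_compl_of_mem (hJ : M.IsDirectFactor Jᶜ) {w : W} (hw : w ∈ cs.parabolic J) :
    cs.retract hJ w = 1 :=
  cs.retract_of_mem_compl hJ (by rwa [compl_compl])

@[simp] theorem retract_compl_coe (hJ : M.IsDirectFactor Jᶜ) (w : cs.parabolic J) :
    cs.retract hJ w = 1 := cs.retract_compl_of_mem hJ w.2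

theorem commute_of_mem_parabolic (hJ : M.IsDirectFactor J) {x y : W} (hx : x ∈ cs.parabolic Jᶜ)
    (hy : y ∈ cs.parabolic J) : Commute x y := by
  have h1 : cs.parabolic J ≤ Subgroup.centralizer (cs.simple '' Jᶜ) := by
    refine (Subgroup.closure_le _).2 ?_
    rintro _ ⟨i, hi, rfl⟩ _ ⟨j, hj, rfl⟩
    exact (cs.simple_commute_of_eq_two (hJ i hi j hj)).symm
  have h2 : cs.parabolic Jᶜ ≤ Subgroup.centralizer (cs.parabolic J) := by
    refine (Subgroup.closure_le _).2 ?_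
    intro s hs y hy
    exact (h1 hy s hs).symm
  exact (h2 hx y hy).symm

theorem retract_mul_retract (hJ : M.IsDirectFactor J) (w : W) :
    (cs.retract hJ.compl w : W) * cs.retract hJ w = w := by
  induction w using cs.simple_induction_left with
  | one => simp
  | mul_simple_left w i hw =>
    rw [map_mul, map_mul, Subgroup.coe_mul, Subgroup.coe_mul]
    by_cases hi : i ∈ J
    · rw [retract_compl_of_mem cs hJ.compl (simple_mem_parabolic hi), coe_retract_simple cs hJ hi,
        Subgroup.coe_one, one_mul, ← mul_assoc,
        (cs.commute_of_mem_parabolic hJ (Subtype.prop _) (simple_mem_parabolic hi)).eq, mul_assoc,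
        hw]
    · rw [retract_simple_of_notMem cs hJ hi, coe_retract_simple cs hJ.compl hi, Subgroup.coe_one,
        one_mul, mul_assoc, hw]

theorem retract_ext (hJ : M.IsDirectFactor J) {x y : W}
    (h : cs.retract hJ.compl x = cs.retract hJ.compl y) (h' : cs.retract hJ x = cs.retract hJ y) :
    x = y := by
  rw [← cs.retract_mul_retract hJ x, h, h', cs.retract_mul_retract]

/-- A Coxeter group is the direct product of complementary direct factors. -/
theorem exists_parabolic_prod_mulEquiv (hJ : M.IsDirectFactor J) :
    ∃ e : cs.parabolic Jᶜ × cs.parabolic J ≃* W, ∀ x y, e (x, y) = (x : W) * (y : W) := by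
  refine ⟨MulEquiv.ofBijective (MonoidHom.noncommCoprod (cs.parabolic Jᶜ).subtype
    (cs.parabolic J).subtype fun x y => cs.commute_of_mem_parabolic hJ x.2 y.2) ⟨?_, ?_⟩,
    fun x y => rfl⟩
  · rintro ⟨x, y⟩ ⟨x', y'⟩ h
    have h : (x : W) * y = x' * y' := h
    have h1 := congrArg (cs.retract hJ.compl) h
    have h2 := congrArg (cs.retract hJ) h
    simp only [map_mul, retract_coe, retract_compl_coe, retract_coe_compl, one_mul, mul_one]
      at h1 h2
    rw [h1, h2]
  · intro w
    exact ⟨(cs.retract hJ.compl w, cs.retract hJ w), cs.retract_mul_retract hJ w⟩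

/-- The Coxeter system of a direct factor. -/
noncomputable def parabolicSystem (hJ : M.IsDirectFactor J) :
    CoxeterSystem (M.restrict J) (cs.parabolic J) where
  mulEquiv := MonoidHom.toMulEquiv ((cs.toRestrict hJ).comp (cs.parabolic J).subtype)
    ((cs.ofRestrict J).codRestrict (cs.parabolic J) cs.ofRestrict_mem)
    (MonoidHom.ext fun x => cs.retract_coe hJ x)
    ((M.restrict J).toCoxeterSystem.ext_simple fun i => by
      rw [CoxeterMatrix.toCoxeterSystem_simple]
      change cs.toRestrict hJ (cs.ofRestrict J _) = _
      rw [ofRestrict_simple, toRestrict_simple cs hJ i.2]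
      rfl)

@[simp] theorem coe_parabolicSystem_simple (hJ : M.IsDirectFactor J) (i : J) :
    ((cs.parabolicSystem hJ).simple i : W) = cs.simple i :=
  cs.ofRestrict_simple i

theorem coe_parabolicSystem_wordProd (hJ : M.IsDirectFactor J) (ω : List J) :
    ((cs.parabolicSystem hJ).wordProd ω : W) = cs.wordProd (ω.map (↑)) := by
  induction ω with
  | nil => simp
  | cons i ω ih => simp [wordProd_cons, ih]

@[simp] theorem parabolicSystem_length (hJ : M.IsDirectFactor J) (x : cs.parabolic J) :
    (cs.parabolicSystem hJ).length x = cs.length (x : W) := by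
  apply le_antisymm
  · obtain ⟨ω, hω, h, hωJ⟩ := exists_isReduced_of_mem_parabolic x.2
    lift ω to List J using hωJ
    have : x = (cs.parabolicSystem hJ).wordProd ω :=
      Subtype.ext (h.trans (cs.coe_parabolicSystem_wordProd hJ ω).symm)
    rw [h, hω.eq, List.length_map, this]
    exact length_wordProd_le _ _
  · obtain ⟨ω, hω, rfl⟩ := (cs.parabolicSystem hJ).exists_isReduced x
    rw [hω.eq, coe_parabolicSystem_wordProd, ← List.length_map (as := ω) ((↑) : J → B)]
    exact length_wordProd_le _ _

/-- A conjugate of a generator projects to a conjugate in that generator's factor and to 1 in the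
other. -/
theorem IsReflection.retract {t : W} (ht : cs.IsReflection t) (hJ : M.IsDirectFactor J) :
    cs.retract hJ.compl t = 1 ∧ (cs.parabolicSystem hJ).IsReflection (cs.retract hJ t) ∨
    cs.retract hJ t = 1 ∧ (cs.parabolicSystem hJ.compl).IsReflection (cs.retract hJ.compl t) := by
  obtain ⟨w, i, rfl⟩ := ht
  by_cases hi : i ∈ J
  · left
    refine ⟨?_, cs.retract hJ w, ⟨i, hi⟩, ?_⟩
    · simp [cs.retract_compl_of_mem hJ.compl (simple_mem_parabolic hi)]
    · rw [map_mul, map_mul, map_inv]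
      congr 2
      exact Subtype.ext (by rw [coe_parabolicSystem_simple, cs.coe_retract_simple hJ hi])
  · right
    refine ⟨?_, cs.retract hJ.compl w, ⟨i, hi⟩, ?_⟩
    · simp [cs.retract_simple_of_notMem hJ hi]
    · rw [map_mul, map_mul, map_inv]
      congr 2
      exact Subtype.ext (by rw [coe_parabolicSystem_simple, cs.coe_retract_simple hJ.compl hi])

theorem parabolicSystem_isReflection_iff (hJ : M.IsDirectFactor J) {t : cs.parabolic J} :
    (cs.parabolicSystem hJ).IsReflection t ↔ cs.IsReflection (t : W) := by
  constructor
  · rintro ⟨w, i, rfl⟩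
    exact ⟨w, i, by simp⟩
  · intro ht
    rcases IsReflection.retract cs ht hJ with h | h
    · simpa using h.2
    · have h1 := ht.odd_length
      rw [retract_coe] at h
      simp [h.1] at h1

theorem parabolicSystem_ble_iff (hJ : M.IsDirectFactor J) {x y : cs.parabolic J} :
    (cs.parabolicSystem hJ).BLE x y ↔ cs.BLE (x : W) y := by
  constructor
  · refine fun h => Relation.ReflTransGen.lift ((↑) : cs.parabolic J → W) ?_ _ _ h
    rintro u v ⟨t, ht, rfl, hlt⟩
    rw [parabolicSystem_length, parabolicSystem_length] at hlt
    exact ⟨t, (cs.parabolicSystem_isReflection_iff hJ).1 ht, rfl, hlt⟩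
  · obtain ⟨x, hx⟩ := x
    obtain ⟨y, hy⟩ := y
    intro h
    dsimp only at h
    induction h using Relation.ReflTransGen.head_induction_on with
    | refl => exact .refl _
    | @head u v hs h ih =>
      have hv := BLE.mem_parabolic h hy
      refine Relation.ReflTransGen.head ?_ (ih hv)
      obtain ⟨t, ht, rfl, hlt⟩ := hs
      refine ⟨⟨t, by simpa using mul_mem (inv_mem hx) hv⟩,
        (cs.parabolicSystem_isReflection_iff hJ).2 ht, rfl, ?_⟩
      rwa [parabolicSystem_length, parabolicSystem_length]

theorem parabolicSystem_cov_iff (hJ : M.IsDirectFactor J) {x y : cs.parabolic J} :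
    (cs.parabolicSystem hJ).Cov x y ↔ cs.Cov (x : W) y := by
  rw [Cov, Cov, parabolicSystem_ble_iff, parabolicSystem_length, parabolicSystem_length]

theorem coe_retract_wordProd [DecidablePred (· ∈ J)] (hJ : M.IsDirectFactor J) (ω : List B) :
    (cs.retract hJ (cs.wordProd ω) : W) = cs.wordProd (ω.filter (· ∈ J)) := by
  induction ω with
  | nil => simp
  | cons i ω ih =>
    rw [wordProd_cons, map_mul, Subgroup.coe_mul, ih]
    by_cases hi : i ∈ J
    · rw [coe_retract_simple cs hJ hi, List.filter_cons_of_pos (by simpa using hi), wordProd_cons]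
    · rw [retract_simple_of_notMem cs hJ hi, List.filter_cons_of_neg (by simpa using hi)]
      simp

/-- Sorting the letters of a reduced word by factor gives words for the two components; the other
inequality is subadditivity. -/
theorem length_retract_add (hJ : M.IsDirectFactor J) (w : W) :
    cs.length (cs.retract hJ.compl w : W) + cs.length (cs.retract hJ w : W) = cs.length w := by
  classical
  apply le_antisymm
  · obtain ⟨ω, hω, rfl⟩ := cs.exists_isReduced w
    rw [hω.eq, coe_retract_wordProd, coe_retract_wordProd,
      List.length_eq_length_filter_add (l := ω) (· ∈ J), add_comm]
    refine add_le_add (length_wordProd_le _ _) ((length_wordProd_le _ _).trans (le_of_eq ?_))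
    congr 2
    ext i
    simp
  · conv_lhs => rw [← cs.retract_mul_retract hJ w]
    exact length_mul_le _ _ _

end Retraction

/-! ### Covers and matchings in a direct product. -/

theorem cov_iff_exists_isReflection {u v : W} :
    cs.Cov u v ↔ ∃ t, cs.IsReflection t ∧ v = u * t ∧ cs.length v = cs.length u + 1 := by
  constructor
  · rintro ⟨h, hl⟩
    rcases Relation.ReflTransGen.cases_head h with rfl | ⟨w, ⟨t, ht, hw, hlt⟩, h'⟩
    · omega
    · have := BLE.eq_of_length_le (cs := cs) h' (by omega)
      subst this
      exact ⟨t, ht, hw, hl⟩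
  · rintro ⟨t, ht, h, hl⟩
    exact ⟨.single ⟨t, ht, h, by omega⟩, hl⟩

/-- A reflection lives in one factor and length is additive, so a cover moves exactly one component.
-/
theorem cov_iff_retract (hJ : M.IsDirectFactor J) {x w : W} : cs.Cov x w ↔
    (cs.parabolicSystem hJ.compl).Cov (cs.retract hJ.compl x) (cs.retract hJ.compl w) ∧
      cs.retract hJ x = cs.retract hJ w ∨
    cs.retract hJ.compl x = cs.retract hJ.compl w ∧
      (cs.parabolicSystem hJ).Cov (cs.retract hJ x) (cs.retract hJ w) := by
  have hx := cs.length_retract_add hJ x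
  have hw := cs.length_retract_add hJ w
  simp only [cov_iff_exists_isReflection, parabolicSystem_length]
  constructor
  · rintro ⟨t, ht, rfl, hl⟩
    rcases IsReflection.retract cs ht hJ with ⟨h1, h2⟩ | ⟨h1, h2⟩
    · right
      have h3 : cs.retract hJ.compl (x * t) = cs.retract hJ.compl x := by rw [map_mul, h1, mul_one]
      refine ⟨h3.symm, _, h2, map_mul _ _ _, ?_⟩
      rw [h3] at hw
      omega
    · left
      have h3 : cs.retract hJ (x * t) = cs.retract hJ x := by rw [map_mul, h1, mul_one]
      refine ⟨⟨_, h2, map_mul _ _ _, ?_⟩, h3.symm⟩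
      rw [h3] at hw
      omega
  · rintro (⟨⟨t, ht, h1, h2⟩, h3⟩ | ⟨h3, t, ht, h1, h2⟩)
    · refine ⟨t, (cs.parabolicSystem_isReflection_iff hJ.compl).1 ht, ?_, by rw [h3] at hx; omega⟩
      refine cs.retract_ext hJ ?_ ?_
      · rw [h1, map_mul, retract_coe]
      · rw [← h3, map_mul, retract_coe_compl, mul_one]
    · refine ⟨t, (cs.parabolicSystem_isReflection_iff hJ).1 ht, ?_, by rw [h3] at hx; omega⟩
      refine cs.retract_ext hJ ?_ ?_
      · rw [← h3, map_mul, retract_compl_coe, mul_one]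
      · rw [h1, map_mul, retract_coe]

namespace IsMatchingOn

/-- A matching of a direct factor induces a matching of the whole group. -/
theorem prod (hJ : M.IsDirectFactor J) {g : cs.parabolic J → cs.parabolic J}
    (hg : (cs.parabolicSystem hJ).IsMatchingOn Set.univ g) :
    cs.IsMatchingOn Set.univ
      fun w => (cs.retract hJ.compl w : W) * (g (cs.retract hJ w) : W) := by
  set F : W → W := fun w => (cs.retract hJ.compl w : W) * (g (cs.retract hJ w) : W) with hF
  have hp : ∀ w, cs.retract hJ.compl (F w) = cs.retract hJ.compl w := fun w => by simp [hF]
  have hq : ∀ w, cs.retract hJ (F w) = g (cs.retract hJ w) := fun w => by simp [hF]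
  have irr : ∀ {J' : Set B} (hJ' : M.IsDirectFactor J') (w : W),
      ¬ (cs.parabolicSystem hJ').Cov (cs.retract hJ' w) (cs.retract hJ' w) :=
    fun _ _ h => h.ne rfl
  have hcov : ∀ w, cs.Cov w (F w) ↔
      (cs.parabolicSystem hJ).Cov (cs.retract hJ w) (g (cs.retract hJ w)) := fun w => by
    rw [cov_iff_retract hJ, hp, hq]
    simp [irr]
  refine ⟨fun _ _ => trivial, fun _ => trivial, fun {w} _ => ?_, fun {w} _ => ?_,
    fun {w} _ h x => ?_⟩
  · exact cs.retract_ext hJ (by rw [hp, hp]) (by rw [hq, hq, hg.invol trivial])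
  · refine (hg.cov (u := cs.retract hJ w) trivial).imp (hcov w).2 fun h => ?_
    rw [cov_iff_retract hJ, hp, hq]
    exact Or.inr ⟨rfl, h⟩
  · rw [hcov] at h
    rw [cov_iff_retract hJ, hp, hq]
    constructor
    · rintro (⟨h1, h2⟩ | ⟨h1, h2⟩)
      · right
        have hvp : cs.retract hJ.compl ((cs.retract hJ.compl x : W) * cs.retract hJ w)
          = cs.retract hJ.compl x := by simp
        have hvq : cs.retract hJ ((cs.retract hJ.compl x : W) * cs.retract hJ w)
          = cs.retract hJ w := by simp
        refine ⟨(cs.retract hJ.compl x : W) * cs.retract hJ w, ?_, ?_, ?_⟩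
        · rw [cov_iff_retract hJ, hvp, hvq]
          exact Or.inl ⟨h1, rfl⟩
        · rw [hcov, hvq]; exact h
        · exact cs.retract_ext hJ (by rw [hp, hvp]) (by rw [hq, hvq, h2])
      · rcases (hg.coat trivial h _).1 h2 with h3 | ⟨v, h3, h4, h5⟩
        · exact Or.inl (cs.retract_ext hJ h1 h3)
        · right
          have hvp : cs.retract hJ.compl ((cs.retract hJ.compl w : W) * v)
            = cs.retract hJ.compl w := by simp
          have hvq : cs.retract hJ ((cs.retract hJ.compl w : W) * v) = v := by simp
          refine ⟨(cs.retract hJ.compl w : W) * v, ?_, ?_, ?_⟩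
          · rw [cov_iff_retract hJ, hvp, hvq]
            exact Or.inr ⟨rfl, h3⟩
          · rw [hcov, hvq]; exact h4
          · exact cs.retract_ext hJ (by rw [hp, hvp, h1]) (by rw [hq, hvq, h5])
    · rintro (rfl | ⟨v, h1, h2, rfl⟩)
      · exact Or.inr ⟨rfl, h⟩
      · rw [hcov] at h2
        rw [cov_iff_retract hJ] at h1
        rw [hp, hq]
        rcases h1 with ⟨h3, h4⟩ | ⟨h3, h4⟩
        · exact Or.inl ⟨h3, by rw [h4]⟩
        · exact Or.inr ⟨h3, (hg.coat trivial h _).2 (Or.inr ⟨_, h4, h2, rfl⟩)⟩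

/-- The restriction of a matching to a direct factor containing `a`. -/
theorem restrict (hJ : M.IsDirectFactor J) {Q : Set W} {f : W → W} (hf : cs.IsMatchingOn Q f)
    {a : B} (h1 : f 1 = cs.simple a) (ha : a ∈ J) :
    (cs.parabolicSystem hJ).IsMatchingOn (Subtype.val ⁻¹' Q) (fun x => cs.retract hJ (f x)) := by
  have key : ∀ {x : cs.parabolic J}, (x : W) ∈ Q → (cs.retract hJ (f x) : W) = f x := fun {x} hx =>
    cs.coe_retract_of_mem hJ (hf.mem_parabolic h1 ha hx x.2)
  refine ⟨fun {u v} h hv => ?_, fun {u} hu => ?_, fun {u} hu => ?_, fun {u} hu => ?_,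
    fun {u} hu h x => ?_⟩
  · exact hf.lower ((cs.parabolicSystem_ble_iff hJ).1 h) hv
  · rw [Set.mem_preimage, key hu]; exact hf.maps hu
  · exact Subtype.ext (by rw [key hu, hf.invol hu, retract_coe])
  · rw [parabolicSystem_cov_iff, parabolicSystem_cov_iff, key hu]
    exact hf.cov hu
  · rw [parabolicSystem_cov_iff, key hu] at h ⊢
    rw [hf.coat hu h, ← Subtype.ext_iff]
    refine or_congr Iff.rfl ⟨?_, ?_⟩
    · rintro ⟨v, h2, h3, h4⟩
      have hv := hf.lower h2.1 hu
      refine ⟨⟨v, h2.1.mem_parabolic u.2⟩, (cs.parabolicSystem_cov_iff hJ).2 h2, ?_, ?_⟩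
      · rw [parabolicSystem_cov_iff, key hv]; exact h3
      · exact Subtype.ext (by rw [key hv, ← h4])
    · rintro ⟨v, h2, h3, rfl⟩
      rw [parabolicSystem_cov_iff] at h2 h3
      have hv := hf.lower h2.1 hu
      rw [key hv] at h3 ⊢
      exact ⟨v, h2, h3, rfl⟩

end IsMatchingOn

end CoxeterSystem

/-! ### The degenerate case. -/

namespace CoxeterSystem

variable {B : Type*} {M : CoxeterMatrix B} {W : Type*} [Group W] {cs : CoxeterSystem M W}

theorem mem_parabolic_pair_of_commute {a c : B} (hac : Commute (cs.simple a) (cs.simple c)) {u : W}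
    (hu : u ∈ cs.parabolic {a, c}) : u = 1 ∨ u = cs.simple a ∨ u = cs.simple c ∨
      u = cs.simple a * cs.simple c := by
  obtain ⟨ω, -, rfl, hω⟩ := exists_isReduced_of_mem_parabolic hu
  clear hu
  induction ω with
  | nil => simp
  | cons i ω ih =>
    rw [wordProd_cons]
    rcases hω i (by simp) with rfl | rfl <;>
      rcases ih (fun j hj => hω j (by simp [hj])) with h | h | h | h <;> rw [h]
    · simp
    · simp
    · simp
    · simp
    · simp
    · simp [hac.eq]
    · simp
    · rw [hac.eq]; simp

namespace IsMatchingOn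

variable {Q : Set W} {f : W → W} {a : B}

/-- The subgroup consists of `1`, `a`, `c` and `ac`. The matching pairs `1` with `a`, which leaves
only `ac` as partner of `c`. -/
theorem eq_simple_mul_of_commute (hf : cs.IsMatchingOn Q f) (h1 : f 1 = cs.simple a) {c : B}
    (hca : c ≠ a) (hac : Commute (cs.simple a) (cs.simple c)) {u : W} (hu : u ∈ Q)
    (hu' : u ∈ cs.parabolic {a, c}) : f u = cs.simple a * u := by
  have hQ1 : (1 : W) ∈ Q := hf.lower (one_ble u) hu
  have hfa : f (cs.simple a) = 1 := by rw [← h1, hf.invol hQ1]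
  have hfc : cs.simple c ∈ Q → f (cs.simple c) = cs.simple a * cs.simple c := by
    intro hc
    rcases mem_parabolic_pair_of_commute hac (hf.mem_parabolic h1 (Or.inl rfl) hc
      (simple_mem_parabolic (Or.inr rfl))) with h | h | h | h
    · have := hf.invol hc
      rw [h, h1] at this
      exact absurd (cs.simple_inj this).symm hca
    · have := hf.invol hc
      rw [h, hfa] at this
      have := cs.length_simple c
      simp_all
    · have := hf.cov hc
      rw [h] at this
      exact absurd rfl (this.elim Cov.ne Cov.ne)
    · exact h
  rcases mem_parabolic_pair_of_commute hac hu' with rfl | rfl | rfl | rfl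
  · rw [h1, mul_one]
  · rw [hfa, simple_mul_simple_self]
  · exact hfc hu
  · have hc : cs.simple c ∈ Q := by
      refine hf.lower ?_ hu
      rw [hac.eq]
      refine (cov_mul_simple ?_).1
      rw [IsRightDescent, length_simple]
      intro h
      have h2 := cs.length_eq_zero_iff.1 (Nat.lt_one_iff.1 h)
      exact hca (cs.simple_inj (by rw [eq_inv_of_mul_eq_one_left h2, inv_simple]))
    rw [← hfc hc, hf.invol hc, hfc hc, simple_mul_simple_cancel_left]

end IsMatchingOn

theorem parabolic_eq_top {J : Set B} (hJ : ∀ i, i ∈ J) : cs.parabolic J = ⊤ := by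
  rw [Set.eq_univ_of_forall hJ, parabolic, Set.image_univ, subgroup_closure_range_simple]

/-- A maximal matching of a dihedral group is defined everywhere. -/
theorem dom_eq_univ_of_pair {a b : B} (hab : ∀ i, i = a ∨ i = b) {φ : PartialMatching cs.Bruhat}
    (hφ : φ ∈ cs.maximalMatchings a) : φ.dom = Set.univ := by
  have hD : cs.parabolic {a, b} = ⊤ := parabolic_eq_top hab
  obtain ⟨hmax, hφ1⟩ := hφ
  obtain ⟨g, hg, hgf⟩ := φ.isMatchingOn.exists_extension (a := a) (b := b)
    (fun _ _ => by rw [hD]; trivial) (φ.maps_iff.1 hφ1).1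
  rw [hD, Subgroup.coe_top] at hg
  refine Set.eq_univ_of_univ_subset (hmax (b := hg.toPartialMatching)
    ⟨Set.subset_univ _, fun x y hxy => ?_⟩).1
  obtain ⟨hx, hy⟩ := φ.maps_iff.1 hxy
  exact hg.toPartialMatching_maps.2 ⟨trivial, (hgf x hx).trans hy⟩

variable {a b : B}

/-- If the Coxeter graph has no edge between `{a, b}` and its complement, then a matching which
maps `1` to `a` is the restriction of the one induced by a matching of the dihedral group. -/
theorem IsMatchingOn.exists_eq_prod (hJ : M.IsDirectFactor {a, b}) {Q : Set W} {f : W → W}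
    (hf : cs.IsMatchingOn Q f) (h1 : f 1 = cs.simple a) (hQ : (1 : W) ∈ Q) :
    ∃ g, (cs.parabolicSystem hJ).IsMatchingOn Set.univ g ∧ (g 1 : W) = cs.simple a ∧
      ∀ u ∈ Q, f u = (cs.retract hJ.compl u : W) * (g (cs.retract hJ u) : W) := by
  have ha : a ∈ ({a, b} : Set B) := Set.mem_insert a {b}
  have hb : b ∈ ({a, b} : Set B) := Set.mem_insert_of_mem a rfl
  have hD : (cs.parabolicSystem hJ).parabolic {⟨a, ha⟩, ⟨b, hb⟩} = ⊤ := by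
    refine parabolic_eq_top ?_
    rintro ⟨i, rfl | rfl⟩
    · exact Or.inl rfl
    · exact Or.inr rfl
  obtain ⟨g, hg, hgf⟩ := (hf.restrict hJ h1 ha).exists_extension (a := ⟨a, ha⟩) (b := ⟨b, hb⟩)
    (fun _ _ => by rw [hD]; trivial) hQ
  rw [hD, Subgroup.coe_top] at hg
  have hgf' : ∀ u ∈ Q, ∀ hu : u ∈ cs.parabolic {a, b}, (g ⟨u, hu⟩ : W) = f u := fun u hu hu' => by
    rw [hgf ⟨u, hu'⟩ hu]
    exact cs.coe_retract_of_mem hJ (hf.mem_parabolic h1 ha hu hu')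
  have hg1 : (g 1 : W) = cs.simple a := (hgf' 1 hQ (one_mem _)).trans h1
  refine ⟨g, hg, hg1, fun u hu => ?_⟩
  have hF := IsMatchingOn.prod hJ hg
  -- Inside `⟨a, b⟩` the two agree by choice of `g`. For other `t`, `a` and `t` commute and both are
  -- left multiplication by `a`.
  refine hf.eqOn_of_eqOn_parabolic hF h1 (fun t u hu hut => ?_) hu
  by_cases ht : t ∈ ({a, b} : Set B)
  · have hu' : u ∈ cs.parabolic {a, b} := parabolic_mono (by
      rintro i (rfl | rfl)
      exacts [ha, ht]) hut
    have h2 : cs.retract hJ u = ⟨u, hu'⟩ := cs.retract_coe hJ ⟨u, hu'⟩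
    rw [h2, hgf' u hu hu', cs.retract_compl_of_mem hJ.compl hu', Subgroup.coe_one, one_mul]
  · have hta : t ≠ a := by rintro rfl; exact ht ha
    have hc := cs.simple_commute_of_eq_two (hJ a ha t ht)
    rw [hf.eq_simple_mul_of_commute h1 hta hc hu hut]
    refine (hF.eq_simple_mul_of_commute ?_ hta hc trivial hut).symm
    simpa using hg1

/-- A maximal matching `φ` of a degenerate Coxeter group is induced from the dihedral factor. -/
theorem exists_eq_prod_of_mem_maximalMatchings (hJ : M.IsDirectFactor {a, b})
    {φ : PartialMatching cs.Bruhat} (hφ : φ ∈ cs.maximalMatchings a) :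
    ∃ g, (cs.parabolicSystem hJ).IsMatchingOn Set.univ g ∧ (g 1 : W) = cs.simple a ∧
      ∀ x y, φ.Maps x y ↔ (cs.retract hJ.compl x : W) * (g (cs.retract hJ x) : W) = y := by
  obtain ⟨hmax, hφ1⟩ := hφ
  obtain ⟨hQ, h1⟩ := φ.maps_iff.1 hφ1
  obtain ⟨g, hg, hg1, hgf⟩ := φ.isMatchingOn.exists_eq_prod hJ h1 hQ
  have hF := IsMatchingOn.prod hJ hg
  refine ⟨g, hg, hg1, fun x y => ?_⟩
  constructor
  · intro h
    obtain ⟨hx, hy⟩ := φ.maps_iff.1 h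
    exact (hgf x hx).symm.trans hy
  · intro h
    -- The product matching extends `φ`, so maximality makes `φ` agree with it on all of `W`.
    refine (hmax (b := hF.toPartialMatching) ⟨Set.subset_univ _, fun x y hxy => ?_⟩).2 _ _
      (hF.toPartialMatching_maps.2 ⟨trivial, h⟩)
    obtain ⟨hx, hy⟩ := φ.maps_iff.1 hxy
    exact hF.toPartialMatching_maps.2 ⟨trivial, (hgf x hx).symm.trans hy⟩

/-- Each `φ` is the product matching of its dihedral part `g`, which gives injectivity. For
surjectivity, a maximal matching of the dihedral factor is total, so it induces a total matching of
`W`. -/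
theorem exists_restrict_bijective (hJ : M.IsDirectFactor {a, b}) :
    ∃ r : cs.maximalMatchings a →
        (cs.parabolicSystem hJ).maximalMatchings ⟨a, Set.mem_insert a {b}⟩,
      (∀ (φ : cs.maximalMatchings a) (x : cs.parabolic {a, b}),
        x ∈ (r φ).1.dom ↔ (x : W) ∈ φ.1.dom) ∧
      (∀ (φ : cs.maximalMatchings a) (x y : cs.parabolic {a, b}),
        (r φ).1.Maps x y → φ.1.Maps (x : W) (y : W)) ∧
      Function.Bijective r := by
  choose g hg hg1 hgφ using fun φ : cs.maximalMatchings a =>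
    exists_eq_prod_of_mem_maximalMatchings hJ φ.2
  have hmaps : ∀ (φ : cs.maximalMatchings a) (x : cs.parabolic {a, b}),
      φ.1.Maps (x : W) (g φ x : W) := fun φ x => (hgφ φ _ _).2 (by simp)
  refine ⟨fun φ => ⟨(hg φ).toPartialMatching,
    (hg φ).toPartialMatching_mem_maximalMatchings (Subtype.ext ?_)⟩, fun φ x => ?_,
    fun φ x y h => ?_, fun φ φ' h => ?_, fun ψ => ?_⟩
  · rw [hg1, coe_parabolicSystem_simple]
  · exact ⟨fun _ => (hmaps φ x).mem_dom, fun _ => trivial⟩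
  · rw [← ((hg φ).toPartialMatching_maps.1 h).2]
    exact hmaps φ x
  · have hgg : g φ = g φ' := by
      funext x
      have h1 : (hg φ).toPartialMatching.Maps x (g φ x) :=
        (hg φ).toPartialMatching_maps.2 ⟨trivial, rfl⟩
      have h2 := congrArg Subtype.val h
      dsimp only at h2
      rw [h2] at h1
      exact ((hg φ').toPartialMatching_maps.1 h1).2.symm
    refine Subtype.ext (PartialMatching.eq_of_maps_iff fun x y => ?_)
    rw [hgφ φ x y, hgφ φ' x y, hgg]
  · have hb : b ∈ ({a, b} : Set B) := Set.mem_insert_of_mem a rfl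
    have hdom := dom_eq_univ_of_pair (b := ⟨b, hb⟩) (by
      rintro ⟨i, rfl | rfl⟩
      · exact Or.inl rfl
      · exact Or.inr rfl) ψ.2
    have hψ := ψ.1.isMatchingOn
    rw [hdom] at hψ
    have hψ1 := (ψ.1.maps_iff.1 ψ.2.2).2
    have hF := IsMatchingOn.prod hJ hψ
    have hmem := hF.toPartialMatching_mem_maximalMatchings (a := a) (by
      rw [map_one, map_one, Subgroup.coe_one, one_mul, hψ1, coe_parabolicSystem_simple])
    have hgψ : ∀ x, g ⟨_, hmem⟩ x = ψ.1.toMap x := fun x => by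
      have h := (hF.toPartialMatching_maps.1 (hmaps ⟨_, hmem⟩ x)).2
      simp only [retract_coe, retract_compl_coe, Subgroup.coe_one, one_mul] at h
      exact (Subtype.ext h).symm
    refine ⟨⟨_, hmem⟩, Subtype.ext (PartialMatching.eq_of_maps_iff fun x y => ?_)⟩
    refine ((hg _).toPartialMatching_maps (x := x) (y := y)).trans
      (Iff.trans ?_ (ψ.1.maps_iff (x := x) (y := y)).symm)
    rw [hdom]
    exact and_congr_right fun _ => (hgψ x).symm ▸ Iff.rfl

end CoxeterSystem

theorem mainTheorem11 {B : Type*} {M : CoxeterMatrix B} {W : Type*} [Group W]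
    (cs : CoxeterSystem M W) (a : B) :
    -- left and right multiplication by `a` are maximal matchings defined on all of `W`, and
    -- outside the degenerate case they are the only ones
    (∃ L ∈ cs.maximalMatchings a, ∃ R ∈ cs.maximalMatchings a,
      (∀ w : W, L.Maps w (cs.simple a * w)) ∧
      (∀ w : W, R.Maps w (w * cs.simple a)) ∧
      ((¬ ∃ b, b ≠ a ∧ ∀ c, c ≠ a → c ≠ b → M a c = 2 ∧ M b c = 2) →
        {φ ∈ cs.maximalMatchings a | φ.dom = Set.univ} = {L, R})) ∧
    -- the degenerate case, where `C` is the complement of `{a, b}`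
    (∀ b, b ≠ a → (∀ c, c ≠ a → c ≠ b → M a c = 2 ∧ M b c = 2) →
      ∃ (csC : CoxeterSystem (M.restrict {a, b}ᶜ) (cs.parabolic {a, b}ᶜ))
        (csD : CoxeterSystem (M.restrict {a, b}) (cs.parabolic {a, b})),
        (∀ i, (csC.simple i : W) = cs.simple i) ∧
        (∀ i, (csD.simple i : W) = cs.simple i) ∧
        -- `W` is the direct product of the Coxeter groups `⟨C⟩` and `⟨a, b⟩`
        (∃ e : cs.parabolic {a, b}ᶜ × cs.parabolic {a, b} ≃* W,
          ∀ x y, e (x, y) = (x : W) * (y : W)) ∧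
        -- every maximal matching with `φ(e) = a` is `⟨C⟩`-regular, and it is defined on `W`
        (∀ φ ∈ cs.maximalMatchings a,
          (∀ c ∈ cs.parabolic {a, b}ᶜ, ∀ x y : W, φ.Maps x y → φ.Maps (c * x) (c * y)) ∧
          φ.dom = Set.univ) ∧
        -- restriction to `⟨a, b⟩` is a bijection
        (∃ r : cs.maximalMatchings a → csD.maximalMatchings ⟨a, Set.mem_insert a {b}⟩,
          (∀ (φ : cs.maximalMatchings a) (x : cs.parabolic {a, b}),
            x ∈ (r φ).1.dom ↔ (x : W) ∈ φ.1.dom) ∧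
          (∀ (φ : cs.maximalMatchings a) (x y : cs.parabolic {a, b}),
            (r φ).1.Maps x y → φ.1.Maps (x : W) (y : W)) ∧
          Function.Bijective r)) := by
  refine ⟨cs.exists_left_right_maximalMatchings a, fun b _ h => ?_⟩
  have hJ : M.IsDirectFactor {a, b} := by
    rintro i (rfl | rfl) j hj <;> rw [Set.mem_insert_iff, Set.mem_singleton_iff, not_or] at hj
    exacts [(h j hj.1 hj.2).1, (h j hj.1 hj.2).2]
  refine ⟨cs.parabolicSystem hJ.compl, cs.parabolicSystem hJ, cs.coe_parabolicSystem_simple _,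
    cs.coe_parabolicSystem_simple _, cs.exists_parabolic_prod_mulEquiv hJ, fun φ hφ => ?_,
    CoxeterSystem.exists_restrict_bijective hJ⟩
  obtain ⟨g, hg, hg1, hgφ⟩ := CoxeterSystem.exists_eq_prod_of_mem_maximalMatchings hJ hφ
  refine ⟨fun c hc x y hxy => ?_, Set.eq_univ_of_forall fun x => ((hgφ x _).2 rfl).mem_dom⟩
  refine (hgφ _ _).2 ?_
  rw [← (hgφ _ _).1 hxy, map_mul, map_mul, cs.retract_of_mem_compl hJ hc, one_mul, Subgroup.coe_mul,
    cs.coe_retract_of_mem hJ.compl hc, mul_assoc]
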